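/- Let $0<q<1$. Let $\mathcal A=\mathcal A(SU_q(2))$ be the unital complex $*$-algebra generated by $a,c$ with relations $ac=qca$, $ac^*=qc^*a$, $cc^*=c^*c$, $a^*a+c^*c=aa^*+q^2cc^*=1$, with the Hopf algebra structure $\Delta a=a\otimes a-qc^*\otimes c$, $\Delta c=c\otimes a+a^*\otimes c$, $\varepsilon(a)=1$, $\varepsilon(c)=0$, $S(a)=a^*$, $S(c)=-qc$ (and the $*$-conjugate formulas, with $S(a^*)=a$ and $S(c^*)=-q^{-1}c^*$). Let $\pi:\mathcal A\to\mathbb C[z,z^{-1}]$ be the Hopf algebra map with $\pi(a)=z$, $\pi(a^*)=z^{-1}$, $\pi(c)=\pi(c^*)=0$. For $n\in\mathbb Z$ put $\mathcal L_n=\{x\in\mathcal A:(\mathrm{id}\otimes\pi)\Delta(x)=x\otimes z^{-n}\}$, and let $\mathcal A(S^2_q)=\mathcal L_0$ be the coordinate algebra of the standard Podleś sphere. Let $\mathcal Q\subset\ker\varepsilon$ be the right ideal generated by the nine elements $c^2$, $c(a^*-a)$, $q^2a^{*2}-(1+q^2)(aa^*-cc^*)+a^2$, $c^*(a^*-a)$,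 $c^{*2}$, $tc$, $t(a^*-a)$, $tc^*$, $t\,[q^2a+a^*-(1+q^2)]$, where $t=q^2a+a^*-q^{-1}(1+q^4)$. The $4D_+$ bicovariant calculus on $SU_q(2)$ is the first order calculus given by $\mathcal Q$: one has $\Omega^1(SU_q(2))=\mathcal A\otimes(\ker\varepsilon/\mathcal Q)$, with left action on the first factor, right action $(x\otimes[y])h=xh_{(1)}\otimes[yh_{(2)}]$, and differential $dx=x_{(1)}\otimes[x_{(2)}-\varepsilon(x_{(2)})1]$. Let $\sigma$ be Woronowicz's braiding on $\Omega^1(SU_q(2))\otimes_{\mathcal A}\Omega^1(SU_q(2))$, that is, the bimodule map with $\sigma(\omega\otimes\eta)=\eta\otimes\omega$ for $\omega$ left invariant and $\eta$ right invariant. Let $\mathfrak A^{(k)}$ be the associated antisymmetriser on $\Omega^1(SU_q(2))^{\otimes_{\mathcal A}k}$. Then $\Omega^k(SU_q(2))=\Omega^1(SU_q(2))^{\otimes_{\mathcal A}k}/\ker\mathfrak A^{(k)}\cong\operatorname{Range}\mathfrak A^{(k)}$, with wedge product $\theta_1\wedge\dots\wedge\theta_k=\mathfrak A^{(k)}(\theta_1\otimes\dots\otimes\theta_k)$.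 Let $$\omega_-=c^*da^*-qa^*dc^*,\qquad \omega_+=a\,dc-qc\,da,$$ $$\omega_0=(1+q)^{-1}\lambda_1^{-1}\big[a^*da+c^*dc+q(a\,da^*+q^2c\,dc^*)\big],$$ where $\lambda_1=[\tfrac12][\tfrac32]$ and $[x]=(q^x-q^{-x})/(q-q^{-1})$. For $k=1,2,3$ let $\Omega^k(S^2_q)\subset\Omega^k(SU_q(2))$ be the degree $k$ part of the exterior algebra restricted to the sphere, that is, the linear span of the forms $b_0\,db_1\wedge\dots\wedge db_k$ with $b_0,\dots,b_k\in\mathcal A(S^2_q)$. **Proposition.** Each $\Omega^k(S^2_q)$ is an $\mathcal A(S^2_q)$-sub-bimodule of $\Omega^k(SU_q(2))$, and as such $$\Omega^1(S^2_q)=\mathcal L_{-2}\,\omega_-\oplus\mathcal L_2\,\omega_+\oplus\mathcal L_0\,\omega_0,$$ $$\Omega^2(S^2_q)=\mathcal L_{-2}\,(\omega_-\wedge\omega_0)\oplus\mathcal L_0\,(\omega_-\wedge\omega_+)\oplus\mathcal L_2\,(\omega_0\wedge\omega_+),$$ $$\Omega^3(S^2_q)=\mathcal L_0\,(\omega_-\wedge\omega_+\wedge\omega_0).$$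 Here $\mathcal L_n\,\theta=\{\varphi\theta:\varphi\in\mathcal L_n\}\subset\Omega^k(SU_q(2))$, each map $\mathcal L_n\to\mathcal L_n\,\theta$, $\varphi\mapsto\varphi\theta$, is bijective, the sums are direct, and the right-hand sides carry the bimodule structure of $\Omega^k(SU_q(2))$. -/

import Mathlib

open scoped TensorProduct

set_option linter.unusedSimpArgs false
set_option linter.unreachableTactic false
set_option linter.unusedTactic false
set_option linter.unnecessarySeqFocus false
set_option linter.style.longLine false

noncomputable section

namespace QuantumSphere

/-- The deformation parameter `0 < q < 1`. -/
abbrev Param : Type := Set.Ioo (0 : ℝ) 1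

/-- The deformation parameter as a complex number. -/
def qc (q : Param) : ℂ := ((q : ℝ) : ℂ)

theorem qc_ne_zero (q : Param) : qc q ≠ 0 := by
  simpa [qc] using q.2.1.ne'

/-! ### The Hopf algebra of the quantum group `SU_q(2)` -/

/-- The generators `a, a*, c, c*`. -/
inductive Gen
  | a | aStar | c | cStar

/-- The defining relations of the unital `*`-algebra generated by `a` and `c`:
`ac = q ca`, `ac* = q c*a`, `cc* = c*c`, `a*a + c*c = 1`, `aa* + q² cc* = 1`, together with the
adjoints `c*a* = q a*c*` and `ca* = q a*c` of the first two. -/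
inductive Rel (q : Param) : FreeAlgebra ℂ Gen → FreeAlgebra ℂ Gen → Prop
  | ac : Rel q (.ι ℂ .a * .ι ℂ .c) (qc q • (.ι ℂ .c * .ι ℂ .a))
  | acs : Rel q (.ι ℂ .a * .ι ℂ .cStar) (qc q • (.ι ℂ .cStar * .ι ℂ .a))
  | csas : Rel q (.ι ℂ .cStar * .ι ℂ .aStar) (qc q • (.ι ℂ .aStar * .ι ℂ .cStar))
  | cas : Rel q (.ι ℂ .c * .ι ℂ .aStar) (qc q • (.ι ℂ .aStar * .ι ℂ .c))
  | ccs : Rel q (.ι ℂ .c * .ι ℂ .cStar) (.ι ℂ .cStar * .ι ℂ .c)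
  | asa : Rel q (.ι ℂ .aStar * .ι ℂ .a + .ι ℂ .cStar * .ι ℂ .c) 1
  | aas : Rel q (.ι ℂ .a * .ι ℂ .aStar + qc q ^ 2 • (.ι ℂ .c * .ι ℂ .cStar)) 1

/-- The coordinate algebra `A(SU_q(2))`. -/
def SUq (q : Param) : Type := RingQuot (Rel q)

instance (q : Param) : Ring (SUq q) := inferInstanceAs (Ring (RingQuot (Rel q)))
instance (q : Param) : Algebra ℂ (SUq q) := inferInstanceAs (Algebra ℂ (RingQuot (Rel q)))

namespace SUq

/-- The generators in the algebra; `a'` and `c'` stand for `a*` and `c*`. -/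
def gen (q : Param) (x : Gen) : SUq q := RingQuot.mkAlgHom ℂ (Rel q) (FreeAlgebra.ι ℂ x)
def a (q : Param) : SUq q := gen q .a
def a' (q : Param) : SUq q := gen q .aStar
def c (q : Param) : SUq q := gen q .c
def c' (q : Param) : SUq q := gen q .cStar

section relations
variable (q : Param)

theorem a_mul_c : a q * c q = qc q • (c q * a q) := by
  simpa only [map_mul, map_smul, map_add, map_one] using! RingQuot.mkAlgHom_rel ℂ (Rel.ac (q := q))
theorem a_mul_c' : a q * c' q = qc q • (c' q * a q) := by
  simpa only [map_mul, map_smul, map_add, map_one] using! RingQuot.mkAlgHom_rel ℂ (Rel.acs (q := q))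
theorem c'_mul_a' : c' q * a' q = qc q • (a' q * c' q) := by
  simpa only [map_mul, map_smul, map_add, map_one] using! RingQuot.mkAlgHom_rel ℂ (Rel.csas (q := q))
theorem c_mul_a' : c q * a' q = qc q • (a' q * c q) := by
  simpa only [map_mul, map_smul, map_add, map_one] using! RingQuot.mkAlgHom_rel ℂ (Rel.cas (q := q))
theorem c_mul_c' : c q * c' q = c' q * c q := by
  simpa only [map_mul, map_smul, map_add, map_one] using! RingQuot.mkAlgHom_rel ℂ (Rel.ccs (q := q))
theorem a'_mul_a : a' q * a q + c' q * c q = 1 := by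
  simpa only [map_mul, map_smul, map_add, map_one] using! RingQuot.mkAlgHom_rel ℂ (Rel.asa (q := q))
theorem a_mul_a' : a q * a' q + qc q ^ 2 • (c q * c' q) = 1 := by
  simpa only [map_mul, map_smul, map_add, map_one] using! RingQuot.mkAlgHom_rel ℂ (Rel.aas (q := q))

end relations

/-- Four elements of a complex algebra that satisfy the relations of `A(SU_q(2))`. -/
structure IsRep (q : Param) {B : Type*} [Ring B] [Algebra ℂ B] (x x' y y' : B) : Prop where
  ac : x * y = qc q • (y * x)
  acs : x * y' = qc q • (y' * x)
  csas : y' * x' = qc q • (x' * y')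
  cas : y * x' = qc q • (x' * y)
  ccs : y * y' = y' * y
  asa : x' * x + y' * y = 1
  aas : x * x' + qc q ^ 2 • (y * y') = 1

/-- Algebra maps out of `A(SU_q(2))` are given by four elements satisfying the relations. -/
def lift (q : Param) {B : Type*} [Ring B] [Algebra ℂ B] {x x' y y' : B}
    (h : IsRep q x x' y y') : SUq q →ₐ[ℂ] B :=
  RingQuot.liftAlgHom ℂ ⟨FreeAlgebra.lift ℂ (fun
    | .a => x | .aStar => x' | .c => y | .cStar => y'), by
      intro u v r
      cases r <;> simp only [map_mul, map_smul, map_add, map_one, FreeAlgebra.lift_ι_apply]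
      exacts [h.ac, h.acs, h.csas, h.cas, h.ccs, h.asa, h.aas]⟩

section lift
variable (q : Param) {B : Type*} [Ring B] [Algebra ℂ B] {x x' y y' : B}
    (h : IsRep q x x' y y')

theorem lift_a : lift q h (a q) = x :=
  (RingQuot.liftAlgHom_mkAlgHom_apply ℂ _ _ _).trans (FreeAlgebra.lift_ι_apply _ _)
theorem lift_a' : lift q h (a' q) = x' :=
  (RingQuot.liftAlgHom_mkAlgHom_apply ℂ _ _ _).trans (FreeAlgebra.lift_ι_apply _ _)
theorem lift_c : lift q h (c q) = y :=
  (RingQuot.liftAlgHom_mkAlgHom_apply ℂ _ _ _).trans (FreeAlgebra.lift_ι_apply _ _)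
theorem lift_c' : lift q h (c' q) = y' :=
  (RingQuot.liftAlgHom_mkAlgHom_apply ℂ _ _ _).trans (FreeAlgebra.lift_ι_apply _ _)
end lift

theorem algHom_ext {q : Param} {B : Type*} [Ring B] [Algebra ℂ B] {f g : SUq q →ₐ[ℂ] B}
    (h1 : f (a q) = g (a q)) (h2 : f (a' q) = g (a' q))
    (h3 : f (c q) = g (c q)) (h4 : f (c' q) = g (c' q)) : f = g := by
  apply RingQuot.ringQuot_ext'
  apply FreeAlgebra.hom_ext
  funext x
  cases x
  · exact h1
  · exact h2
  · exact h3
  · exact h4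

theorem induction {q : Param} {P : SUq q → Prop} (h0 : ∀ r : ℂ, P (algebraMap ℂ _ r))
    (h1 : P (a q)) (h2 : P (a' q)) (h3 : P (c q)) (h4 : P (c' q))
    (hm : ∀ x y, P x → P y → P (x * y)) (ha : ∀ x y, P x → P y → P (x + y)) (x : SUq q) : P x := by
  obtain ⟨x, rfl⟩ := RingQuot.mkAlgHom_surjective ℂ (Rel q) x
  induction x using FreeAlgebra.induction with
  | grade0 r => simpa using! h0 r
  | grade1 x => cases x <;> assumption
  | mul x y hx hy => rw [map_mul]; exact hm _ _ hx hy
  | add x y hx hy => rw [map_add]; exact ha _ _ hx hy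


section normal
variable (q : Param)

theorem nf1 : c q * a q = (qc q)⁻¹ • (a q * c q) := by
  rw [a_mul_c, smul_smul, inv_mul_cancel₀ (qc_ne_zero q), one_smul]
theorem nf2 : c' q * a q = (qc q)⁻¹ • (a q * c' q) := by
  rw [a_mul_c', smul_smul, inv_mul_cancel₀ (qc_ne_zero q), one_smul]
theorem nf3 : a' q * a q = 1 - c q * c' q := by
  rw [← a'_mul_a q, c_mul_c']; abel
theorem nf4 : a q * a' q = 1 - qc q ^ 2 • (c q * c' q) := by
  rw [← a_mul_a' q]; abel
theorem nf1' (x : SUq q) : c q * (a q * x) = (qc q)⁻¹ • (a q * (c q * x)) := by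
  rw [← mul_assoc, nf1, smul_mul_assoc, mul_assoc]
theorem nf2' (x : SUq q) : c' q * (a q * x) = (qc q)⁻¹ • (a q * (c' q * x)) := by
  rw [← mul_assoc, nf2, smul_mul_assoc, mul_assoc]
theorem nf3' (x : SUq q) : a' q * (a q * x) = x - c q * (c' q * x) := by
  rw [← mul_assoc, nf3, sub_mul, one_mul, mul_assoc]
theorem nf4' (x : SUq q) : a q * (a' q * x) = x - qc q ^ 2 • (c q * (c' q * x)) := by
  rw [← mul_assoc, nf4, sub_mul, one_mul, smul_mul_assoc, mul_assoc]
theorem nf5' (x : SUq q) : c q * (a' q * x) = qc q • (a' q * (c q * x)) := by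
  rw [← mul_assoc, c_mul_a', smul_mul_assoc, mul_assoc]
theorem nf6' (x : SUq q) : c' q * (a' q * x) = qc q • (a' q * (c' q * x)) := by
  rw [← mul_assoc, c'_mul_a', smul_mul_assoc, mul_assoc]
theorem nf7' (x : SUq q) : c' q * (c q * x) = c q * (c' q * x) := by
  rw [← mul_assoc, ← c_mul_c', mul_assoc]
end normal

open TensorProduct in
theorem isRep_Δ (q : Param) :
    IsRep q (a q ⊗ₜ[ℂ] a q - qc q • (c' q ⊗ₜ[ℂ] c q)) (a' q ⊗ₜ a' q - qc q • (c q ⊗ₜ c' q))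
      (c q ⊗ₜ a q + a' q ⊗ₜ c q) (c' q ⊗ₜ a' q + a q ⊗ₜ c' q) := by
  have := qc_ne_zero q
  constructor <;>
  · simp only [mul_add, add_mul, mul_sub, sub_mul, smul_mul_assoc, mul_smul_comm, smul_add,
      smul_sub, Algebra.TensorProduct.tmul_mul_tmul, nf1, nf2, nf3, nf4, c_mul_a', c'_mul_a',
      ← c_mul_c', tmul_add, tmul_sub, add_tmul, sub_tmul, tmul_smul, ← smul_tmul',
      Algebra.TensorProduct.one_def]
    match_scalars <;> (try field_simp) <;> ring

/-- The coproduct: `Δ a = a ⊗ a - q c* ⊗ c`, `Δ c = c ⊗ a + a* ⊗ c`, and adjoints. -/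
def Δ (q : Param) : SUq q →ₐ[ℂ] SUq q ⊗[ℂ] SUq q := lift q (isRep_Δ q)

theorem isRep_ε (q : Param) : IsRep q (1 : ℂ) 1 0 0 := by constructor <;> simp

/-- The counit: `ε a = ε a* = 1`, `ε c = ε c* = 0`. -/
def ε (q : Param) : SUq q →ₐ[ℂ] ℂ := lift q (isRep_ε q)

section
variable (q : Param)
theorem Δ_a : Δ q (a q) = a q ⊗ₜ a q - qc q • (c' q ⊗ₜ c q) := lift_a ..
theorem Δ_a' : Δ q (a' q) = a' q ⊗ₜ a' q - qc q • (c q ⊗ₜ c' q) := lift_a' ..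
theorem Δ_c : Δ q (c q) = c q ⊗ₜ a q + a' q ⊗ₜ c q := lift_c ..
theorem Δ_c' : Δ q (c' q) = c' q ⊗ₜ a' q + a q ⊗ₜ c' q := lift_c' ..
theorem ε_a : ε q (a q) = 1 := lift_a ..
theorem ε_a' : ε q (a' q) = 1 := lift_a' ..
theorem ε_c : ε q (c q) = 0 := lift_c ..
theorem ε_c' : ε q (c' q) = 0 := lift_c' ..
end

open TensorProduct in
instance (q : Param) : Bialgebra ℂ (SUq q) :=
  Bialgebra.ofAlgHom (Δ q) (ε q)
    (by
      apply algHom_ext <;>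
        simp [Δ_a, Δ_a', Δ_c, Δ_c', tmul_add, add_tmul, tmul_sub, sub_tmul, ← smul_tmul',
          smul_sub, smul_add] <;> abel)
    (by apply algHom_ext <;> simp [Δ_a, Δ_a', Δ_c, Δ_c', ε_a, ε_a', ε_c, ε_c'])
    (by apply algHom_ext <;> simp [Δ_a, Δ_a', Δ_c, Δ_c', ε_a, ε_a', ε_c, ε_c'])

theorem isRep_antip (q : Param) : IsRep q (B := (SUq q)ᵐᵒᵖ) (.op (a' q)) (.op (a q))
    (.op (-(qc q • c q))) (.op (-((qc q)⁻¹ • c' q))) := by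
  have := qc_ne_zero q
  constructor <;> apply MulOpposite.unop_injective <;>
  · simp only [MulOpposite.unop_mul, MulOpposite.unop_op, MulOpposite.unop_smul,
      MulOpposite.unop_add, MulOpposite.unop_one, mul_neg, neg_mul, smul_mul_assoc, mul_smul_comm,
      nf1, nf2, nf3, nf4, c_mul_a', c'_mul_a', ← c_mul_c']
    match_scalars <;> field_simp <;> ring

/-- The antipode as an algebra map into the opposite algebra: `S a = a*`, `S a* = a`,
`S c = -q c`, `S c* = -q⁻¹ c*`. -/
def antip (q : Param) : SUq q →ₐ[ℂ] (SUq q)ᵐᵒᵖ := lift q (isRep_antip q)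

section
variable (q : Param)
theorem antip_a : antip q (a q) = .op (a' q) := lift_a ..
theorem antip_a' : antip q (a' q) = .op (a q) := lift_a' ..
theorem antip_c : antip q (c q) = .op (-(qc q • c q)) := lift_c ..
theorem antip_c' : antip q (c' q) = .op (-((qc q)⁻¹ • c' q)) := lift_c' ..

/-- The antipode as a linear map. -/
def S : SUq q →ₗ[ℂ] SUq q := (MulOpposite.opLinearEquiv ℂ).symm.toLinearMap ∘ₗ (antip q).toLinearMap

theorem S_mul (x y : SUq q) : S q (x * y) = S q y * S q x := by simp [S]
theorem S_a : S q (a q) = a' q := by simp [S, antip_a]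
theorem S_a' : S q (a' q) = a q := by simp [S, antip_a']
theorem S_c : S q (c q) = -(qc q • c q) := by simp [S, antip_c]
theorem S_c' : S q (c' q) = -((qc q)⁻¹ • c' q) := by simp [S, antip_c']
theorem S_one : S q 1 = 1 := by simp [S]

end

theorem mul_rTensor_S (q : Param) (u : SUq q ⊗[ℂ] SUq q) (x y : SUq q) :
    LinearMap.mul' ℂ _ ((S q).rTensor _ (u * x ⊗ₜ y)) =
      S q x * LinearMap.mul' ℂ _ ((S q).rTensor _ u) * y := by
  induction u with
  | zero => simp
  | add u v hu hv => simp only [add_mul, map_add, hu, hv, mul_add]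
  | tmul u v => simp [S_mul, mul_assoc]

theorem mul_lTensor_S (q : Param) (u : SUq q ⊗[ℂ] SUq q) (x y : SUq q) :
    LinearMap.mul' ℂ _ ((S q).lTensor _ (x ⊗ₜ y * u)) =
      x * LinearMap.mul' ℂ _ ((S q).lTensor _ u) * S q y := by
  induction u with
  | zero => simp
  | add u v hu hv => simp only [add_mul, map_add, hu, hv, mul_add]
  | tmul u v => simp [S_mul, mul_assoc]

theorem mul_antip_comul (q : Param) (x : SUq q) :
    LinearMap.mul' ℂ _ ((S q).rTensor _ (Δ q x)) = algebraMap ℂ _ (ε q x) := by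
  induction x using induction with
  | h0 r => simp [Algebra.TensorProduct.algebraMap_apply, Algebra.algebraMap_eq_smul_one, S_one,
      Algebra.TensorProduct.one_def]
  | h1 => simp [Δ_a, ε_a, S_a, S_c', nf3, smul_smul, qc_ne_zero, ← c_mul_c']
  | h2 => simp [Δ_a', ε_a', S_a', S_c, nf4, smul_smul, qc_ne_zero, ← c_mul_c', sq]
  | h3 => simp [Δ_c, ε_c, S_a', S_c, a_mul_c]
  | h4 => simp [Δ_c', ε_c', S_a, S_c', c'_mul_a', smul_smul, qc_ne_zero]
  | hm x y hx hy =>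
    rw [map_mul]
    have : ∀ v : SUq q ⊗[ℂ] SUq q, LinearMap.mul' ℂ _ ((S q).rTensor _ (Δ q x * v)) =
        ε q x • LinearMap.mul' ℂ _ ((S q).rTensor _ v) := by
      intro v
      induction v with
      | zero => simp
      | add u v hu hv => simp only [mul_add, map_add, hu, hv, smul_add]
      | tmul u v => simp [mul_rTensor_S, hx, Algebra.algebraMap_eq_smul_one]
    rw [this, hy, map_mul, map_mul, Algebra.smul_def]
  | ha x y hx hy => simp only [map_add, hx, hy]

theorem mul_comul_antip (q : Param) (x : SUq q) :
    LinearMap.mul' ℂ _ ((S q).lTensor _ (Δ q x)) = algebraMap ℂ _ (ε q x) := by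
  induction x using induction with
  | h0 r => simp [Algebra.TensorProduct.algebraMap_apply, Algebra.algebraMap_eq_smul_one, S_one,
      Algebra.TensorProduct.one_def]
  | h1 => simp [Δ_a, ε_a, S_a, S_c, nf4, smul_smul, qc_ne_zero, ← c_mul_c', sq]
  | h2 => simp [Δ_a', ε_a', S_a', S_c', nf3, smul_smul, qc_ne_zero, ← c_mul_c']
  | h3 => simp [Δ_c, ε_c, S_a, S_c, c_mul_a']
  | h4 => simp [Δ_c', ε_c', S_a', S_c', a_mul_c', smul_smul, qc_ne_zero]
  | hm x y hx hy =>
    rw [map_mul]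
    have : ∀ v : SUq q ⊗[ℂ] SUq q, LinearMap.mul' ℂ _ ((S q).lTensor _ (v * Δ q y)) =
        ε q y • LinearMap.mul' ℂ _ ((S q).lTensor _ v) := by
      intro v
      induction v with
      | zero => simp
      | add u v hu hv => simp only [add_mul, map_add, hu, hv, smul_add]
      | tmul u v => simp [mul_lTensor_S, hy, Algebra.algebraMap_eq_smul_one]
    rw [this, hx, map_mul, map_mul, Algebra.smul_def, Algebra.commutes]
  | ha x y hx hy => simp only [map_add, hx, hy]

instance (q : Param) : HopfAlgebra ℂ (SUq q) where
  antipode := S q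
  mul_antipode_rTensor_comul := LinearMap.ext (mul_antip_comul q)
  mul_antipode_lTensor_comul := LinearMap.ext (mul_comul_antip q)

end SUq

section calculus

variable (H : Type*) [Ring H] [HopfAlgebra ℂ H]

/-- The right adjoint coaction `Ad h = h₍₂₎ ⊗ S(h₍₁₎) h₍₃₎`. -/
def adjointCoaction : H →ₗ[ℂ] H ⊗[ℂ] H :=
  (LinearMap.mul' ℂ H).lTensor H ∘ₗ (TensorProduct.leftComm ℂ H H H).toLinearMap ∘ₗ
    TensorProduct.map (HopfAlgebra.antipode ℂ) Coalgebra.comul ∘ₗ Coalgebra.comul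

/-- The kernel of the counit, as a right ideal (right ideals of `H` are submodules over `Hᵐᵒᵖ`). -/
def augmentation : Submodule Hᵐᵒᵖ H where
  carrier := {x | Coalgebra.counit (R := ℂ) x = 0}
  add_mem' := by intro x y hx hy; simp_all
  zero_mem' := by simp
  smul_mem' := by intro y x hx; simp_all [Bialgebra.counit_mul]

/-- The data of a bicovariant first order calculus on `H`: a right ideal `Q ⊆ ker ε` with
`Ad Q ⊆ Q ⊗ H`. -/
structure CalculusIdeal where
  ideal : Submodule Hᵐᵒᵖ H
  le_augmentation : ideal ≤ augmentation H
  ad_mem : ∀ x ∈ ideal, adjointCoaction H x ∈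
    LinearMap.range ((ideal.restrictScalars ℂ).subtype.rTensor H)

variable {H}

/-- A right `H`-module structure on `W`, as an algebra map from `Hᵐᵒᵖ` to endomorphisms of `W`. -/
abbrev RAct (H : Type*) [Ring H] [HopfAlgebra ℂ H] (W : Type*) [AddCommGroup W] [Module ℂ W] :
    Type _ := Hᵐᵒᵖ →ₐ[ℂ] Module.End ℂ W

namespace RAct

variable {V W W' : Type*} [AddCommGroup V] [Module ℂ V] [AddCommGroup W] [Module ℂ W]
  [AddCommGroup W'] [Module ℂ W']

/-- The diagonal right action `(v ⊗ w) · h = v · h₍₁₎ ⊗ w · h₍₂₎`. -/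
def tensor (ρ : RAct H V) (τ : RAct H W) : RAct H (V ⊗[ℂ] W) :=
  (Module.endTensorEndAlgHom (R := ℂ) (S := ℂ) (A := ℂ)).comp
    ((Algebra.TensorProduct.map ρ τ).comp
      ((Algebra.TensorProduct.opAlgEquiv ℂ ℂ H H).symm.toAlgHom.comp
        (AlgHom.op (Bialgebra.comulAlgHom ℂ H))))

/-- The right action `(x ⊗ w) · h = x h₍₁₎ ⊗ w · h₍₂₎` on the bimodule `H ⊗ W`. -/
def forms (ρ : RAct H W) : RAct H (H ⊗[ℂ] W) :=
  RAct.tensor (Algebra.lsmul ℂ ℂ H : RAct H H) ρ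

/-- The product `(H ⊗ W) ⊗_H (H ⊗ W') = H ⊗ (W ⊗ W')`, that is `θ ⊗_H (y ⊗ w) = (θ · y) ⊗ w`. -/
def mulTensor (ρ : RAct H W) (θ : H ⊗[ℂ] W) (η : H ⊗[ℂ] W') : H ⊗[ℂ] (W ⊗[ℂ] W') :=
  TensorProduct.assoc ℂ H W W' (LinearMap.rTensor W'
    (LinearMap.flip (ρ.forms.toLinearMap ∘ₗ (MulOpposite.opLinearEquiv ℂ).toLinearMap) θ) η)

theorem forms_tmul (ρ : RAct H W) (x h : H) (w : W) :
    ρ.forms (.op h) (x ⊗ₜ w) = TensorProduct.map (LinearMap.mulLeft ℂ x)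
      (LinearMap.flip (ρ.toLinearMap ∘ₗ (MulOpposite.opLinearEquiv ℂ).toLinearMap) w)
      (Coalgebra.comul h) := by
  simp only [forms, tensor, AlgHom.comp_apply, AlgHom.op_apply_apply, MulOpposite.unop_op,
    Bialgebra.comulAlgHom_apply]
  generalize Coalgebra.comul (R := ℂ) h = u
  induction u with
  | zero => simp
  | add u v hu hv =>
    simp only [map_add, MulOpposite.op_add, LinearMap.add_apply] at hu hv ⊢
    rw [hu, hv]
  | tmul u v =>
    simp [Module.endTensorEndAlgHom_apply]

theorem mulTensor_tmul (ρ : RAct H W) (θ : H ⊗[ℂ] W) (y : H) (w : W') :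
    ρ.mulTensor θ (y ⊗ₜ w) = TensorProduct.assoc ℂ H W W' (ρ.forms (.op y) θ ⊗ₜ w) := rfl

end RAct

namespace CalculusIdeal

variable (C : CalculusIdeal H)

/-- The space `ker ε / Q` of left invariant one-forms, with its right `H`-module structure. -/
abbrev Inv : Type _ := augmentation H ⧸ C.ideal.submoduleOf (augmentation H)

/-- The map `x ↦ [x - ε(x) 1]` onto left invariant one-forms. -/
def cls : H →ₗ[ℂ] C.Inv where
  toFun x := Submodule.Quotient.mk
    ⟨x - Coalgebra.counit (R := ℂ) x • 1, by simp [augmentation]⟩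
  map_add' x y := by
    rw [← Submodule.Quotient.mk_add]
    congr 1
    ext
    simp [add_smul]
    abel
  map_smul' r x := by
    rw [RingHom.id_apply, ← Submodule.Quotient.mk_smul]
    congr 1
    ext
    simp [smul_sub, mul_smul]

theorem cls_eq_zero {x : H} (hx : x ∈ C.ideal) : C.cls x = 0 := by
  have h : Coalgebra.counit (R := ℂ) x = 0 := C.le_augmentation hx
  refine (Submodule.Quotient.mk_eq_zero _).2 ?_
  simpa [Submodule.submoduleOf, h] using hx

theorem cls_rTensor_ad {x : H} (hx : x ∈ C.ideal) :
    C.cls.rTensor H (adjointCoaction H x) = 0 := by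
  obtain ⟨u, hu⟩ := C.ad_mem x hx
  rw [← hu, ← LinearMap.comp_apply, ← LinearMap.rTensor_comp]
  have : C.cls ∘ₗ (C.ideal.restrictScalars ℂ).subtype = 0 := by
    ext y
    exact C.cls_eq_zero y.2
  simp [this]

/-- The right coaction on left invariant one-forms, induced by `Ad`. -/
def coaction : C.Inv →ₗ[ℂ] C.Inv ⊗[ℂ] H :=
  ((C.ideal.submoduleOf (augmentation H)).restrictScalars ℂ).liftQ
    (C.cls.rTensor H ∘ₗ adjointCoaction H ∘ₗ ((augmentation H).restrictScalars ℂ).subtype)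
    (by intro x hx; exact C.cls_rTensor_ad hx) ∘ₗ
  (Submodule.Quotient.restrictScalarsEquiv ℂ
    (C.ideal.submoduleOf (augmentation H))).symm.toLinearMap

theorem coaction_cls (x : H) (hx : x ∈ augmentation H) :
    C.coaction (Submodule.Quotient.mk ⟨x, hx⟩) = C.cls.rTensor H (adjointCoaction H x) := rfl

/-- The right action of `H` on left invariant one-forms, `[x] · h = [x h]`. -/
def invAct : RAct H C.Inv := Algebra.lsmul ℂ ℂ C.Inv

/-- The bimodule `Ω¹(H) = H ⊗ (ker ε / Q)` of one-forms, which is the quotient of the universal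
one-forms by the sub-bimodule `r⁻¹(H ⊗ Q)`, where `r (x ⊗ y) = (x ⊗ 1) Δ(y)`. The left action is by left multiplication
on the first factor; the right action is `RAct.forms C.invAct`. -/
abbrev OneForms : Type _ := H ⊗[ℂ] C.Inv

/-- The differential `d x = x₍₁₎ ⊗ [x₍₂₎ - ε(x₍₂₎) 1]`. -/
def d : H →ₗ[ℂ] C.OneForms := C.cls.lTensor H ∘ₗ Coalgebra.comul

/-- The Leibniz rule. -/
theorem d_mul (x y : H) : C.d (x * y) = x • C.d y + C.invAct.forms (.op y) (C.d x) := by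
  have key : ∀ x y : H, C.cls (x * y) = Coalgebra.counit (R := ℂ) x • C.cls y + C.invAct (.op y) (C.cls x) := by
    intro x y
    change Submodule.Quotient.mk _ = Coalgebra.counit (R := ℂ) x • Submodule.Quotient.mk _ + Submodule.Quotient.mk _
    rw [← Submodule.Quotient.mk_smul, ← Submodule.Quotient.mk_add]
    congr 1; ext
    simp [sub_mul, smul_sub, mul_smul]
  have k2 : ∀ u : H ⊗[ℂ] H, C.cls.lTensor H (u * Coalgebra.comul y) =
      (TensorProduct.rid ℂ H ((Coalgebra.counit (R:=ℂ)).lTensor H u)) • C.cls.lTensor H (Coalgebra.comul y)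
      + C.invAct.forms (.op y) (C.cls.lTensor H u) := by
    intro u
    induction u with
    | zero => simp
    | add u v hu hv => simp only [add_mul, map_add, hu, hv, add_smul]; abel
    | tmul x1 x2 =>
      simp only [LinearMap.lTensor_tmul, RAct.forms_tmul]
      generalize Coalgebra.comul (R := ℂ) y = v
      induction v with
      | zero => simp
      | add u v hu hv => simp only [mul_add, map_add, hu, hv, smul_add]; abel
      | tmul u v => simp [key, TensorProduct.tmul_add, TensorProduct.smul_tmul']
  have := k2 (Coalgebra.comul x)
  rw [← Bialgebra.comul_mul, Coalgebra.lTensor_counit_comul] at this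
  rw [Bialgebra.comul_mul] at this; simp only [CalculusIdeal.d, LinearMap.comp_apply, Bialgebra.comul_mul]; simpa using this

/-- The braiding on left invariant one-forms: `σ(v ⊗ w) = w₍₀₎ ⊗ v · w₍₁₎`. It is the restriction of
the unique bimodule map `σ` on `Ω¹ ⊗_H Ω¹` with `σ(ω ⊗ η) = η ⊗ ω` for `ω` left invariant and `η`
right invariant. -/
def braiding : Module.End ℂ (C.Inv ⊗[ℂ] C.Inv) :=
  (TensorProduct.lift (LinearMap.flip
    (C.invAct.toLinearMap ∘ₗ (MulOpposite.opLinearEquiv ℂ).toLinearMap))).lTensor C.Inv ∘ₗ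
  (TensorProduct.leftComm ℂ C.Inv C.Inv H).toLinearMap ∘ₗ C.coaction.lTensor C.Inv

/-- The braiding in the first two of three factors. -/
def braiding₁ : Module.End ℂ (C.Inv ⊗[ℂ] (C.Inv ⊗[ℂ] C.Inv)) :=
  (TensorProduct.assoc ℂ C.Inv C.Inv C.Inv).toLinearMap ∘ₗ C.braiding.rTensor C.Inv ∘ₗ
    (TensorProduct.assoc ℂ C.Inv C.Inv C.Inv).symm.toLinearMap

/-- The braiding in the last two of three factors. -/
def braiding₂ : Module.End ℂ (C.Inv ⊗[ℂ] (C.Inv ⊗[ℂ] C.Inv)) := C.braiding.lTensor C.Inv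

/-- The antisymmetriser `1 - σ` in degree two. Tensored with the identity of `H` it is the
antisymmetriser of `Ω¹ ⊗_H Ω¹`, as `σ` is left `H`-linear. -/
def antisymm₂ : Module.End ℂ (C.Inv ⊗[ℂ] C.Inv) := 1 - C.braiding

/-- The antisymmetriser in degree three: the signed sum over the symmetric group `S₃` of the
braidings attached to reduced words. -/
def antisymm₃ : Module.End ℂ (C.Inv ⊗[ℂ] (C.Inv ⊗[ℂ] C.Inv)) :=
  1 - C.braiding₁ - C.braiding₂ + C.braiding₁ * C.braiding₂ + C.braiding₂ * C.braiding₁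
    - C.braiding₁ * C.braiding₂ * C.braiding₁

/-- `Ω¹ ⊗_H Ω¹ = H ⊗ Inv ⊗ Inv`, which contains `Ω²(H) = Ω¹ ⊗_H Ω¹ / ker (1 - σ)` as the range of
the antisymmetriser. -/
abbrev TwoTensors : Type _ := H ⊗[ℂ] (C.Inv ⊗[ℂ] C.Inv)

/-- `Ω¹ ⊗_H Ω¹ ⊗_H Ω¹ = H ⊗ Inv ⊗ Inv ⊗ Inv`, which contains `Ω³(H)` as the range of the
antisymmetriser. -/
abbrev ThreeTensors : Type _ := H ⊗[ℂ] (C.Inv ⊗[ℂ] (C.Inv ⊗[ℂ] C.Inv))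

/-- The space of left invariant 2-tensors as a right `H`-module. -/
def invAct₂ : RAct H (C.Inv ⊗[ℂ] C.Inv) := C.invAct.tensor C.invAct

/-- The space of left invariant 3-tensors as a right `H`-module. -/
def invAct₃ : RAct H (C.Inv ⊗[ℂ] (C.Inv ⊗[ℂ] C.Inv)) := C.invAct.tensor C.invAct₂

/-- The wedge product `θ ∧ η = (1 - σ)(θ ⊗_H η)` of two one-forms. -/
def wedge₂ (θ η : C.OneForms) : C.TwoTensors :=
  C.antisymm₂.lTensor H (C.invAct.mulTensor θ η)

/-- The wedge product `θ ∧ η ∧ ζ`, the antisymmetrisation of `θ ⊗_H η ⊗_H ζ`. -/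
def wedge₃ (θ η ζ : C.OneForms) : C.ThreeTensors :=
  C.antisymm₃.lTensor H (C.invAct.mulTensor θ (C.invAct.mulTensor η ζ))

section restriction

variable (B : Subalgebra ℂ H)

/-- One-forms of the calculus restricted to a subalgebra `B`: the span of `b₀ d b₁`. -/
def restrict₁ : Submodule B C.OneForms :=
  Submodule.span B {θ | ∃ x ∈ B, θ = C.d x}

/-- Two-forms of the exterior algebra restricted to `B`: the span of `b₀ d b₁ ∧ d b₂`. -/
def restrict₂ : Submodule B C.TwoTensors :=
  Submodule.span B {θ | ∃ x ∈ B, ∃ y ∈ B, θ = C.wedge₂ (C.d x) (C.d y)}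

/-- Three-forms of the exterior algebra restricted to `B`: the span of
`b₀ d b₁ ∧ d b₂ ∧ d b₃`. -/
def restrict₃ : Submodule B C.ThreeTensors :=
  Submodule.span B {θ | ∃ x ∈ B, ∃ y ∈ B, ∃ z ∈ B, θ = C.wedge₃ (C.d x) (C.d y) (C.d z)}

end restriction

end CalculusIdeal
end calculus

namespace SUq
/-- The nine generators of the right ideal of the `4D₊` calculus. -/
def idealGen (q : Param) : Fin 9 → SUq q :=
  let t := qc q ^ 2 • a q + a' q
  let k := (qc q)⁻¹ * (1 + qc q ^ 4)
  ![c q * c q,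
    c q * (a' q - a q),
    qc q ^ 2 • (a' q * a' q) - (1 + qc q ^ 2) • (a q * a' q - c q * c' q) + a q * a q,
    c' q * (a' q - a q),
    c' q * c' q,
    (t - k • 1) * c q,
    (t - k • 1) * (a' q - a q),
    (t - k • 1) * c' q,
    (t - k • 1) * (t - (1 + qc q ^ 2) • 1)]

open TensorProduct
section
variable (q : Param)

theorem idealGen0 : idealGen q 0 = c q * c q := rfl
theorem idealGen1 : idealGen q 1 = c q * (a' q - a q) := rfl
theorem idealGen2 : idealGen q 2 =  qc q ^ 2 • (a' q * a' q) - (1 + qc q ^ 2) • (a q * a' q - c q * c' q) + a q * a q := rfl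
theorem idealGen3 : idealGen q 3 = c' q * (a' q - a q) := rfl
theorem idealGen5 : idealGen q 5 = (qc q ^ 2 • a q + a' q - ((qc q)⁻¹ * (1 + qc q ^ 4)) • 1) * c q := rfl
theorem idealGen6 : idealGen q 6 =
    (qc q ^ 2 • a q + a' q - ((qc q)⁻¹ * (1 + qc q ^ 4)) • 1) * (a' q - a q) := rfl
theorem idealGen7 : idealGen q 7 =
    (qc q ^ 2 • a q + a' q - ((qc q)⁻¹ * (1 + qc q ^ 4)) • 1) * c' q := rfl
theorem idealGen8 : idealGen q 8 = (qc q ^ 2 • a q + a' q - ((qc q)⁻¹ * (1 + qc q ^ 4)) • 1) *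
    (qc q ^ 2 • a q + a' q - (1 + qc q ^ 2) • 1) := rfl
theorem idealGen4 : idealGen q 4 = c' q * c' q := rfl

/-- The map `x ⊗ y ⊗ z ↦ y ⊗ S(x) z`. -/
def adMap : SUq q ⊗[ℂ] (SUq q ⊗[ℂ] SUq q) →ₗ[ℂ] SUq q ⊗[ℂ] SUq q :=
  (LinearMap.mul' ℂ (SUq q)).lTensor _ ∘ₗ (TensorProduct.leftComm ℂ _ _ _).toLinearMap ∘ₗ
    (S q).rTensor _

theorem adMap_tmul (x y z : SUq q) : adMap q (x ⊗ₜ (y ⊗ₜ z)) = y ⊗ₜ (S q x * z) := by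
  simp [adMap]

/-- The iterated coproduct. -/
def comul3 : SUq q →ₐ[ℂ] SUq q ⊗[ℂ] (SUq q ⊗[ℂ] SUq q) :=
  (Algebra.TensorProduct.map (.id ℂ _) (Δ q)).comp (Δ q)

theorem comul3_a : comul3 q (a q) = a q ⊗ₜ (a q ⊗ₜ a q - qc q • (c' q ⊗ₜ c q)) -
    qc q • (c' q ⊗ₜ (c q ⊗ₜ a q + a' q ⊗ₜ c q)) := by simp [comul3, Δ_a, Δ_c]
theorem comul3_a' : comul3 q (a' q) = a' q ⊗ₜ (a' q ⊗ₜ a' q - qc q • (c q ⊗ₜ c' q)) -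
    qc q • (c q ⊗ₜ (c' q ⊗ₜ a' q + a q ⊗ₜ c' q)) := by simp [comul3, Δ_a', Δ_c']
theorem comul3_c : comul3 q (c q) = c q ⊗ₜ (a q ⊗ₜ a q - qc q • (c' q ⊗ₜ c q)) +
    a' q ⊗ₜ (c q ⊗ₜ a q + a' q ⊗ₜ c q) := by simp [comul3, Δ_a, Δ_c]
theorem comul3_c' : comul3 q (c' q) = c' q ⊗ₜ (a' q ⊗ₜ a' q - qc q • (c q ⊗ₜ c' q)) +
    a q ⊗ₜ (c' q ⊗ₜ a' q + a q ⊗ₜ c' q) := by simp [comul3, Δ_a', Δ_c']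

theorem ad_apply (x : SUq q) : adjointCoaction (SUq q) x = adMap q (comul3 q x) := by
  change (LinearMap.mul' ℂ (SUq q)).lTensor _ ((TensorProduct.leftComm ℂ _ _ _)
    (TensorProduct.map (S q) (Δ q).toLinearMap (Δ q x))) = _
  simp only [adMap, comul3, LinearMap.comp_apply, AlgHom.comp_apply]
  generalize Δ q x = u
  induction u with
  | zero => simp
  | add u v hu hv => simp only [map_add, hu, hv]
  | tmul u v => simp

set_option maxHeartbeats 4000000 in
theorem ad_g1 : adjointCoaction (SUq q) (idealGen q 0) =
    idealGen q 0 ⊗ₜ ((a q * (a q * (a q * a q)))) +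
    idealGen q 1 ⊗ₜ (((qc q)⁻¹ ^ 2 + 1) • (a q * (a q * (a q * c q)))) +
    idealGen q 2 ⊗ₜ (((qc q)⁻¹ ^ 2) • (a q * (a q * (c q * c q)))) +
    idealGen q 3 ⊗ₜ ((1 + qc q ^ 2) • (a q * (c q * (c q * c q)))) +
    idealGen q 4 ⊗ₜ ((qc q ^ 4) • (c q * (c q * (c q * c q)))) := by
  simp only [ad_apply, idealGen0, idealGen1, idealGen2, idealGen3, idealGen4, map_mul, map_add, map_sub, map_smul, map_one, comul3_a, comul3_a', comul3_c, comul3_c',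
    mul_add, add_mul, mul_sub, sub_mul, smul_mul_assoc, mul_smul_comm, smul_add, smul_sub, smul_neg,
    neg_mul, mul_neg, Algebra.TensorProduct.tmul_mul_tmul, Algebra.TensorProduct.one_def, tmul_add,
    tmul_sub, add_tmul, sub_tmul, tmul_smul, ← smul_tmul', tmul_neg, neg_tmul, adMap_tmul, mul_one,
    one_mul, S_mul, S_a, S_a', S_c, S_c', S_one, mul_assoc, nf1, nf2, nf3, nf4, c_mul_a', c'_mul_a',
    ← c_mul_c', nf1', nf2', nf3', nf4', nf5', nf6', nf7']
  have := qc_ne_zero q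
  match_scalars <;> (try field_simp) <;> ring

set_option maxHeartbeats 4000000 in
theorem ad_g2 : adjointCoaction (SUq q) (idealGen q 1) =
    idealGen q 0 ⊗ₜ ((-(qc q)⁻¹ ^ 3 - qc q) • (a q * (a q * (a q * c' q)))) +
    idealGen q 1 ⊗ₜ ((-(qc q)⁻¹ ^ 4 - (qc q)⁻¹ ^ 2 - 1 - qc q ^ 2) • (a q * (a q * (c q * c' q))) + (a q * a q)) +
    idealGen q 2 ⊗ₜ ((-(qc q)⁻¹ ^ 3 - qc q) • (a q * (c q * (c q * c' q))) + ((qc q)⁻¹) • (a q * c q)) +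
    idealGen q 3 ⊗ₜ ((1 + qc q ^ 2 + qc q ^ 4) • (c q * c q) + (-1 - qc q ^ 2 - qc q ^ 4 - qc q ^ 6) • (c q * (c q * (c q * c' q)))) +
    idealGen q 4 ⊗ₜ ((qc q ^ 3 + qc q ^ 7) • (a' q * (c q * (c q * c q)))) := by
  simp only [ad_apply, idealGen0, idealGen1, idealGen2, idealGen3, idealGen4, map_mul, map_add, map_sub, map_smul, map_one, comul3_a, comul3_a', comul3_c, comul3_c',
    mul_add, add_mul, mul_sub, sub_mul, smul_mul_assoc, mul_smul_comm, smul_add, smul_sub, smul_neg,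
    neg_mul, mul_neg, Algebra.TensorProduct.tmul_mul_tmul, Algebra.TensorProduct.one_def, tmul_add,
    tmul_sub, add_tmul, sub_tmul, tmul_smul, ← smul_tmul', tmul_neg, neg_tmul, adMap_tmul, mul_one,
    one_mul, S_mul, S_a, S_a', S_c, S_c', S_one, mul_assoc, nf1, nf2, nf3, nf4, c_mul_a', c'_mul_a',
    ← c_mul_c', nf1', nf2', nf3', nf4', nf5', nf6', nf7']
  have := qc_ne_zero q
  match_scalars <;> (try field_simp) <;> ring

set_option maxHeartbeats 4000000 in
theorem ad_g3 : adjointCoaction (SUq q) (idealGen q 2) =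
    idealGen q 0 ⊗ₜ (((qc q)⁻¹ ^ 4 + (qc q)⁻¹ ^ 2 + 2 + qc q ^ 2 + qc q ^ 4) • (a q * (a q * (c' q * c' q)))) +
    idealGen q 1 ⊗ₜ (((qc q)⁻¹ ^ 4 + 2 * (qc q)⁻¹ ^ 2 + 3 + 3 * qc q ^ 2 + 2 * qc q ^ 4 + qc q ^ 6) • (a q * (c q * (c' q * c' q))) + (-(qc q)⁻¹ ^ 2 - 2 - 2 * qc q ^ 2 - qc q ^ 4) • (a q * c' q)) +
    idealGen q 2 ⊗ₜ (((qc q)⁻¹ ^ 2 + 1 + 2 * qc q ^ 2 + qc q ^ 4 + qc q ^ 6) • (c q * (c q * (c' q * c' q))) + (-(qc q)⁻¹ ^ 2 - 2 - 2 * qc q ^ 2 - qc q ^ 4) • (c q * c' q) + (1)) +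
    idealGen q 3 ⊗ₜ ((-1 - 2 * qc q ^ 2 - 3 * qc q ^ 4 - 3 * qc q ^ 6 - 2 * qc q ^ 8 - qc q ^ 10) • (a' q * (c q * (c q * c' q))) + (1 + 2 * qc q ^ 2 + 2 * qc q ^ 4 + qc q ^ 6) • (a' q * c q)) +
    idealGen q 4 ⊗ₜ ((qc q ^ 2 + qc q ^ 4 + 2 * qc q ^ 6 + qc q ^ 8 + qc q ^ 10) • (a' q * (a' q * (c q * c q)))) := by
  simp only [ad_apply, idealGen0, idealGen1, idealGen2, idealGen3, idealGen4, map_mul, map_add, map_sub, map_smul, map_one, comul3_a, comul3_a', comul3_c, comul3_c',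
    mul_add, add_mul, mul_sub, sub_mul, smul_mul_assoc, mul_smul_comm, smul_add, smul_sub, smul_neg,
    neg_mul, mul_neg, Algebra.TensorProduct.tmul_mul_tmul, Algebra.TensorProduct.one_def, tmul_add,
    tmul_sub, add_tmul, sub_tmul, tmul_smul, ← smul_tmul', tmul_neg, neg_tmul, adMap_tmul, mul_one,
    one_mul, S_mul, S_a, S_a', S_c, S_c', S_one, mul_assoc, nf1, nf2, nf3, nf4, c_mul_a', c'_mul_a',
    ← c_mul_c', nf1', nf2', nf3', nf4', nf5', nf6', nf7']
  have := qc_ne_zero q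
  match_scalars <;> (try field_simp) <;> ring

set_option maxHeartbeats 4000000 in
theorem ad_g4 : adjointCoaction (SUq q) (idealGen q 3) =
    idealGen q 0 ⊗ₜ ((-(qc q)⁻¹ ^ 3 - qc q) • (a q * (c' q * (c' q * c' q)))) +
    idealGen q 1 ⊗ₜ (((qc q)⁻¹ ^ 2 + 1 + qc q ^ 2) • (c' q * c' q) + (-(qc q)⁻¹ ^ 2 - 1 - qc q ^ 2 - qc q ^ 4) • (c q * (c' q * (c' q * c' q)))) +
    idealGen q 2 ⊗ₜ (((qc q)⁻¹ + qc q ^ 3) • (a' q * (c q * (c' q * c' q))) + (-(qc q)⁻¹) • (a' q * c' q)) +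
    idealGen q 3 ⊗ₜ ((-1 - qc q ^ 2 - qc q ^ 4 - qc q ^ 6) • (a' q * (a' q * (c q * c' q))) + (a' q * a' q)) +
    idealGen q 4 ⊗ₜ ((qc q + qc q ^ 5) • (a' q * (a' q * (a' q * c q)))) := by
  simp only [ad_apply, idealGen0, idealGen1, idealGen2, idealGen3, idealGen4, map_mul, map_add, map_sub, map_smul, map_one, comul3_a, comul3_a', comul3_c, comul3_c',
    mul_add, add_mul, mul_sub, sub_mul, smul_mul_assoc, mul_smul_comm, smul_add, smul_sub, smul_neg,
    neg_mul, mul_neg, Algebra.TensorProduct.tmul_mul_tmul, Algebra.TensorProduct.one_def, tmul_add,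
    tmul_sub, add_tmul, sub_tmul, tmul_smul, ← smul_tmul', tmul_neg, neg_tmul, adMap_tmul, mul_one,
    one_mul, S_mul, S_a, S_a', S_c, S_c', S_one, mul_assoc, nf1, nf2, nf3, nf4, c_mul_a', c'_mul_a',
    ← c_mul_c', nf1', nf2', nf3', nf4', nf5', nf6', nf7']
  have := qc_ne_zero q
  match_scalars <;> (try field_simp) <;> ring

set_option maxHeartbeats 4000000 in
theorem ad_g5 : adjointCoaction (SUq q) (idealGen q 4) =
    idealGen q 0 ⊗ₜ ((c' q * (c' q * (c' q * c' q)))) +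
    idealGen q 1 ⊗ₜ ((-1 - qc q ^ 2) • (a' q * (c' q * (c' q * c' q)))) +
    idealGen q 2 ⊗ₜ ((a' q * (a' q * (c' q * c' q)))) +
    idealGen q 3 ⊗ₜ ((-1 - qc q ^ 2) • (a' q * (a' q * (a' q * c' q)))) +
    idealGen q 4 ⊗ₜ ((a' q * (a' q * (a' q * a' q)))) := by
  simp only [ad_apply, idealGen0, idealGen1, idealGen2, idealGen3, idealGen4, map_mul, map_add, map_sub, map_smul, map_one, comul3_a, comul3_a', comul3_c, comul3_c',
    mul_add, add_mul, mul_sub, sub_mul, smul_mul_assoc, mul_smul_comm, smul_add, smul_sub, smul_neg,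
    neg_mul, mul_neg, Algebra.TensorProduct.tmul_mul_tmul, Algebra.TensorProduct.one_def, tmul_add,
    tmul_sub, add_tmul, sub_tmul, tmul_smul, ← smul_tmul', tmul_neg, neg_tmul, adMap_tmul, mul_one,
    one_mul, S_mul, S_a, S_a', S_c, S_c', S_one, mul_assoc, nf1, nf2, nf3, nf4, c_mul_a', c'_mul_a',
    ← c_mul_c', nf1', nf2', nf3', nf4', nf5', nf6', nf7']
  have := qc_ne_zero q
  match_scalars <;> (try field_simp) <;> ring


theorem ad_one : adjointCoaction (SUq q) 1 = 1 ⊗ₜ 1 := by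
  simp [ad_apply, Algebra.TensorProduct.one_def, adMap_tmul, S_one]

theorem ad_trace : adjointCoaction (SUq q) (qc q ^ 2 • a q + a' q) = (qc q ^ 2 • a q + a' q) ⊗ₜ 1 := by
  simp only [ad_apply, idealGen0, idealGen1, idealGen2, idealGen3, idealGen4, map_mul, map_add, map_sub, map_smul, map_one, comul3_a, comul3_a', comul3_c, comul3_c',
    mul_add, add_mul, mul_sub, sub_mul, smul_mul_assoc, mul_smul_comm, smul_add, smul_sub, smul_neg,
    neg_mul, mul_neg, Algebra.TensorProduct.tmul_mul_tmul, Algebra.TensorProduct.one_def, tmul_add,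
    tmul_sub, add_tmul, sub_tmul, tmul_smul, ← smul_tmul', tmul_neg, neg_tmul, adMap_tmul, mul_one,
    one_mul, S_mul, S_a, S_a', S_c, S_c', S_one, mul_assoc, nf1, nf2, nf3, nf4, c_mul_a', c'_mul_a',
    ← c_mul_c', nf1', nf2', nf3', nf4', nf5', nf6', nf7']
  have := qc_ne_zero q
  match_scalars <;> (try field_simp) <;> ring

theorem ad_c : adjointCoaction (SUq q) (c q) = c q ⊗ₜ[ℂ] (a q * a q) + (a' q - a q) ⊗ₜ (a q * c q) + c' q ⊗ₜ (qc q ^ 2 • (c q * c q)) := by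
  simp only [ad_apply, idealGen0, idealGen1, idealGen2, idealGen3, idealGen4, map_mul, map_add, map_sub, map_smul, map_one, comul3_a, comul3_a', comul3_c, comul3_c',
    mul_add, add_mul, mul_sub, sub_mul, smul_mul_assoc, mul_smul_comm, smul_add, smul_sub, smul_neg,
    neg_mul, mul_neg, Algebra.TensorProduct.tmul_mul_tmul, Algebra.TensorProduct.one_def, tmul_add,
    tmul_sub, add_tmul, sub_tmul, tmul_smul, ← smul_tmul', tmul_neg, neg_tmul, adMap_tmul, mul_one,
    one_mul, S_mul, S_a, S_a', S_c, S_c', S_one, mul_assoc, nf1, nf2, nf3, nf4, c_mul_a', c'_mul_a',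
    ← c_mul_c', nf1', nf2', nf3', nf4', nf5', nf6', nf7']
  have := qc_ne_zero q
  match_scalars <;> (try field_simp) <;> ring

theorem ad_diff : adjointCoaction (SUq q) (a' q - a q) = c q ⊗ₜ[ℂ] (-(qc q + (qc q)⁻¹) • (a q * c' q)) + (a' q - a q) ⊗ₜ (1 - (1 + qc q ^ 2) • (c q * c' q)) + c' q ⊗ₜ ((qc q + qc q ^ 3) • (a' q * c q)) := by
  simp only [ad_apply, idealGen0, idealGen1, idealGen2, idealGen3, idealGen4, map_mul, map_add, map_sub, map_smul, map_one, comul3_a, comul3_a', comul3_c, comul3_c',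
    mul_add, add_mul, mul_sub, sub_mul, smul_mul_assoc, mul_smul_comm, smul_add, smul_sub, smul_neg,
    neg_mul, mul_neg, Algebra.TensorProduct.tmul_mul_tmul, Algebra.TensorProduct.one_def, tmul_add,
    tmul_sub, add_tmul, sub_tmul, tmul_smul, ← smul_tmul', tmul_neg, neg_tmul, adMap_tmul, mul_one,
    one_mul, S_mul, S_a, S_a', S_c, S_c', S_one, mul_assoc, nf1, nf2, nf3, nf4, c_mul_a', c'_mul_a',
    ← c_mul_c', nf1', nf2', nf3', nf4', nf5', nf6', nf7']
  have := qc_ne_zero q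
  match_scalars <;> (try field_simp) <;> ring

theorem ad_c' : adjointCoaction (SUq q) (c' q) = c q ⊗ₜ[ℂ] (c' q * c' q) - (a' q - a q) ⊗ₜ (a' q * c' q) + c' q ⊗ₜ (a' q * a' q) := by
  simp only [ad_apply, idealGen0, idealGen1, idealGen2, idealGen3, idealGen4, map_mul, map_add, map_sub, map_smul, map_one, comul3_a, comul3_a', comul3_c, comul3_c',
    mul_add, add_mul, mul_sub, sub_mul, smul_mul_assoc, mul_smul_comm, smul_add, smul_sub, smul_neg,
    neg_mul, mul_neg, Algebra.TensorProduct.tmul_mul_tmul, Algebra.TensorProduct.one_def, tmul_add,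
    tmul_sub, add_tmul, sub_tmul, tmul_smul, ← smul_tmul', tmul_neg, neg_tmul, adMap_tmul, mul_one,
    one_mul, S_mul, S_a, S_a', S_c, S_c', S_one, mul_assoc, nf1, nf2, nf3, nf4, c_mul_a', c'_mul_a',
    ← c_mul_c', nf1', nf2', nf3', nf4', nf5', nf6', nf7']
  have := qc_ne_zero q
  match_scalars <;> (try field_simp) <;> ring

end

section ideal
variable {q : Param}

theorem adMap_mul (U : SUq q ⊗[ℂ] (SUq q ⊗[ℂ] SUq q)) (x y z : SUq q) :
    adMap q (U * x ⊗ₜ (y ⊗ₜ z)) = (1 ⊗ₜ S q x) * adMap q U * (y ⊗ₜ z) := by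
  induction U with
  | zero => simp
  | add u v hu hv => simp only [add_mul, map_add, hu, hv, mul_add]
  | tmul u v =>
    induction v with
    | zero => simp
    | add v w hv hw => simp only [tmul_add, add_mul, map_add, hv, hw, mul_add]
    | tmul v w => simp [adMap_tmul, S_mul, mul_assoc]

theorem ad_mul_mem {Q : Submodule (SUq q)ᵐᵒᵖ (SUq q)} {x : SUq q}
    (hx : adjointCoaction (SUq q) x ∈
      LinearMap.range ((Q.restrictScalars ℂ).subtype.rTensor (SUq q))) (y : SUq q) :
    adjointCoaction (SUq q) (x * y) ∈
      LinearMap.range ((Q.restrictScalars ℂ).subtype.rTensor (SUq q)) := by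
  rw [ad_apply] at hx
  rw [ad_apply, map_mul]
  generalize comul3 q y = V
  induction V with
  | zero => simp
  | add u v hu hv => rw [mul_add, map_add]; exact add_mem hu hv
  | tmul u v =>
    induction v with
    | zero => simp
    | add v w hv hw => rw [tmul_add, mul_add, map_add]; exact add_mem hv hw
    | tmul v w =>
      rw [adMap_mul]
      obtain ⟨z, hz⟩ := hx
      rw [← hz]
      clear hz
      induction z with
      | zero => simp
      | add z z' hz hz' => rw [map_add, mul_add, add_mul]; exact add_mem hz hz'
      | tmul z h =>
        refine ⟨(⟨z.1 * v, Q.smul_mem (.op v) z.2⟩ : Q.restrictScalars ℂ) ⊗ₜ (S q u * h * w), ?_⟩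
        simp

theorem ad_mul_of_coinvariant {x : SUq q} (hx : adjointCoaction (SUq q) x = x ⊗ₜ 1) (y : SUq q) :
    adjointCoaction (SUq q) (x * y) = (x ⊗ₜ 1) * adjointCoaction (SUq q) y := by
  rw [ad_apply] at hx
  rw [ad_apply, ad_apply, map_mul]
  generalize comul3 q y = V
  induction V with
  | zero => simp
  | add u v hu hv => simp only [mul_add, map_add, hu, hv]
  | tmul u v =>
    induction v with
    | zero => simp
    | add v w hv hw => simp only [tmul_add, mul_add, map_add, hv, hw]
    | tmul v w => simp [adMap_mul, hx, adMap_tmul]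

theorem ad_coinvariant (k : ℂ) :
    adjointCoaction (SUq q) (qc q ^ 2 • a q + a' q - k • 1) =
      (qc q ^ 2 • a q + a' q - k • 1) ⊗ₜ 1 := by
  rw [map_sub, ad_trace, map_smul, ad_one, sub_tmul, smul_tmul']

theorem ad_idealGen_mem (Q : Submodule (SUq q)ᵐᵒᵖ (SUq q)) (h : ∀ i, idealGen q i ∈ Q) (i : Fin 9) :
    adjointCoaction (SUq q) (idealGen q i) ∈
      LinearMap.range ((Q.restrictScalars ℂ).subtype.rTensor (SUq q)) := by
  have key : ∀ (x y : SUq q), x ∈ Q → x ⊗ₜ y ∈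
      LinearMap.range ((Q.restrictScalars ℂ).subtype.rTensor (SUq q)) :=
    fun x y hx => ⟨(⟨x, hx⟩ : Q.restrictScalars ℂ) ⊗ₜ y, by simp⟩
  have key' : ∀ (j : Fin 9) (y : SUq q), idealGen q j ⊗ₜ y ∈
      LinearMap.range ((Q.restrictScalars ℂ).subtype.rTensor (SUq q)) := fun j y => key _ y (h j)
  have h5 := key' 5
  have h6 := key' 6
  have h7 := key' 7
  have h8 := key' 8
  simp only [idealGen5, idealGen6, idealGen7, idealGen8] at h5 h6 h7 h8
  have e1 : ∀ x y z u v w t : SUq q, (t ⊗ₜ[ℂ] 1) * (x ⊗ₜ[ℂ] u + y ⊗ₜ[ℂ] v + z ⊗ₜ[ℂ] w) =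
      (t * x) ⊗ₜ[ℂ] u + (t * y) ⊗ₜ[ℂ] v + (t * z) ⊗ₜ[ℂ] w := by
    intro x y z u v w t; simp [mul_add]
  have e2 : ∀ x y z u v w t : SUq q, (t ⊗ₜ[ℂ] 1) * (x ⊗ₜ[ℂ] u - y ⊗ₜ[ℂ] v + z ⊗ₜ[ℂ] w) =
      (t * x) ⊗ₜ[ℂ] u - (t * y) ⊗ₜ[ℂ] v + (t * z) ⊗ₜ[ℂ] w := by
    intro x y z u v w t; simp [mul_add, mul_sub]
  fin_cases i
  · exact ad_g1 q ▸ add_mem (add_mem (add_mem (add_mem (key' ..) (key' ..)) (key' ..)) (key' ..)) (key' ..)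
  · exact ad_g2 q ▸ add_mem (add_mem (add_mem (add_mem (key' ..) (key' ..)) (key' ..)) (key' ..)) (key' ..)
  · exact ad_g3 q ▸ add_mem (add_mem (add_mem (add_mem (key' ..) (key' ..)) (key' ..)) (key' ..)) (key' ..)
  · exact ad_g4 q ▸ add_mem (add_mem (add_mem (add_mem (key' ..) (key' ..)) (key' ..)) (key' ..)) (key' ..)
  · exact ad_g5 q ▸ add_mem (add_mem (add_mem (add_mem (key' ..) (key' ..)) (key' ..)) (key' ..)) (key' ..)
  · change adjointCoaction (SUq q) (idealGen q 5) ∈ _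
    rw [idealGen5, ad_mul_of_coinvariant (ad_coinvariant _), ad_c, e1]
    exact add_mem (add_mem (h5 _) (h6 _)) (h7 _)
  · change adjointCoaction (SUq q) (idealGen q 6) ∈ _
    rw [idealGen6, ad_mul_of_coinvariant (ad_coinvariant _), ad_diff, e1]
    exact add_mem (add_mem (h5 _) (h6 _)) (h7 _)
  · change adjointCoaction (SUq q) (idealGen q 7) ∈ _
    rw [idealGen7, ad_mul_of_coinvariant (ad_coinvariant _), ad_c', e2]
    exact add_mem (sub_mem (h5 _) (h6 _)) (h7 _)
  · change adjointCoaction (SUq q) (idealGen q 8) ∈ _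
    rw [idealGen8, ad_mul_of_coinvariant (ad_coinvariant _), ad_coinvariant,
      Algebra.TensorProduct.tmul_mul_tmul]
    exact h8 _

theorem idealGen_mem_augmentation (i : Fin 9) : idealGen q i ∈ augmentation (SUq q) := by
  change ε q (idealGen q i) = 0
  have := qc_ne_zero q
  fin_cases i <;> simp [idealGen, ε_a, ε_a', ε_c, ε_c'] <;>
    first | exact Or.inr (by ring) | ring

end ideal

/-- The `4D₊` bicovariant calculus on `SU_q(2)`: the right ideal generated by the nine elements
above. -/
def fourDPlus (q : Param) : CalculusIdeal (SUq q) where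
  ideal := Submodule.span (SUq q)ᵐᵒᵖ (Set.range (idealGen q))
  le_augmentation := by
    rw [Submodule.span_le]
    rintro _ ⟨i, rfl⟩
    exact idealGen_mem_augmentation i
  ad_mem x hx := by
    refine Submodule.span_induction ?_ ?_ ?_ ?_ hx
    · rintro _ ⟨i, rfl⟩
      exact ad_idealGen_mem _ (fun i => Submodule.subset_span (Set.mem_range_self i)) i
    · simp
    · intro x y _ _ hx hy
      rw [map_add]
      exact add_mem hx hy
    · intro y x _ hx
      exact ad_mul_mem hx y.unop

/-! ### The quantum sphere and its line bundles -/

theorem isRep_π (q : Param) :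
    IsRep q (B := LaurentPolynomial ℂ) (.T 1) (.T (-1)) 0 0 := by
  constructor
  case asa => rw [← LaurentPolynomial.T_add]; simp
  case aas => rw [← LaurentPolynomial.T_add]; simp
  all_goals simp

/-- The projection `π : A(SU_q(2)) → A(U(1)) = ℂ[z, z⁻¹]`, `a ↦ z`, `a* ↦ z⁻¹`, `c, c* ↦ 0`. -/
def π (q : Param) : SUq q →ₐ[ℂ] LaurentPolynomial ℂ := lift q (isRep_π q)

/-- The right coaction `δ_R = (id ⊗ π) Δ` of `U(1)`. -/
def δR (q : Param) : SUq q →ₐ[ℂ] SUq q ⊗[ℂ] LaurentPolynomial ℂ :=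
  (Algebra.TensorProduct.map (.id ℂ _) (π q)).comp (Δ q)

/-- The coordinate algebra `A(S²_q)` of the standard Podleś sphere: the elements `b` with
`δ_R b = b ⊗ 1`. -/
def sphere (q : Param) : Subalgebra ℂ (SUq q) :=
  AlgHom.equalizer (δR q) Algebra.TensorProduct.includeLeft

/-- The line bundle `L_n`: the elements `x` with `δ_R x = x ⊗ z⁻ⁿ`, as a left `A(S²_q)`-module. -/
def lineBundle (q : Param) (n : ℤ) : Submodule (sphere q) (SUq q) where
  carrier := {x | δR q x = x ⊗ₜ[ℂ] LaurentPolynomial.T (-n)}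
  add_mem' := by
    intro x y hx hy
    change δR q x = x ⊗ₜ[ℂ] _ at hx
    change δR q y = y ⊗ₜ[ℂ] _ at hy
    change δR q _ = _ ⊗ₜ[ℂ] _
    rw [map_add, hx, hy, add_tmul]
  zero_mem' := by simp
  smul_mem' := by
    rintro ⟨b, hb⟩ x hx
    have hb' : δR q b = b ⊗ₜ[ℂ] 1 := hb
    have hx' : δR q x = x ⊗ₜ[ℂ] LaurentPolynomial.T (-n) := hx
    change δR q _ = _ ⊗ₜ[ℂ] _
    rw [Subalgebra.smul_def, smul_eq_mul, map_mul, hx', hb', Algebra.TensorProduct.tmul_mul_tmul,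
      one_mul]

/-! ### Left invariant forms -/

/-- The `q`-number `[x] = (qˣ - q⁻ˣ) / (q - q⁻¹)`. -/
def qNumber (q : Param) (x : ℝ) : ℝ :=
  ((q : ℝ) ^ x - (q : ℝ) ^ (-x)) / ((q : ℝ) - (q : ℝ)⁻¹)

/-- `λ₁ = [1/2] [3/2]`. -/
def lam (q : Param) : ℂ := ((qNumber q (1 / 2) * qNumber q (3 / 2) : ℝ) : ℂ)

section invariantForms
variable (q : Param)

/-- `ω₋ = c* da* - q a* dc*`. -/
def ωm : (fourDPlus q).OneForms :=
  c' q • (fourDPlus q).d (a' q) - qc q • (a' q • (fourDPlus q).d (c' q))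

/-- `ω₊ = a dc - q c da`. -/
def ωp : (fourDPlus q).OneForms :=
  a q • (fourDPlus q).d (c q) - qc q • (c q • (fourDPlus q).d (a q))

/-- `ω₀ = (1 + q)⁻¹ λ₁⁻¹ [a* da + c* dc + q (a da* + q² c dc*)]`. -/
def ω0 : (fourDPlus q).OneForms :=
  ((1 + qc q)⁻¹ * (lam q)⁻¹) •
    (a' q • (fourDPlus q).d (a q) + c' q • (fourDPlus q).d (c q) +
      qc q • (a q • (fourDPlus q).d (a' q) + qc q ^ 2 • (c q • (fourDPlus q).d (c' q))))

end invariantForms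

section bimodules
variable {q : Param} {W : Type*} [AddCommGroup W] [Module ℂ W]

/-- The left `A(S²_q)`-module `L_n θ = {φ θ : φ ∈ L_n}` inside the bimodule `A(SU_q(2)) ⊗ W`. -/
def lineForms (n : ℤ) (θ : SUq q ⊗[ℂ] W) : Submodule (sphere q) (SUq q ⊗[ℂ] W) :=
  (lineBundle q n).map ((LinearMap.toSpanSingleton (SUq q) _ θ).restrictScalars (sphere q))

/-- `Ω` is an `A(S²_q)`-sub-bimodule of the `A(SU_q(2))`-bimodule `A(SU_q(2)) ⊗ W`, and it is the
internal direct sum of the spaces `L_{n i} θ i`, each of which is a copy of `L_{n i}` through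
`φ ↦ φ θ i`. In this sense `Ω ≃ ⨁ i, L_{n i} θ i` as `A(S²_q)`-bimodules. -/
structure IsLineBundleSum (ρ : RAct (SUq q) W) (Ω : Submodule (sphere q) (SUq q ⊗[ℂ] W)) {r : ℕ}
    (n : Fin r → ℤ) (θ : Fin r → SUq q ⊗[ℂ] W) : Prop where
  right_mem : ∀ η ∈ Ω, ∀ b ∈ sphere q, ρ.forms (.op b) η ∈ Ω
  eq_iSup : Ω = ⨆ i, lineForms (n i) (θ i)
  indep : iSupIndep fun i => lineForms (n i) (θ i)
  free : ∀ i, ∀ φ ∈ lineBundle q (n i), φ • θ i = 0 → φ = 0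

end bimodules

end SUq
end QuantumSphere

end

/-! ### Relations among classes in ker ε / Q, and nonvanishing of polynomials in q. -/

noncomputable section

namespace QuantumSphere

namespace CalculusIdeal

variable {H : Type*} [Ring H] [HopfAlgebra ℂ H] (C : CalculusIdeal H)

/-! All forms live in A ⊗ Inv^{⊗k} with Inv = ker ε / Q, so the statement reduces to finite tables
on Inv plus a grading argument. The nine generators of Q leave Inv spanned by `eP` = [c], `eM` =
[c*], `eZ` ∝ [cc*] and `eX` = [a - 1]. The forms ω₋, ω₊, ω₀ are nonzero multiples of 1 ⊗ `eM`, 1 ⊗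
`eP`, 1 ⊗ `eZ`. These three vectors span a submodule for the right action. Give them weights -2, 2,
0, and call a form Σ φᵢ ⊗ wᵢ homogeneous of degree k if φᵢ ∈ L_{nᵢ + k}, where nᵢ is the weight of
wᵢ. The right action of the generators changes weights in such a way that right multiplication by
L_m shifts the degree by m (`IsGraded.forms_mem`). The claim is that Ω^k(S²_q) consists exactly of
the homogeneous forms of degree 0 built on the stated left invariant forms.

One-forms: for y ∈ L_m the `eX`-part of dy is (q^{-m} - 1)/(q - 1) · y ⊗ `eX` (`d_sub_mem`). It
vanishes for m = 0, so db has degree 0 for b in the sphere. Conversely 1 ⊗ [x] = S(x₍₁₎) dx₍₂₎, and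
`eM`, `eP`, `eZ` have the representatives c*a, ca*, cc* (up to a scalar for `eZ`), for which x₍₂₎
can be taken in the sphere (`tmul_eM_mem`, `tmul_eP_mem`, `tmul_eZ_mem`).

Higher forms: explicit braiding tables show that antisymmetrisation sends products of the three
one-forms into the span of three two-forms, respectively one three-form (`asym₂_table`,
`shuffle₃_table`), and these spans are again stable under the right action. Conversely 1 ∈ L_{-n}
L_n (`one_mem_span_mul`), so every degree 0 tensor is a sum of products of degree 0 one-forms
(`IsGraded.le_span_mulTensor`). By the Leibniz rule their wedge products are restricted forms.

Directness and freeness need linear independence. It comes from functionals read off a 5 × 5 matrix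
representation modelled on the right module A/Q (`mat`, `dual`). -/

theorem cls_one : C.cls 1 = 0 := by
  have h : (⟨(1 : H) - Coalgebra.counit (R := ℂ) (1 : H) • 1, by simp [augmentation]⟩ :
      augmentation H) = 0 := by
    ext; simp
  change Submodule.Quotient.mk _ = _
  rw [h, Submodule.Quotient.mk_zero]

/-- Since [x] stands for x - ε(x)1, multiplying by h produces the correction ε(x)[h]. All later
action formulas come from this cocycle rule. -/
theorem invAct_cls (x h : H) : C.invAct (.op h) (C.cls x) =
    C.cls (x * h) - Coalgebra.counit (R := ℂ) x • C.cls h := by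
  rw [eq_sub_iff_add_eq']
  symm
  change Submodule.Quotient.mk _ = Coalgebra.counit (R := ℂ) x • Submodule.Quotient.mk _ +
    Submodule.Quotient.mk _
  rw [← Submodule.Quotient.mk_smul, ← Submodule.Quotient.mk_add]
  congr 1; ext
  simp [sub_mul, smul_sub, mul_smul]

end CalculusIdeal

namespace SUq

variable (q : Param)

/-- The class of an element of `A(SU_q(2))` in the left invariant one-forms. -/
def fcls : SUq q →ₗ[ℂ] (fourDPlus q).Inv := (fourDPlus q).cls

/-- The right action of an element of `A(SU_q(2))` on the left invariant one-forms. -/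
def act (h : SUq q) : Module.End ℂ (fourDPlus q).Inv := (fourDPlus q).invAct (.op h)

theorem act_fcls (x h : SUq q) : act q h (fcls q x) = fcls q (x * h) - ε q x • fcls q h :=
  (fourDPlus q).invAct_cls x h

theorem act_mul (x y : SUq q) (w : (fourDPlus q).Inv) : act q (x * y) w = act q y (act q x w) := by
  simp [act]

theorem fcls_one : fcls q 1 = 0 := (fourDPlus q).cls_one

theorem fcls_idealGen (i : Fin 9) : fcls q (idealGen q i) = 0 :=
  (fourDPlus q).cls_eq_zero (Submodule.subset_span (Set.mem_range_self i))

theorem one_add_qc_ne_zero : 1 + qc q ≠ 0 := by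
  have h : (0 : ℝ) < 1 + (q : ℝ) := by linarith [q.2.1]
  have := h.ne'
  unfold qc; exact_mod_cast this

theorem one_add_qc_sq_ne_zero : 1 + qc q ^ 2 ≠ 0 := by
  have h : (0 : ℝ) < 1 + (q : ℝ) ^ 2 := by positivity
  have := h.ne'
  unfold qc; exact_mod_cast this

theorem one_add_qc_pow_four_ne_zero : 1 + qc q ^ 4 ≠ 0 := by
  have h : (0 : ℝ) < 1 + (q : ℝ) ^ 4 := by positivity
  have := h.ne'
  unfold qc; exact_mod_cast this

theorem one_add_qc_add_sq_ne_zero : 1 + qc q + qc q ^ 2 ≠ 0 := by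
  have h : (0 : ℝ) < 1 + (q : ℝ) + (q : ℝ) ^ 2 := by have := q.2.1; positivity
  have := h.ne'
  unfold qc; exact_mod_cast this

theorem one_add_qc_sq_add_pow_four_ne_zero : 1 + qc q ^ 2 + qc q ^ 4 ≠ 0 := by
  have h : (0 : ℝ) < 1 + (q : ℝ) ^ 2 + (q : ℝ) ^ 4 := by positivity
  have := h.ne'
  unfold qc; exact_mod_cast this

theorem one_sub_qc_ne_zero : 1 - qc q ≠ 0 := by
  have h : (0 : ℝ) < 1 - (q : ℝ) := by linarith [q.2.2]
  have := h.ne'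
  unfold qc; exact_mod_cast this

/-! ### The four left invariant one-forms -/

/-- The left invariant one-form `[c]`. -/
def eP : (fourDPlus q).Inv := fcls q (c q)
/-- The left invariant one-form `[c*]`. -/
def eM : (fourDPlus q).Inv := fcls q (c' q)
/-- The left invariant one-form `(1 + q)⁻¹ [c c*]`. -/
def eZ : (fourDPlus q).Inv := (1 + qc q)⁻¹ • fcls q (c q * c' q)
/-- The left invariant one-form `[a - 1]`. -/
def eX : (fourDPlus q).Inv := fcls q (a q)

theorem fcls_c_mul_c' : fcls q (c q * c' q) = (1 + qc q) • eZ q := by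
  rw [eZ, smul_smul, mul_inv_cancel₀ (one_add_qc_ne_zero q), one_smul]

theorem fcls_c_sq : fcls q (c q * c q) = 0 := fcls_idealGen q 0
theorem fcls_c'_sq : fcls q (c' q * c' q) = 0 := fcls_idealGen q 4

theorem fcls_c_mul_a' : fcls q (c q * a' q) = fcls q (c q * a q) := by
  have := fcls_idealGen q 1
  rwa [idealGen1, mul_sub, map_sub, sub_eq_zero] at this

theorem fcls_c'_mul_a' : fcls q (c' q * a' q) = fcls q (c' q * a q) := by
  have := fcls_idealGen q 3
  rwa [idealGen3, mul_sub, map_sub, sub_eq_zero] at this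

theorem a'_mul_c : a' q * c q = (qc q)⁻¹ • (c q * a' q) := by
  rw [c_mul_a', smul_smul, inv_mul_cancel₀ (qc_ne_zero q), one_smul]
theorem a'_mul_c' : a' q * c' q = (qc q)⁻¹ • (c' q * a' q) := by
  rw [c'_mul_a', smul_smul, inv_mul_cancel₀ (qc_ne_zero q), one_smul]

/-- In the generator tc both ac and a*c are multiples of [ca], by the commutation relations and
[ca*] = [ca]. The total coefficient q³ + q⁻¹ equals the constant q⁻¹(1 + q⁴) in t, which then
cancels. -/
theorem fcls_c_mul_a : fcls q (c q * a q) = eP q := by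
  have h := fcls_idealGen q 5
  have h1 := qc_ne_zero q
  have h2 := one_add_qc_pow_four_ne_zero q
  rw [idealGen5, sub_mul, add_mul, smul_mul_assoc, a_mul_c, a'_mul_c, smul_mul_assoc, one_mul,
    map_sub, map_add, map_smul, map_smul, map_smul, map_smul, fcls_c_mul_a'] at h
  rw [← sub_eq_zero, eP]
  have h3 : ((qc q)⁻¹ * (1 + qc q ^ 4)) • (fcls q (c q * a q) - fcls q (c q)) = 0 := by
    rw [← h]
    match_scalars <;> field_simp <;> ring
  exact (smul_eq_zero.1 h3).resolve_left (by positivity)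

theorem fcls_c'_mul_a : fcls q (c' q * a q) = eM q := by
  have h := fcls_idealGen q 7
  have h1 := qc_ne_zero q
  have h2 := one_add_qc_pow_four_ne_zero q
  rw [idealGen7, sub_mul, add_mul, smul_mul_assoc, a_mul_c', a'_mul_c', smul_mul_assoc, one_mul,
    map_sub, map_add, map_smul, map_smul, map_smul, map_smul, fcls_c'_mul_a'] at h
  rw [← sub_eq_zero, eM]
  have h3 : ((qc q)⁻¹ * (1 + qc q ^ 4)) • (fcls q (c' q * a q) - fcls q (c' q)) = 0 := by
    rw [← h]
    match_scalars <;> field_simp <;> ring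
  exact (smul_eq_zero.1 h3).resolve_left (by positivity)

theorem fcls_relation_two : qc q ^ 2 • fcls q (a' q * a' q) + fcls q (a q * a q) =
    -(1 + qc q ^ 2) ^ 2 • fcls q (c q * c' q) := by
  have h := fcls_idealGen q 2
  simp only [idealGen2, nf4, map_add, map_sub, map_smul, fcls_one] at h
  rw [← sub_eq_zero, ← h]
  module

theorem fcls_relation_six : fcls q (a' q * a' q) - qc q ^ 2 • fcls q (a q * a q) =
    ((qc q)⁻¹ * (1 + qc q ^ 4)) • (fcls q (a' q) - fcls q (a q)) -
      (1 - qc q ^ 4) • fcls q (c q * c' q) := by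
  have h := fcls_idealGen q 6
  simp only [idealGen6, mul_sub, sub_mul, add_mul, smul_mul_assoc, one_mul, nf3, nf4, map_add,
    map_sub, map_smul, fcls_one] at h
  rw [← sub_eq_zero, ← h]
  module

theorem fcls_relation_eight : qc q ^ 4 • fcls q (a q * a q) + fcls q (a' q * a' q) =
    ((qc q)⁻¹ * (1 + qc q ^ 4) + (1 + qc q ^ 2)) • (qc q ^ 2 • fcls q (a q) + fcls q (a' q)) +
      (qc q ^ 2 * (1 + qc q ^ 2)) • fcls q (c q * c' q) := by
  have h := fcls_idealGen q 8
  simp only [idealGen8, mul_sub, sub_mul, add_mul, mul_add, smul_mul_assoc, mul_smul_comm, one_mul,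
    mul_one, nf3, nf4, map_add, map_sub, map_smul, fcls_one] at h
  rw [← sub_eq_zero, ← h]
  module

/-- The generators with index 2 and 6 are two linear equations for [a²] and [a*²] with determinant 1
+ q⁴ up to sign. Solving them leaves one further relation, from index 8, among [a], [a*] and [cc*].
-/
theorem fcls_a'_sq : fcls q (a' q * a' q) =
    (qc q)⁻¹ • (fcls q (a' q) - fcls q (a q)) - (1 + qc q ^ 2) • fcls q (c q * c' q) := by
  have h1 := qc_ne_zero q
  have h2 := one_add_qc_pow_four_ne_zero q
  have h3 : (1 + qc q ^ 4) • (fcls q (a' q * a' q) - ((qc q)⁻¹ • (fcls q (a' q) - fcls q (a q)) -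
      (1 + qc q ^ 2) • fcls q (c q * c' q))) = 0 := by
    linear_combination (norm := module) fcls_relation_six q + qc q ^ 2 • fcls_relation_two q
  exact sub_eq_zero.1 ((smul_eq_zero.1 h3).resolve_left h2)

theorem fcls_a_sq : fcls q (a q * a q) =
    qc q • (fcls q (a q) - fcls q (a' q)) - (1 + qc q ^ 2) • fcls q (c q * c' q) := by
  have h1 := qc_ne_zero q
  have h : qc q ^ 2 • (qc q)⁻¹ • (fcls q (a' q) - fcls q (a q)) =
      qc q • (fcls q (a' q) - fcls q (a q)) := by
    rw [smul_smul, sq, mul_assoc, mul_inv_cancel₀ h1, mul_one]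
  linear_combination (norm := module) fcls_relation_two q - qc q ^ 2 • fcls_a'_sq q - h

/-- Once both squares are eliminated from the generator with index 8, the coefficient of [a*] is (1
+ q²)(1 + q³) up to sign. Hence [a*] is redundant and four vectors span Inv. -/
theorem fcls_a' : fcls q (a' q) = -(1 + qc q + qc q ^ 2) • eZ q - (qc q)⁻¹ • eX q := by
  have h1 := qc_ne_zero q
  have h2 := one_add_qc_sq_ne_zero q
  have h4 := one_add_qc_ne_zero q
  -- This is a factor of 1 + q² + q⁴ = (1 + q + q²)(1 - q + q²).
  have h5 : 1 - qc q + qc q ^ 2 ≠ 0 := by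
    intro h
    apply one_add_qc_sq_add_pow_four_ne_zero q
    linear_combination (1 + qc q + qc q ^ 2) * h
  have h3 : ((1 + qc q ^ 2) * (1 + qc q) * (1 - qc q + qc q ^ 2)) • (fcls q (a' q) - (-(1 + qc q + qc q ^ 2) • eZ q - (qc q)⁻¹ • eX q)) = 0 := by
    have h8 := fcls_relation_eight q
    rw [fcls_a_sq, fcls_a'_sq, fcls_c_mul_c', ← sub_eq_zero] at h8
    rw [← smul_zero (-1 : ℂ), ← h8, eX]
    match_scalars <;> field_simp <;> ring
  exact sub_eq_zero.1 ((smul_eq_zero.1 h3).resolve_left (mul_ne_zero (mul_ne_zero h2 h4) h5))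

/-! ### The right action of the generators on `eP`, `eM`, `eX`, `eZ`. -/

theorem act_eP_a : act q (a q) (eP q) = eP q := by
  rw [eP, act_fcls, ε_c, zero_smul, sub_zero, fcls_c_mul_a, eP]
theorem act_eP_a' : act q (a' q) (eP q) = eP q := by
  rw [eP, act_fcls, ε_c, zero_smul, sub_zero, fcls_c_mul_a', fcls_c_mul_a, eP]
theorem act_eP_c : act q (c q) (eP q) = 0 := by
  rw [eP, act_fcls, ε_c, zero_smul, sub_zero, fcls_c_sq]
theorem act_eP_c' : act q (c' q) (eP q) = (1 + qc q) • eZ q := by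
  rw [eP, act_fcls, ε_c, zero_smul, sub_zero, fcls_c_mul_c']
theorem act_eM_a : act q (a q) (eM q) = eM q := by
  rw [eM, act_fcls, ε_c', zero_smul, sub_zero, fcls_c'_mul_a, eM]
theorem act_eM_a' : act q (a' q) (eM q) = eM q := by
  rw [eM, act_fcls, ε_c', zero_smul, sub_zero, fcls_c'_mul_a', fcls_c'_mul_a, eM]
theorem act_eM_c : act q (c q) (eM q) = (1 + qc q) • eZ q := by
  rw [eM, act_fcls, ε_c', zero_smul, sub_zero, ← c_mul_c', fcls_c_mul_c']
theorem act_eM_c' : act q (c' q) (eM q) = 0 := by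
  rw [eM, act_fcls, ε_c', zero_smul, sub_zero, fcls_c'_sq]

theorem act_eX_a : act q (a q) (eX q) = qc q • eX q - eZ q := by
  rw [eX, act_fcls, ε_a, one_smul, fcls_a_sq, fcls_a', fcls_c_mul_c', ← eX]
  have h1 := qc_ne_zero q
  match_scalars <;> field_simp <;> ring
theorem act_eX_a' : act q (a' q) (eX q) = (qc q)⁻¹ • eX q + (1 + qc q - qc q ^ 3) • eZ q := by
  rw [eX, act_fcls, ε_a, one_smul, nf4, map_sub, map_smul, fcls_one, fcls_a', fcls_c_mul_c', ← eX]
  have h1 := qc_ne_zero q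
  match_scalars <;> field_simp <;> ring
theorem act_eX_c : act q (c q) (eX q) = (qc q - 1) • eP q := by
  rw [eX, act_fcls, ε_a, one_smul, a_mul_c, map_smul, fcls_c_mul_a, eP]
  module
theorem act_eX_c' : act q (c' q) (eX q) = (qc q - 1) • eM q := by
  rw [eX, act_fcls, ε_a, one_smul, a_mul_c', map_smul, fcls_c'_mul_a, eM]
  module

/-- With `eZ` written as a translate of `eP`, its action table follows from that of `eP` and the
commutation relations, without any cubic classes. -/
theorem eZ_eq_act : eZ q = (1 + qc q)⁻¹ • act q (c' q) (eP q) := by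
  rw [act_eP_c', smul_smul, inv_mul_cancel₀ (one_add_qc_ne_zero q), one_smul]

theorem act_act_c'_a (w : (fourDPlus q).Inv) : act q (a q) (act q (c' q) w) =
    (qc q)⁻¹ • act q (c' q) (act q (a q) w) := by
  rw [← act_mul, ← act_mul, nf2]
  simp [act]

theorem act_eZ_a : act q (a q) (eZ q) = (qc q)⁻¹ • eZ q := by
  rw [eZ_eq_act, map_smul, act_act_c'_a, act_eP_a, smul_comm]

theorem act_act_c'_a' (w : (fourDPlus q).Inv) : act q (a' q) (act q (c' q) w) =
    qc q • act q (c' q) (act q (a' q) w) := by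
  rw [← act_mul, ← act_mul, c'_mul_a']
  simp [act]

theorem act_eZ_a' : act q (a' q) (eZ q) = qc q • eZ q := by
  rw [eZ_eq_act, map_smul, act_act_c'_a', act_eP_a', smul_comm]

theorem act_eZ_c : act q (c q) (eZ q) = 0 := by
  rw [eZ_eq_act, map_smul, ← act_mul, ← c_mul_c', act_mul, act_eP_c, map_zero, smul_zero]

theorem fcls_c_mul_c'_eq_act : act q (c q) (eM q) = fcls q (c q * c' q) := by
  rw [act_eM_c, fcls_c_mul_c']

/-- Here `eZ` is taken as a translate of `eM` by c instead, because c* then commutes past c and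
annihilates `eM`. -/
theorem act_eZ_c' : act q (c' q) (eZ q) = 0 := by
  rw [eZ, ← fcls_c_mul_c'_eq_act, map_smul, ← act_mul, c_mul_c', act_mul, act_eM_c', map_zero,
    smul_zero]

end SUq
end QuantumSphere
end

noncomputable section

namespace QuantumSphere
namespace SUq

variable (q : Param)

/-! ### Linear functionals on the left invariant one-forms -/

/-- The matrix of `a` acting on `ℂ ⊕ Inv`, twisted by the universal cocycle. -/
def matA : Matrix (Fin 5) (Fin 5) ℂ :=
  !![1, 0, 0, 0, 1; 0, 1, 0, 0, 0; 0, 0, 1, 0, 0; 0, 0, 0, (qc q)⁻¹, 0; 0, 0, 0, -1, qc q]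
/-- The matrix of `a*`. -/
def matA' : Matrix (Fin 5) (Fin 5) ℂ :=
  !![1, 0, 0, -(1 + qc q + qc q ^ 2), -(qc q)⁻¹; 0, 1, 0, 0, 0; 0, 0, 1, 0, 0; 0, 0, 0, qc q, 0;
    0, 0, 0, 1 + qc q - qc q ^ 3, (qc q)⁻¹]
/-- The matrix of `c`. -/
def matC : Matrix (Fin 5) (Fin 5) ℂ :=
  !![0, 1, 0, 0, 0; 0, 0, 0, 0, 0; 0, 0, 0, 1 + qc q, 0; 0, 0, 0, 0, 0; 0, qc q - 1, 0, 0, 0]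
/-- The matrix of `c*`. -/
def matC' : Matrix (Fin 5) (Fin 5) ℂ :=
  !![0, 0, 1, 0, 0; 0, 0, 0, 1 + qc q, 0; 0, 0, 0, 0, 0; 0, 0, 0, 0, 0; 0, 0, qc q - 1, 0, 0]

-- The matrices describe A/Q = ℂ[1] ⊕ Inv as a right module in the basis 1, `eP`, `eM`, `eZ`, `eX`,
-- with row i the image of the i-th basis vector. Linear independence of that basis is not yet
-- known, so the relations are checked directly on the matrices.
set_option maxHeartbeats 1000000 in
theorem isRep_mat : IsRep q (matA q) (matA' q) (matC q) (matC' q) := by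
  have := qc_ne_zero q
  constructor <;> ext i j <;> fin_cases i <;> fin_cases j <;>
    simp [matA, matA', matC, matC', Matrix.mul_apply, Fin.sum_univ_five] <;> field_simp <;> ring

/-- The representation of `A(SU_q(2))` on `ℂ ⊕ Inv`. -/
def mat : SUq q →ₐ[ℂ] Matrix (Fin 5) (Fin 5) ℂ := lift q (isRep_mat q)

theorem mat_a : mat q (a q) = matA q := lift_a ..
theorem mat_a' : mat q (a' q) = matA' q := lift_a' ..
theorem mat_c : mat q (c q) = matC q := lift_c ..
theorem mat_c' : mat q (c' q) = matC' q := lift_c' ..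

-- Row 0 of `mat q x` is the would-be coordinate vector of x in A/Q, so it must vanish on the
-- generators of Q.
set_option maxHeartbeats 1000000 in
theorem mat_idealGen (i : Fin 9) (j : Fin 5) : mat q (idealGen q i) 0 j = 0 := by
  have := qc_ne_zero q
  fin_cases i <;> fin_cases j <;>
    simp [idealGen, mat_a, mat_a', mat_c, mat_c', matA, matA', matC, matC', Matrix.mul_apply,
      Fin.sum_univ_five] <;> field_simp <;> first | ring1 | (right; ring1)

/-- Row 0 of a product is row 0 of the left factor times the right factor, so its vanishing passes
from the generators to the whole right ideal. -/
theorem mat_ideal {x : SUq q} (hx : x ∈ (fourDPlus q).ideal) (j : Fin 5) : mat q x 0 j = 0 := by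
  revert j
  refine Submodule.span_induction ?_ ?_ ?_ ?_ hx
  · rintro _ ⟨i, rfl⟩ j
    exact mat_idealGen q i j
  · simp
  · intro x y _ _ hx hy j
    simp [hx, hy]
  · intro y x _ hx j
    change mat q (x * y.unop) 0 j = 0
    simp [Matrix.mul_apply, hx]

/-- The linear functionals on the left invariant one-forms given by the matrix entries. -/
def dual (j : Fin 4) : (fourDPlus q).Inv →ₗ[ℂ] ℂ :=
  (((fourDPlus q).ideal.submoduleOf (augmentation (SUq q))).restrictScalars ℂ).liftQ
    (Matrix.entryLinearMap ℂ ℂ (0 : Fin 5) j.succ ∘ₗ (mat q).toLinearMap ∘ₗ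
      ((augmentation (SUq q)).restrictScalars ℂ).subtype)
    (by intro x hx; exact mat_ideal q hx _) ∘ₗ
  (Submodule.Quotient.restrictScalarsEquiv ℂ
    ((fourDPlus q).ideal.submoduleOf (augmentation (SUq q)))).symm.toLinearMap

/-- Subtracting ε(x)1 changes only the diagonal entry of row 0, which the shift `j.succ` avoids. -/
theorem dual_fcls (j : Fin 4) (x : SUq q) : dual q j (fcls q x) = mat q x 0 j.succ := by
  change mat q (x - ε q x • 1) 0 j.succ = _
  simp [Matrix.one_apply, (Fin.succ_ne_zero j).symm]

theorem dual_eP : (fun j => dual q j (eP q)) = ![1, 0, 0, 0] := by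
  ext j; fin_cases j <;> simp [eP, dual_fcls, mat_c, matC]
theorem dual_eM : (fun j => dual q j (eM q)) = ![0, 1, 0, 0] := by
  ext j; fin_cases j <;> simp [eM, dual_fcls, mat_c', matC']
theorem dual_eX : (fun j => dual q j (eX q)) = ![0, 0, 0, 1] := by
  ext j; fin_cases j <;> simp [eX, dual_fcls, mat_a, matA]
theorem dual_eZ : (fun j => dual q j (eZ q)) = ![0, 0, 1, 0] := by
  have := one_add_qc_ne_zero q
  ext j; fin_cases j <;> simp [eZ, dual_fcls, mat_c, mat_c', matC, matC', Matrix.mul_apply,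
      Fin.sum_univ_five, this]

theorem dual_eP' (j : Fin 4) : dual q j (eP q) = ![1, 0, 0, 0] j := congrFun (dual_eP q) j
theorem dual_eM' (j : Fin 4) : dual q j (eM q) = ![0, 1, 0, 0] j := congrFun (dual_eM q) j
theorem dual_eZ' (j : Fin 4) : dual q j (eZ q) = ![0, 0, 1, 0] j := congrFun (dual_eZ q) j
theorem dual_eX' (j : Fin 4) : dual q j (eX q) = ![0, 0, 0, 1] j := congrFun (dual_eX q) j

/-! ### The braiding on the left invariant one-forms -/

open TensorProduct

theorem coaction_fcls (x : SUq q) : (fourDPlus q).coaction (fcls q x) =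
    (fcls q).rTensor _ (adjointCoaction (SUq q) x) := by
  have h : (fourDPlus q).coaction (fcls q x) =
    (fcls q).rTensor _ (adjointCoaction (SUq q) (x - ε q x • 1)) := rfl
  rw [h, map_sub, map_smul, ad_one, map_sub, map_smul, LinearMap.rTensor_tmul, fcls_one, zero_tmul,
    smul_zero, sub_zero]

/-- The left invariant one-form `[a* - a]`. -/
def eG : (fourDPlus q).Inv := fcls q (a' q - a q)

theorem eG_eq : eG q = -(1 + qc q + qc q ^ 2) • eZ q - (1 + (qc q)⁻¹) • eX q := by
  rw [eG, map_sub, fcls_a', eX]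
  module

theorem coaction_eP : (fourDPlus q).coaction (eP q) =
    eP q ⊗ₜ (a q * a q) + eG q ⊗ₜ (a q * c q) + eM q ⊗ₜ (qc q ^ 2 • (c q * c q)) := by
  rw [eP, coaction_fcls, ad_c]
  simp only [map_add, LinearMap.rTensor_tmul]
  rfl

theorem coaction_eM : (fourDPlus q).coaction (eM q) =
    eP q ⊗ₜ (c' q * c' q) - eG q ⊗ₜ (a' q * c' q) + eM q ⊗ₜ (a' q * a' q) := by
  rw [eM, coaction_fcls, ad_c']
  simp only [eP, eM, eG, map_add, map_sub, LinearMap.rTensor_tmul]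

/-- The span of a and a* is also spanned by the coinvariant q²a + a* and the difference a* - a,
whose coactions are known: (1 + q²)a = (q²a + a*) - (a* - a). -/
theorem ad_a : adjointCoaction (SUq q) (a q) = a q ⊗ₜ 1 + c q ⊗ₜ ((qc q)⁻¹ • (a q * c' q)) +
    (a' q - a q) ⊗ₜ (c q * c' q) - c' q ⊗ₜ (qc q • (a' q * c q)) := by
  have h1 := qc_ne_zero q
  have h2 := one_add_qc_sq_ne_zero q
  have h : adjointCoaction (SUq q) (a q) = (1 + qc q ^ 2)⁻¹ •
      (adjointCoaction (SUq q) (qc q ^ 2 • a q + a' q) -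
        adjointCoaction (SUq q) (a' q - a q)) := by
    rw [← map_sub, ← map_smul]
    congr 1
    match_scalars <;> field_simp <;> ring
  rw [h, ad_trace, ad_diff]
  simp only [tmul_sub, tmul_add, tmul_smul, sub_tmul, add_tmul, ← smul_tmul']
  match_scalars <;> field_simp <;> ring

theorem coaction_eX : (fourDPlus q).coaction (eX q) =
    eX q ⊗ₜ 1 + eP q ⊗ₜ ((qc q)⁻¹ • (a q * c' q)) +
    eG q ⊗ₜ (c q * c' q) - eM q ⊗ₜ (qc q • (a' q * c q)) := by
  rw [eX, coaction_fcls, ad_a]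
  simp only [eP, eM, eG, eX, map_add, map_sub, LinearMap.rTensor_tmul]

theorem coaction_eG : (fourDPlus q).coaction (eG q) =
    eP q ⊗ₜ[ℂ] (-(qc q + (qc q)⁻¹) • (a q * c' q)) + eG q ⊗ₜ (1 - (1 + qc q ^ 2) • (c q * c' q)) +
    eM q ⊗ₜ ((qc q + qc q ^ 3) • (a' q * c q)) := by
  rw [eG, coaction_fcls, ad_diff]
  simp only [map_add, LinearMap.rTensor_tmul]
  rfl

/-- This gives `eZ` a representative that is linear in a and a*, so its coaction needs no
computation of Ad(cc*). -/
theorem eZ_eq : eZ q = -(1 + qc q + qc q ^ 2)⁻¹ • (eG q + (1 + (qc q)⁻¹) • eX q) := by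
  have h1 := qc_ne_zero q
  have h2 := one_add_qc_add_sq_ne_zero q
  rw [eG_eq]
  match_scalars <;> field_simp <;> ring

theorem coaction_eZ : (fourDPlus q).coaction (eZ q) =
    eZ q ⊗ₜ 1 - (1 - qc q) • (eP q ⊗ₜ ((qc q)⁻¹ ^ 2 • (a q * c' q)) +
      eG q ⊗ₜ ((qc q)⁻¹ • (c q * c' q)) - eM q ⊗ₜ (a' q * c q)) := by
  have h1 := qc_ne_zero q
  have h2 := one_add_qc_add_sq_ne_zero q
  have h : (fourDPlus q).coaction (eZ q) = -(1 + qc q + qc q ^ 2)⁻¹ •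
      ((fourDPlus q).coaction (eG q) + (1 + (qc q)⁻¹) • (fourDPlus q).coaction (eX q)) := by
    conv_lhs => rw [eZ_eq]
    rw [map_smul, map_add, map_smul]
  rw [h, coaction_eG, coaction_eX]
  conv_rhs => rw [eZ_eq]
  simp only [tmul_sub, tmul_add, tmul_smul, sub_tmul, add_tmul, ← smul_tmul', smul_add, smul_sub]
  match_scalars <;> field_simp <;> ring

end SUq
end QuantumSphere
end

noncomputable section

namespace QuantumSphere
namespace SUq

open TensorProduct

variable (q : Param)

/-- The braiding on left invariant one-forms. -/
def br : Module.End ℂ ((fourDPlus q).Inv ⊗[ℂ] (fourDPlus q).Inv) := (fourDPlus q).braiding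

/-- The map `u ⊗ h ↦ u ⊗ v · h`. -/
def insertAct (v : (fourDPlus q).Inv) :
    (fourDPlus q).Inv ⊗[ℂ] SUq q →ₗ[ℂ] (fourDPlus q).Inv ⊗[ℂ] (fourDPlus q).Inv :=
  LinearMap.lTensor _ (LinearMap.flip ((fourDPlus q).invAct.toLinearMap ∘ₗ
    (MulOpposite.opLinearEquiv ℂ).toLinearMap) v)

theorem insertAct_tmul (u v : (fourDPlus q).Inv) (h : SUq q) :
    insertAct q v (u ⊗ₜ h) = u ⊗ₜ act q h v := rfl

theorem br_tmul (v w : (fourDPlus q).Inv) :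
    br q (v ⊗ₜ w) = insertAct q v ((fourDPlus q).coaction w) := by
  simp only [br, CalculusIdeal.braiding, LinearMap.comp_apply, LinearMap.lTensor_tmul]
  generalize (fourDPlus q).coaction w = u
  induction u with
  | zero => simp
  | add u v hu hv => simp only [tmul_add, map_add, hu, hv]
  | tmul u h => rfl

theorem act_smul (r : ℂ) (h : SUq q) (v : (fourDPlus q).Inv) :
    act q (r • h) v = r • act q h v := by simp [act]
theorem act_one (v : (fourDPlus q).Inv) : act q 1 v = v := by simp [act]
theorem act_sub (g h : SUq q) (v : (fourDPlus q).Inv) :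
    act q (g - h) v = act q g v - act q h v := by simp [act]

theorem act_eG_a : act q (a q) (eG q) = qc q • eG q + (qc q ^ 2 + qc q ^ 3) • eZ q := by
  have h1 := qc_ne_zero q
  rw [eG_eq, map_sub, map_smul, map_smul, act_eZ_a, act_eX_a]
  match_scalars <;> field_simp <;> ring
theorem act_eG_a' : act q (a' q) (eG q) = (qc q)⁻¹ • eG q - (1 + qc q) • eZ q := by
  have h1 := qc_ne_zero q
  rw [eG_eq, map_sub, map_smul, map_smul, act_eZ_a', act_eX_a']
  match_scalars <;> field_simp <;> ring
theorem act_eG_c : act q (c q) (eG q) = ((qc q)⁻¹ - qc q) • eP q := by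
  have h1 := qc_ne_zero q
  rw [eG_eq, map_sub, map_smul, map_smul, act_eZ_c, act_eX_c]
  match_scalars <;> field_simp <;> ring
theorem act_eG_c' : act q (c' q) (eG q) = ((qc q)⁻¹ - qc q) • eM q := by
  have h1 := qc_ne_zero q
  rw [eG_eq, map_sub, map_smul, map_smul, act_eZ_c', act_eX_c']
  match_scalars <;> field_simp <;> ring

theorem act_table :
    (act q (a q) (eP q) = eP q ∧ act q (a' q) (eP q) = eP q ∧ act q (c q) (eP q) = 0 ∧
      act q (c' q) (eP q) = (1 + qc q) • eZ q) ∧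
    (act q (a q) (eM q) = eM q ∧ act q (a' q) (eM q) = eM q ∧
      act q (c q) (eM q) = (1 + qc q) • eZ q ∧ act q (c' q) (eM q) = 0) ∧
    (act q (a q) (eZ q) = (qc q)⁻¹ • eZ q ∧ act q (a' q) (eZ q) = qc q • eZ q ∧
      act q (c q) (eZ q) = 0 ∧ act q (c' q) (eZ q) = 0) ∧
    (act q (a q) (eG q) = qc q • eG q + (qc q ^ 2 + qc q ^ 3) • eZ q ∧
      act q (a' q) (eG q) = (qc q)⁻¹ • eG q - (1 + qc q) • eZ q ∧
      act q (c q) (eG q) = ((qc q)⁻¹ - qc q) • eP q ∧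
      act q (c' q) (eG q) = ((qc q)⁻¹ - qc q) • eM q) :=
  ⟨⟨act_eP_a q, act_eP_a' q, act_eP_c q, act_eP_c' q⟩, ⟨act_eM_a q, act_eM_a' q, act_eM_c q,
    act_eM_c' q⟩, ⟨act_eZ_a q, act_eZ_a' q, act_eZ_c q, act_eZ_c' q⟩, act_eG_a q, act_eG_a' q,
    act_eG_c q, act_eG_c' q⟩

/-- The braiding table is grouped by the second factor, since σ(v ⊗ w) inserts v into the coaction
of w. The vector `eG` replaces `eX` because [c], [a* - a], [c*] span a subcomodule. -/
theorem br_eP :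
    (br q (eP q ⊗ₜ eP q) =
    eP q ⊗ₜ eP q) ∧
    (br q (eM q ⊗ₜ eP q) =
    eP q ⊗ₜ eM q + (1 + qc q) • (eG q ⊗ₜ eZ q)) ∧
    (br q (eZ q ⊗ₜ eP q) =
    ((qc q)⁻¹ ^ 2) • (eP q ⊗ₜ eZ q)) ∧
    (br q (eG q ⊗ₜ eP q) =
    (qc q ^ 2) • (eP q ⊗ₜ eG q) +
    (qc q + qc q ^ 2 + qc q ^ 3 + qc q ^ 4) • (eP q ⊗ₜ eZ q) +
    (1 - qc q ^ 2) • (eG q ⊗ₜ eP q)) := by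
  have h1 := qc_ne_zero q
  refine ⟨?_, ?_, ?_, ?_⟩ <;>
  · simp only [br_tmul, coaction_eP, map_add, map_sub, map_smul, insertAct_tmul, act_smul, act_one,
      act_mul, act_table, act_sub, map_zero, tmul_zero, tmul_add, tmul_sub, tmul_smul, ← smul_tmul',
      smul_add, smul_sub, smul_zero]
    match_scalars <;> field_simp <;> ring

theorem br_eM :
    (br q (eP q ⊗ₜ eM q) =
    (-1 - qc q) • (eG q ⊗ₜ eZ q) + eM q ⊗ₜ eP q) ∧
    (br q (eM q ⊗ₜ eM q) =
    eM q ⊗ₜ eM q) ∧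
    (br q (eZ q ⊗ₜ eM q) =
    (qc q ^ 2) • (eM q ⊗ₜ eZ q)) ∧
    (br q (eG q ⊗ₜ eM q) =
    (-(qc q)⁻¹ ^ 2 + 1) • (eG q ⊗ₜ eM q) +
    ((qc q)⁻¹ ^ 2) • (eM q ⊗ₜ eG q) +
    (-(qc q)⁻¹ - 1 - qc q - qc q ^ 2) • (eM q ⊗ₜ eZ q)) := by
  have h1 := qc_ne_zero q
  refine ⟨?_, ?_, ?_, ?_⟩ <;>
  · simp only [br_tmul, coaction_eM, map_add, map_sub, map_smul, insertAct_tmul, act_smul, act_one,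
      act_mul, act_table, act_sub, map_zero, tmul_zero, tmul_add, tmul_sub, tmul_smul, ← smul_tmul',
      smul_add, smul_sub, smul_zero]
    match_scalars <;> field_simp <;> ring

theorem br_eZ :
    (br q (eP q ⊗ₜ eZ q) =
    eZ q ⊗ₜ eP q + (-(qc q)⁻¹ ^ 2 + 1) • (eP q ⊗ₜ eZ q)) ∧
    (br q (eM q ⊗ₜ eZ q) =
    eZ q ⊗ₜ eM q + (1 - qc q ^ 2) • (eM q ⊗ₜ eZ q)) ∧
    (br q (eZ q ⊗ₜ eZ q) =
    eZ q ⊗ₜ eZ q) ∧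
    (br q (eG q ⊗ₜ eZ q) =
    eZ q ⊗ₜ eG q +
    (-(qc q)⁻¹ ^ 2 +
    (qc q)⁻¹ + 1 - qc q) • (eP q ⊗ₜ eM q) +
    (-(qc q)⁻¹ ^ 2 + 2 - qc q ^ 2) • (eG q ⊗ₜ eZ q) +
    ((qc q)⁻¹ ^ 2 - (qc q)⁻¹ - 1 + qc q) • (eM q ⊗ₜ eP q)) := by
  have h1 := qc_ne_zero q
  refine ⟨?_, ?_, ?_, ?_⟩ <;>
  · simp only [br_tmul, coaction_eZ, map_add, map_sub, map_smul, insertAct_tmul, act_smul, act_one,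
      act_mul, act_table, act_sub, map_zero, tmul_zero, tmul_add, tmul_sub, tmul_smul, ← smul_tmul',
      smul_add, smul_sub, smul_zero]
    match_scalars <;> field_simp <;> ring

theorem br_eG :
    (br q (eP q ⊗ₜ eG q) =
    (-(qc q)⁻¹ - 1 - qc q - qc q ^ 2) • (eP q ⊗ₜ eZ q) + eG q ⊗ₜ eP q) ∧
    (br q (eM q ⊗ₜ eG q) =
    eG q ⊗ₜ eM q + (qc q + qc q ^ 2 + qc q ^ 3 + qc q ^ 4) • (eM q ⊗ₜ eZ q)) ∧
    (br q (eZ q ⊗ₜ eG q) =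
    eG q ⊗ₜ eZ q) ∧
    (br q (eG q ⊗ₜ eG q) =
    (-(qc q)⁻¹ + qc q ^ 3) • (eP q ⊗ₜ eM q) + eG q ⊗ₜ eG q +
    (-(qc q)⁻¹ - 1 + qc q ^ 3 + qc q ^ 4) • (eG q ⊗ₜ eZ q) +
    ((qc q)⁻¹ - qc q ^ 3) • (eM q ⊗ₜ eP q)) := by
  have h1 := qc_ne_zero q
  refine ⟨?_, ?_, ?_, ?_⟩ <;>
  · simp only [br_tmul, coaction_eG, map_add, map_sub, map_smul, insertAct_tmul, act_smul, act_one,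
      act_mul, act_table, act_sub, map_zero, tmul_zero, tmul_add, tmul_sub, tmul_smul, ← smul_tmul',
      smul_add, smul_sub, smul_zero]
    match_scalars <;> field_simp <;> ring

/-! ### The antisymmetrisers -/

/-- The antisymmetriser `1 - σ` on left invariant 2-tensors. -/
def asym₂ : Module.End ℂ ((fourDPlus q).Inv ⊗[ℂ] (fourDPlus q).Inv) := (fourDPlus q).antisymm₂

theorem asym₂_apply (u : (fourDPlus q).Inv ⊗[ℂ] (fourDPlus q).Inv) : asym₂ q u = u - br q u := rfl

/-- `[c*] ∧ [c c*]`, up to a factor. -/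
def eMZ : (fourDPlus q).Inv ⊗[ℂ] (fourDPlus q).Inv :=
  qc q ^ 2 • (eM q ⊗ₜ eZ q) - eZ q ⊗ₜ eM q
/-- `[c*] ∧ [c]`. -/
def eMP : (fourDPlus q).Inv ⊗[ℂ] (fourDPlus q).Inv :=
  eM q ⊗ₜ eP q - eP q ⊗ₜ eM q - (1 + qc q) • (eG q ⊗ₜ eZ q)
/-- `[c c*] ∧ [c]`, up to a factor. -/
def eZP : (fourDPlus q).Inv ⊗[ℂ] (fourDPlus q).Inv :=
  eZ q ⊗ₜ eP q - (qc q)⁻¹ ^ 2 • (eP q ⊗ₜ eZ q)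

/-- The braiding does not preserve the tensors in `eM`, `eP`, `eZ` alone: σ produces eG ⊗ eZ. That
term enters σ(eM ⊗ eP) and σ(eP ⊗ eM) with opposite signs, so both orders give the same two-form
`eMP` up to sign. -/
theorem asym₂_table :
    (asym₂ q (eM q ⊗ₜ eM q) = 0 ∧ asym₂ q (eM q ⊗ₜ eP q) = eMP q ∧
      asym₂ q (eM q ⊗ₜ eZ q) = eMZ q) ∧
    (asym₂ q (eP q ⊗ₜ eM q) = -eMP q ∧ asym₂ q (eP q ⊗ₜ eP q) = 0 ∧
      asym₂ q (eP q ⊗ₜ eZ q) = -eZP q) ∧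
    (asym₂ q (eZ q ⊗ₜ eM q) = -eMZ q ∧ asym₂ q (eZ q ⊗ₜ eP q) = eZP q ∧
      asym₂ q (eZ q ⊗ₜ eZ q) = 0) := by
  have h1 := qc_ne_zero q
  refine ⟨⟨?_, ?_, ?_⟩, ⟨?_, ?_, ?_⟩, ?_, ?_, ?_⟩ <;>
  · simp only [asym₂_apply, br_eP, br_eM, br_eZ, eMZ, eMP, eZP]
    try match_scalars <;> (try field_simp) <;> ring

/-- The antisymmetriser on left invariant 3-tensors. -/
def asym₃ : Module.End ℂ
    ((fourDPlus q).Inv ⊗[ℂ] ((fourDPlus q).Inv ⊗[ℂ] (fourDPlus q).Inv)) := (fourDPlus q).antisymm₃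

/-- The map `u ⊗ w ↦ u ⊗_H w` from 2-tensors and one-forms to 3-tensors. -/
def tens₃ (w : (fourDPlus q).Inv) : (fourDPlus q).Inv ⊗[ℂ] (fourDPlus q).Inv →ₗ[ℂ]
    (fourDPlus q).Inv ⊗[ℂ] ((fourDPlus q).Inv ⊗[ℂ] (fourDPlus q).Inv) :=
  (TensorProduct.assoc ℂ _ _ _).toLinearMap ∘ₗ (TensorProduct.mk ℂ _ _).flip w

theorem tens₃_tmul (u v w : (fourDPlus q).Inv) : tens₃ q w (u ⊗ₜ v) = u ⊗ₜ (v ⊗ₜ w) := rfl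

/-- The map `1 - σ₂ + σ₁σ₂`. -/
def shuffle₃ : Module.End ℂ
    ((fourDPlus q).Inv ⊗[ℂ] ((fourDPlus q).Inv ⊗[ℂ] (fourDPlus q).Inv)) :=
  1 - (fourDPlus q).braiding₂ + (fourDPlus q).braiding₁ * (fourDPlus q).braiding₂

/-- This is the coset decomposition of S₃ over the subgroup generated by the first transposition.
Degree three can therefore reuse the degree two table instead of treating 27 products. -/
theorem antisymm₃_factor {R : Type*} [Ring R] (x y : R) :
    1 - x - y + x * y + y * x - x * y * x = (1 - y + x * y) * (1 - x) := by
  noncomm_ring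

theorem asym₃_tmul (u v w : (fourDPlus q).Inv) :
    asym₃ q (u ⊗ₜ (v ⊗ₜ w)) = shuffle₃ q (tens₃ q w (asym₂ q (u ⊗ₜ v))) := by
  have h : asym₃ q = shuffle₃ q * (1 - (fourDPlus q).braiding₁) := by
    unfold asym₃ shuffle₃ CalculusIdeal.antisymm₃
    exact antisymm₃_factor (fourDPlus q).braiding₁ (fourDPlus q).braiding₂
  rw [h, asym₂_apply, map_sub]
  rfl

/-- The braiding of the first two factors, in curried form. -/
def br₁ (u : (fourDPlus q).Inv) : (fourDPlus q).Inv ⊗[ℂ] (fourDPlus q).Inv →ₗ[ℂ]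
    (fourDPlus q).Inv ⊗[ℂ] ((fourDPlus q).Inv ⊗[ℂ] (fourDPlus q).Inv) :=
  (fourDPlus q).braiding₁ ∘ₗ TensorProduct.mk ℂ _ _ u

theorem br₁_tmul (u v w : (fourDPlus q).Inv) :
    br₁ q u (v ⊗ₜ w) = tens₃ q w (br q (u ⊗ₜ v)) := rfl

theorem shuffle₃_tmul (u v w : (fourDPlus q).Inv) :
    shuffle₃ q (u ⊗ₜ (v ⊗ₜ w)) =
      u ⊗ₜ (v ⊗ₜ w) - u ⊗ₜ br q (v ⊗ₜ w) + br₁ q u (br q (v ⊗ₜ w)) := rfl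

/-- `[c*] ∧ [c] ∧ [c c*]`, up to a factor. -/
def eMPZ : (fourDPlus q).Inv ⊗[ℂ] ((fourDPlus q).Inv ⊗[ℂ] (fourDPlus q).Inv) :=
  eM q ⊗ₜ (eP q ⊗ₜ eZ q) - eP q ⊗ₜ (eM q ⊗ₜ eZ q) - qc q ^ 2 • (eM q ⊗ₜ (eZ q ⊗ₜ eP q)) +
    (qc q)⁻¹ ^ 2 • (eP q ⊗ₜ (eZ q ⊗ₜ eM q)) + eZ q ⊗ₜ (eM q ⊗ₜ eP q) - eZ q ⊗ₜ (eP q ⊗ₜ eM q) -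
    (1 + qc q) • (eZ q ⊗ₜ (eG q ⊗ₜ eZ q))

-- Only the combinations of total weight 0 survive, and all of them are multiples of one tensor.
-- This is why Ω³ has rank one.
set_option maxHeartbeats 1000000 in
theorem shuffle₃_table :
    (shuffle₃ q (tens₃ q (eM q) (eMZ q)) = 0 ∧ shuffle₃ q (tens₃ q (eP q) (eMZ q)) = -eMPZ q ∧
      shuffle₃ q (tens₃ q (eZ q) (eMZ q)) = 0) ∧
    (shuffle₃ q (tens₃ q (eM q) (eMP q)) = 0 ∧ shuffle₃ q (tens₃ q (eP q) (eMP q)) = 0 ∧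
      shuffle₃ q (tens₃ q (eZ q) (eMP q)) = eMPZ q) ∧
    (shuffle₃ q (tens₃ q (eM q) (eZP q)) = -eMPZ q ∧ shuffle₃ q (tens₃ q (eP q) (eZP q)) = 0 ∧
      shuffle₃ q (tens₃ q (eZ q) (eZP q)) = 0) := by
  have h1 := qc_ne_zero q
  refine ⟨⟨?_, ?_, ?_⟩, ⟨?_, ?_, ?_⟩, ?_, ?_, ?_⟩ <;>
  · simp only [eMZ, eMP, eZP, eMPZ, map_add, map_sub, map_smul, tens₃_tmul, shuffle₃_tmul, br_eP,
      br_eM, br_eZ, br_eG, br₁_tmul, tmul_add, tmul_sub, tmul_smul]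
    match_scalars <;> field_simp <;> ring

end SUq
end QuantumSphere
end

noncomputable section

namespace QuantumSphere
namespace SUq

open TensorProduct

variable {q : Param}

/-! ### The grading of `A(SU_q(2))` by the line bundles -/

theorem mem_lineBundle {n : ℤ} {x : SUq q} :
    x ∈ lineBundle q n ↔ δR q x = x ⊗ₜ[ℂ] LaurentPolynomial.T (-n) := Iff.rfl

theorem mem_sphere {x : SUq q} : x ∈ sphere q ↔ x ∈ lineBundle q 0 := Iff.rfl

theorem π_a : π q (a q) = .T 1 := lift_a ..
theorem π_a' : π q (a' q) = .T (-1) := lift_a' ..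
theorem π_c : π q (c q) = 0 := lift_c ..
theorem π_c' : π q (c' q) = 0 := lift_c' ..

theorem a_mem : a q ∈ lineBundle q (-1) := by
  simp [mem_lineBundle, δR, Δ_a, π_a, π_c]
theorem a'_mem : a' q ∈ lineBundle q 1 := by
  simp [mem_lineBundle, δR, Δ_a', π_a', π_c']
theorem c_mem : c q ∈ lineBundle q (-1) := by
  simp [mem_lineBundle, δR, Δ_c, π_a, π_c]
theorem c'_mem : c' q ∈ lineBundle q 1 := by
  simp [mem_lineBundle, δR, Δ_c', π_a', π_c']

theorem one_mem_lineBundle : (1 : SUq q) ∈ lineBundle q 0 := by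
  simp [mem_lineBundle, Algebra.TensorProduct.one_def]

theorem mul_mem_lineBundle {m n : ℤ} {x y : SUq q} (hx : x ∈ lineBundle q m)
    (hy : y ∈ lineBundle q n) : x * y ∈ lineBundle q (m + n) := by
  rw [mem_lineBundle] at *
  rw [map_mul, hx, hy, Algebra.TensorProduct.tmul_mul_tmul, ← LaurentPolynomial.T_add, neg_add]

theorem mul_mem_lineBundle_of_eq {m n k : ℤ} {x y : SUq q} (hx : x ∈ lineBundle q m)
    (hy : y ∈ lineBundle q n) (h : m + n = k) : x * y ∈ lineBundle q k :=
  h ▸ mul_mem_lineBundle hx hy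

theorem smul_mem_lineBundle {n : ℤ} (r : ℂ) {x : SUq q} (hx : x ∈ lineBundle q n) :
    r • x ∈ lineBundle q n := by
  rw [mem_lineBundle] at *
  rw [map_smul, hx, smul_tmul']

/-- The projection of `A(SU_q(2))` onto the line bundle `L_n`. -/
def proj (q : Param) (n : ℤ) : SUq q →ₗ[ℂ] SUq q :=
  (TensorProduct.rid ℂ _).toLinearMap ∘ₗ
    (Finsupp.lapply (-n) ∘ₗ
      (AddMonoidAlgebra.coeffLinearEquiv ℂ (S := ℂ) (M := ℤ)).toLinearMap).lTensor _ ∘ₗ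
    (δR q).toLinearMap

theorem proj_of_mem {m n : ℤ} {x : SUq q} (hx : x ∈ lineBundle q m) :
    proj q n x = if m = n then x else 0 := by
  rw [mem_lineBundle] at hx
  have : (AddMonoidAlgebra.coeffLinearEquiv ℂ (S := ℂ) (M := ℤ))
      (LaurentPolynomial.T (-m)) (-n) = if m = n then (1 : ℂ) else 0 := by
    change (LaurentPolynomial.T (-m) : LaurentPolynomial ℂ).coeff (-n) = _
    simp [LaurentPolynomial.T_apply]
  simp only [proj, LinearMap.comp_apply, AlgHom.toLinearMap_apply, hx, LinearMap.lTensor_tmul,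
    LinearEquiv.coe_coe, Finsupp.lapply_apply, this, TensorProduct.rid_tmul]
  split_ifs <;> simp

/-- Induction on homogeneous elements: a family of subspaces containing `1` and closed under right
multiplication by the generators contains all line bundles. -/
theorem lineBundle_induction {P : ℤ → Submodule ℂ (SUq q)} (h1 : 1 ∈ P 0)
    (ha : ∀ n, ∀ x ∈ lineBundle q n, x ∈ P n → x * a q ∈ P (n - 1))
    (ha' : ∀ n, ∀ x ∈ lineBundle q n, x ∈ P n → x * a' q ∈ P (n + 1))
    (hc : ∀ n, ∀ x ∈ lineBundle q n, x ∈ P n → x * c q ∈ P (n - 1))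
    (hc' : ∀ n, ∀ x ∈ lineBundle q n, x ∈ P n → x * c' q ∈ P (n + 1))
    {n : ℤ} {x : SUq q} (hx : x ∈ lineBundle q n) : x ∈ P n := by
  -- Intersecting with L_n keeps track of homogeneity, so that `proj` can later separate the
  -- summands of ⨆ R n.
  let R : ℤ → Submodule ℂ (SUq q) := fun n =>
    { carrier := {x | x ∈ lineBundle q n ∧ x ∈ P n}
      add_mem' := fun h h' => ⟨add_mem h.1 h'.1, add_mem h.2 h'.2⟩
      zero_mem' := ⟨zero_mem _, zero_mem _⟩
      smul_mem' := fun r _ h => ⟨smul_mem_lineBundle r h.1, (P n).smul_mem r h.2⟩ }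
  have hgen : ∀ g : SUq q, (∀ n, ∀ x ∈ R n, ∃ m, x * g ∈ R m) →
      ∀ x ∈ ⨆ n, R n, x * g ∈ ⨆ n, R n := by
    intro g hg x hx
    induction hx using Submodule.iSup_induction' with
    | mem n x hx =>
      obtain ⟨m, hm⟩ := hg n x hx
      exact Submodule.mem_iSup_of_mem m hm
    | zero => simp
    | add x y _ _ hx hy => rw [add_mul]; exact add_mem hx hy
  -- Applied to x = 1, stability under right multiplication shows that the sum of the R n is the
  -- whole algebra.
  have hall : ∀ y : SUq q, ∀ x ∈ ⨆ n, R n, x * y ∈ ⨆ n, R n := by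
    intro y
    induction y using induction with
    | h0 r =>
      intro x hx
      rw [← Algebra.commutes, ← Algebra.smul_def]
      exact Submodule.smul_mem _ r hx
    | h1 => exact hgen _ fun n x hx => ⟨n - 1, mul_mem_lineBundle hx.1 a_mem, ha n x hx.1 hx.2⟩
    | h2 => exact hgen _ fun n x hx => ⟨n + 1, mul_mem_lineBundle hx.1 a'_mem, ha' n x hx.1 hx.2⟩
    | h3 => exact hgen _ fun n x hx => ⟨n - 1, mul_mem_lineBundle hx.1 c_mem, hc n x hx.1 hx.2⟩
    | h4 => exact hgen _ fun n x hx => ⟨n + 1, mul_mem_lineBundle hx.1 c'_mem, hc' n x hx.1 hx.2⟩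
    | hm y z hy hz => intro x hx; rw [← mul_assoc]; exact hz _ (hy _ hx)
    | ha y z hy hz => intro x hx; rw [mul_add]; exact add_mem (hy _ hx) (hz _ hx)
  have hproj : ∀ y ∈ ⨆ n, R n, proj q n y ∈ R n := by
    intro y hy
    induction hy using Submodule.iSup_induction' with
    | mem m y hy =>
      rw [proj_of_mem hy.1]
      split_ifs with h
      · exact h ▸ hy
      · exact zero_mem _
    | zero => simp
    | add x y _ _ hx hy => rw [map_add]; exact add_mem hx hy
  have h := hproj _ (hall x 1 (Submodule.mem_iSup_of_mem 0 ⟨one_mem_lineBundle, h1⟩))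
  rw [one_mul, proj_of_mem hx, if_pos rfl] at h
  exact h.2

/-- `1 ∈ L_{-n} L_n`. -/
theorem one_mem_span_mul (q : Param) (n : ℤ) : (1 : SUq q) ∈
    Submodule.span ℂ {x | ∃ u ∈ lineBundle q (-n), ∃ v ∈ lineBundle q n, x = u * v} := by
  have step : ∀ (k m : ℤ) (f g f' g' : SUq q), f ∈ lineBundle q (-k) → g ∈ lineBundle q k →
      f' ∈ lineBundle q (-k) → g' ∈ lineBundle q k → f * g + f' * g' = 1 →
      (1 : SUq q) ∈
        Submodule.span ℂ {x | ∃ u ∈ lineBundle q (-m), ∃ v ∈ lineBundle q m, x = u * v} →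
      (1 : SUq q) ∈ Submodule.span ℂ
        {x | ∃ u ∈ lineBundle q (-(m + k)), ∃ v ∈ lineBundle q (m + k), x = u * v} := by
    intro k m f g f' g' hf hg hf' hg' h1 h
    have key : ∀ y ∈ Submodule.span ℂ
        {x | ∃ u ∈ lineBundle q (-m), ∃ v ∈ lineBundle q m, x = u * v},
        f * y * g + f' * y * g' ∈ Submodule.span ℂ
          {x | ∃ u ∈ lineBundle q (-(m + k)), ∃ v ∈ lineBundle q (m + k), x = u * v} := by
      intro y hy
      induction hy using Submodule.span_induction with
      | mem y hy =>
        obtain ⟨u, hu, v, hv, rfl⟩ := hy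
        refine add_mem (Submodule.subset_span ⟨f * u, ?_, v * g, ?_, by simp only [mul_assoc]⟩)
          (Submodule.subset_span ⟨f' * u, ?_, v * g', ?_, by simp only [mul_assoc]⟩)
        · exact mul_mem_lineBundle_of_eq hf hu (by ring)
        · exact mul_mem_lineBundle hv hg
        · exact mul_mem_lineBundle_of_eq hf' hu (by ring)
        · exact mul_mem_lineBundle hv hg'
      | zero => simp
      | add x y _ _ hx hy =>
        convert add_mem hx hy using 1
        simp only [mul_add, add_mul]; abel
      | smul r x _ hx =>
        convert Submodule.smul_mem _ r hx using 1
        simp only [mul_smul_comm, smul_mul_assoc, smul_add]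
    simpa only [mul_one, h1] using key 1 h
  have h0 : (1 : SUq q) ∈
      Submodule.span ℂ {x | ∃ u ∈ lineBundle q (-0), ∃ v ∈ lineBundle q 0, x = u * v} :=
    Submodule.subset_span
      ⟨1, by simpa using one_mem_lineBundle, 1, one_mem_lineBundle, (one_mul 1).symm⟩
  induction n using Int.induction_on with
  | zero => exact h0
  | succ n ih =>
    -- Upwards the relation aa* + q²cc* = 1 is wrapped around the decomposition for n. Downwards a*a
    -- + c*c = 1 plays the same role.
    refine step 1 n (a q) (a' q) (qc q ^ 2 • c q) (c' q) a_mem a'_mem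
      (smul_mem_lineBundle _ c_mem) c'_mem ?_ ih
    rw [smul_mul_assoc, a_mul_a']
  | pred n ih =>
    have h := step (-1) (-n) (a' q) (a q) (c' q) (c q) (by simpa using a'_mem) a_mem
      (by simpa using c'_mem) c_mem (a'_mul_a q) ih
    rwa [← sub_eq_add_neg] at h

end SUq
end QuantumSphere
end

/-! ### Bimodule properties of A ⊗ W and of the product over A. -/

noncomputable section

namespace QuantumSphere

namespace RAct

open TensorProduct

variable {H : Type*} [Ring H] [HopfAlgebra ℂ H] {W W' : Type*} [AddCommGroup W] [Module ℂ W]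
  [AddCommGroup W'] [Module ℂ W'] (ρ : RAct H W)

theorem forms_smul (h x : H) (θ : H ⊗[ℂ] W) :
    ρ.forms (.op h) (x • θ) = x • ρ.forms (.op h) θ := by
  induction θ with
  | zero => simp
  | add θ η hθ hη => simp only [smul_add, map_add, hθ, hη]
  | tmul y w =>
    rw [TensorProduct.smul_tmul', smul_eq_mul, forms_tmul, forms_tmul]
    generalize Coalgebra.comul (R := ℂ) h = u
    induction u with
    | zero => simp
    | add u v hu hv => simp only [map_add, hu, hv, smul_add]
    | tmul u v => simp [TensorProduct.smul_tmul', mul_assoc]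

theorem forms_mul_apply (x y : H) (θ : H ⊗[ℂ] W) :
    ρ.forms (.op (x * y)) θ = ρ.forms (.op y) (ρ.forms (.op x) θ) := by
  rw [MulOpposite.op_mul, map_mul, Module.End.mul_apply]

theorem mulTensor_add_left (θ θ' : H ⊗[ℂ] W) (η : H ⊗[ℂ] W') :
    ρ.mulTensor (θ + θ') η = ρ.mulTensor θ η + ρ.mulTensor θ' η := by
  simp only [mulTensor, map_add, LinearMap.rTensor_add, LinearMap.add_apply]

theorem mulTensor_zero_left (η : H ⊗[ℂ] W') : ρ.mulTensor (0 : H ⊗[ℂ] W) η = 0 := by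
  simp [mulTensor]

theorem mulTensor_smul_left (r : ℂ) (θ : H ⊗[ℂ] W) (η : H ⊗[ℂ] W') :
    ρ.mulTensor (r • θ) η = r • ρ.mulTensor θ η := by
  simp only [mulTensor, map_smul, LinearMap.rTensor_smul, LinearMap.smul_apply]

theorem mulTensor_add_right (θ : H ⊗[ℂ] W) (η η' : H ⊗[ℂ] W') :
    ρ.mulTensor θ (η + η') = ρ.mulTensor θ η + ρ.mulTensor θ η' := by
  simp only [mulTensor, map_add]

theorem mulTensor_zero_right (θ : H ⊗[ℂ] W) : ρ.mulTensor θ (0 : H ⊗[ℂ] W') = 0 := by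
  simp [mulTensor]

theorem mulTensor_smul_right (r : ℂ) (θ : H ⊗[ℂ] W) (η : H ⊗[ℂ] W') :
    ρ.mulTensor θ (r • η) = r • ρ.mulTensor θ η := by
  simp only [mulTensor, map_smul]

theorem assoc_smul (x : H) (θ : H ⊗[ℂ] W) (w : W') :
    TensorProduct.assoc ℂ H W W' ((x • θ) ⊗ₜ w) =
      x • TensorProduct.assoc ℂ H W W' (θ ⊗ₜ w) := by
  induction θ with
  | zero => simp
  | add θ η hθ hη => simp only [smul_add, add_tmul, map_add, hθ, hη]
  | tmul y v => simp [TensorProduct.smul_tmul']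

theorem mulTensor_left_linear (x : H) (θ : H ⊗[ℂ] W) (η : H ⊗[ℂ] W') :
    ρ.mulTensor (x • θ) η = x • ρ.mulTensor θ η := by
  induction η with
  | zero => simp [mulTensor_zero_right]
  | add η ζ hη hζ => simp only [mulTensor_add_right, smul_add, hη, hζ]
  | tmul y w => rw [mulTensor_tmul, mulTensor_tmul, forms_smul, assoc_smul]

/-- The product is one over H, not merely over ℂ. Coefficients of later factors can thus be moved to
the left. -/
theorem mulTensor_balanced (x : H) (θ : H ⊗[ℂ] W) (η : H ⊗[ℂ] W') :
    ρ.mulTensor θ (x • η) = ρ.mulTensor (ρ.forms (.op x) θ) η := by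
  induction η with
  | zero => simp [mulTensor_zero_right]
  | add η ζ hη hζ => simp only [mulTensor_add_right, smul_add, hη, hζ]
  | tmul y w =>
    rw [TensorProduct.smul_tmul', smul_eq_mul, mulTensor_tmul, mulTensor_tmul, forms_mul_apply]

theorem mulTensor_one_tmul (v : W) (w : W') :
    ρ.mulTensor ((1 : H) ⊗ₜ v) ((1 : H) ⊗ₜ[ℂ] w) = (1 : H) ⊗ₜ (v ⊗ₜ w) := by
  rw [mulTensor_tmul, MulOpposite.op_one, map_one, Module.End.one_apply, TensorProduct.assoc_tmul]

end RAct

theorem lTensor_smul_left {H : Type*} [Ring H] [Algebra ℂ H] {W W' : Type*} [AddCommGroup W]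
    [Module ℂ W] [AddCommGroup W'] [Module ℂ W'] (f : W →ₗ[ℂ] W') (x : H) (θ : H ⊗[ℂ] W) :
    f.lTensor H (x • θ) = x • f.lTensor H θ := by
  induction θ with
  | zero => simp
  | add θ η hθ hη => simp only [smul_add, map_add, hθ, hη]
  | tmul y v => simp [TensorProduct.smul_tmul']

namespace SUq

open TensorProduct

variable {q : Param} {ι ι' : Type*} {W W' : Type*} [AddCommGroup W] [Module ℂ W]
  [AddCommGroup W'] [Module ℂ W']

/-! ### Homogeneous forms -/

/-- The forms `∑ φᵢ ⊗ wᵢ` with `φᵢ ∈ L_{nᵢ + k}`. -/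
def gradedForms (q : Param) (n : ι → ℤ) (w : ι → W) (k : ℤ) : Submodule ℂ (SUq q ⊗[ℂ] W) :=
  Submodule.span ℂ {θ | ∃ i, ∃ φ ∈ lineBundle q (n i + k), θ = φ ⊗ₜ w i}

/-- The span of the vectors of weight `m` in a family of vectors with weights. -/
def weightSpan (n : ι → ℤ) (w : ι → W) (m : ℤ) : Submodule ℂ W :=
  Submodule.span ℂ (w '' {j | n j = m})

theorem mem_weightSpan {n : ι → ℤ} (w : ι → W) {m : ℤ} (j : ι) (h : n j = m) :
    w j ∈ weightSpan n w m :=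
  Submodule.subset_span ⟨j, h, rfl⟩

theorem tmul_mem_gradedForms {n : ι → ℤ} {w : ι → W} {m k l : ℤ} {φ : SUq q} {u : W}
    (hφ : φ ∈ lineBundle q l) (hu : u ∈ weightSpan n w m) (h : m + k = l) :
    φ ⊗ₜ u ∈ gradedForms q n w k := by
  subst h
  induction hu using Submodule.span_induction with
  | mem u hu =>
    obtain ⟨j, rfl, rfl⟩ := hu
    exact Submodule.subset_span ⟨j, φ, hφ, rfl⟩
  | zero => simp
  | add u v _ _ hu hv => rw [tmul_add]; exact add_mem hu hv
  | smul r u _ hu => rw [tmul_smul]; exact Submodule.smul_mem _ r hu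

theorem smul_mem_gradedForms {n : ι → ℤ} {w : ι → W} {m k l : ℤ} {x : SUq q} {θ : SUq q ⊗[ℂ] W}
    (hx : x ∈ lineBundle q m) (hθ : θ ∈ gradedForms q n w k) (h : m + k = l) :
    x • θ ∈ gradedForms q n w l := by
  subst h
  induction hθ using Submodule.span_induction with
  | mem θ hθ =>
    obtain ⟨i, φ, hφ, rfl⟩ := hθ
    exact Submodule.subset_span ⟨i, x * φ, mul_mem_lineBundle_of_eq hx hφ (by ring), rfl⟩
  | zero => simp
  | add u v _ _ hu hv => rw [smul_add]; exact add_mem hu hv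
  | smul r u _ hu => rw [smul_comm]; exact Submodule.smul_mem _ r hu

/-- A family of vectors with weights whose weight spaces are permuted by the generators: `a` and
`a*` preserve weights, `c` raises and `c*` lowers them by `2`. -/
structure IsGraded (ρ : RAct (SUq q) W) (n : ι → ℤ) (w : ι → W) : Prop where
  a : ∀ i, ρ (.op (a q)) (w i) ∈ weightSpan n w (n i)
  a' : ∀ i, ρ (.op (a' q)) (w i) ∈ weightSpan n w (n i)
  c : ∀ i, ρ (.op (c q)) (w i) ∈ weightSpan n w (n i + 2)
  c' : ∀ i, ρ (.op (c' q)) (w i) ∈ weightSpan n w (n i - 2)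

theorem comul_eq (x : SUq q) : Coalgebra.comul (R := ℂ) x = Δ q x := rfl

section
variable (ρ : RAct (SUq q) W) (φ : SUq q) (w : W)

theorem forms_a : ρ.forms (.op (a q)) (φ ⊗ₜ w) =
    (φ * a q) ⊗ₜ ρ (.op (a q)) w - qc q • ((φ * c' q) ⊗ₜ ρ (.op (c q)) w) := by
  rw [RAct.forms_tmul, comul_eq, Δ_a, map_sub, map_smul]; rfl
theorem forms_a' : ρ.forms (.op (a' q)) (φ ⊗ₜ w) =
    (φ * a' q) ⊗ₜ ρ (.op (a' q)) w - qc q • ((φ * c q) ⊗ₜ ρ (.op (c' q)) w) := by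
  rw [RAct.forms_tmul, comul_eq, Δ_a', map_sub, map_smul]; rfl
theorem forms_c : ρ.forms (.op (c q)) (φ ⊗ₜ w) =
    (φ * c q) ⊗ₜ ρ (.op (a q)) w + (φ * a' q) ⊗ₜ ρ (.op (c q)) w := by
  rw [RAct.forms_tmul, comul_eq, Δ_c, map_add]; rfl
theorem forms_c' : ρ.forms (.op (c' q)) (φ ⊗ₜ w) =
    (φ * c' q) ⊗ₜ ρ (.op (a' q)) w + (φ * a q) ⊗ₜ ρ (.op (c' q)) w := by
  rw [RAct.forms_tmul, comul_eq, Δ_c', map_add]; rfl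

end

theorem map_gradedForms {n : ι → ℤ} {w : ι → W} {n' : ι' → ℤ} {w' : ι' → W'} {k l : ℤ}
    (f : SUq q ⊗[ℂ] W →ₗ[ℂ] SUq q ⊗[ℂ] W')
    (h : ∀ i, ∀ φ ∈ lineBundle q (n i + k), f (φ ⊗ₜ w i) ∈ gradedForms q n' w' l)
    {θ : SUq q ⊗[ℂ] W} (hθ : θ ∈ gradedForms q n w k) : f θ ∈ gradedForms q n' w' l := by
  have : gradedForms q n w k ≤ (gradedForms q n' w' l).comap f := by
    refine Submodule.span_le.2 ?_
    rintro _ ⟨i, φ, hφ, rfl⟩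
    exact h i φ hφ
  exact this hθ

/-- Right multiplication by elements of `L_m` shifts the degree of homogeneous forms by `m`. -/
theorem IsGraded.forms_mem {ρ : RAct (SUq q) W} {n : ι → ℤ} {w : ι → W} (h : IsGraded ρ n w)
    {m k l : ℤ} {y : SUq q} (hy : y ∈ lineBundle q m) {θ : SUq q ⊗[ℂ] W}
    (hθ : θ ∈ gradedForms q n w k) (hl : k + m = l) :
    ρ.forms (.op y) θ ∈ gradedForms q n w l := by
  subst hl
  -- The condition ranges over all degrees k, since multiplying by one factor of a product changes
  -- the degree seen by the next.
  let P : ℤ → Submodule ℂ (SUq q) := fun m =>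
    { carrier := {y | ∀ k, ∀ θ ∈ gradedForms q n w k, ρ.forms (.op y) θ ∈ gradedForms q n w (k + m)}
      add_mem' := fun hx hy k θ hθ => by
        rw [MulOpposite.op_add, map_add]
        exact add_mem (hx k θ hθ) (hy k θ hθ)
      zero_mem' := fun k θ hθ => by simp
      smul_mem' := fun r x hx k θ hθ => by
        rw [MulOpposite.op_smul, map_smul]
        exact Submodule.smul_mem _ r (hx k θ hθ) }
  have step : ∀ (g : SUq q) (e : ℤ), (∀ k, ∀ i, ∀ φ ∈ lineBundle q (n i + k),
      ρ.forms (.op g) (φ ⊗ₜ w i) ∈ gradedForms q n w (k + e)) →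
      ∀ m, ∀ x, x ∈ P m → x * g ∈ P (m + e) := by
    intro g e hg m x hx k θ hθ
    rw [RAct.forms_mul_apply, ← add_assoc]
    exact map_gradedForms (ρ.forms (.op g)) (hg (k + m)) (hx k θ hθ)
  refine lineBundle_induction (P := P) ?_ ?_ ?_ ?_ ?_ hy k θ hθ
  · intro k θ hθ
    rw [MulOpposite.op_one, map_one, add_zero]
    exact hθ
  · refine fun m x _ hx => step _ (-1) (fun k i φ hφ => ?_) m x hx
    rw [forms_a]
    exact sub_mem (tmul_mem_gradedForms (mul_mem_lineBundle hφ a_mem) (h.a i) (by ring))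
      (Submodule.smul_mem _ _
        (tmul_mem_gradedForms (mul_mem_lineBundle hφ c'_mem) (h.c i) (by ring)))
  · refine fun m x _ hx => step _ 1 (fun k i φ hφ => ?_) m x hx
    rw [forms_a']
    exact sub_mem (tmul_mem_gradedForms (mul_mem_lineBundle hφ a'_mem) (h.a' i) (by ring))
      (Submodule.smul_mem _ _
        (tmul_mem_gradedForms (mul_mem_lineBundle hφ c_mem) (h.c' i) (by ring)))
  · refine fun m x _ hx => step _ (-1) (fun k i φ hφ => ?_) m x hx
    rw [forms_c]
    exact add_mem (tmul_mem_gradedForms (mul_mem_lineBundle hφ c_mem) (h.a i) (by ring))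
      (tmul_mem_gradedForms (mul_mem_lineBundle hφ a'_mem) (h.c i) (by ring))
  · refine fun m x _ hx => step _ 1 (fun k i φ hφ => ?_) m x hx
    rw [forms_c']
    exact add_mem (tmul_mem_gradedForms (mul_mem_lineBundle hφ c'_mem) (h.a' i) (by ring))
      (tmul_mem_gradedForms (mul_mem_lineBundle hφ a_mem) (h.c' i) (by ring))

/-! ### Tensor products of homogeneous forms -/

/-- The product of two families of vectors. -/
def tensFamily (w : ι → W) (w' : ι' → W') (p : ι × ι') : W ⊗[ℂ] W' := w p.1 ⊗ₜ w' p.2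

/-- The weights of the product of two families of vectors. -/
def sumWeight (n : ι → ℤ) (n' : ι' → ℤ) (p : ι × ι') : ℤ := n p.1 + n' p.2

/-- The coefficient ψ ∈ L_{n'ⱼ} of the right factor is absorbed into θ, which raises the degree of θ
by n'ⱼ. This is the weight contributed by w'ⱼ. -/
theorem IsGraded.mulTensor_mem {ρ : RAct (SUq q) W} {n : ι → ℤ} {w : ι → W}
    (h : IsGraded ρ n w) {n' : ι' → ℤ} {w' : ι' → W'} {θ : SUq q ⊗[ℂ] W} {η : SUq q ⊗[ℂ] W'}
    (hθ : θ ∈ gradedForms q n w 0) (hη : η ∈ gradedForms q n' w' 0) :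
    ρ.mulTensor θ η ∈ gradedForms q (sumWeight n n') (tensFamily w w') 0 := by
  induction hη using Submodule.span_induction with
  | mem η hη =>
    obtain ⟨j, ψ, hψ, rfl⟩ := hη
    rw [RAct.mulTensor_tmul]
    have h1 := h.forms_mem hψ hθ rfl
    refine map_gradedForms ((TensorProduct.assoc ℂ _ _ _).toLinearMap ∘ₗ
      (TensorProduct.mk ℂ (SUq q ⊗[ℂ] W) W').flip (w' j)) ?_ h1
    intro i φ hφ
    refine Submodule.subset_span ⟨(i, j), φ, ?_, rfl⟩
    convert hφ using 2
    simp only [sumWeight]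
    ring
  | zero => rw [RAct.mulTensor_zero_right]; exact zero_mem _
  | add u v _ _ hu hv => rw [RAct.mulTensor_add_right]; exact add_mem hu hv
  | smul r u _ hu => rw [RAct.mulTensor_smul_right]; exact Submodule.smul_mem _ r hu

/-- Write 1 = Σ uv with u ∈ L_{-n'ⱼ} and v ∈ L_{n'ⱼ}. Then φ ⊗ wᵢ ⊗ w'ⱼ = Σ ((φ ⊗ wᵢ)·u) ⊗_A (v ⊗
w'ⱼ), and both factors have degree 0. -/
theorem IsGraded.le_span_mulTensor {ρ : RAct (SUq q) W} {n : ι → ℤ} {w : ι → W}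
    (h : IsGraded ρ n w) (n' : ι' → ℤ) (w' : ι' → W') :
    gradedForms q (sumWeight n n') (tensFamily w w') 0 ≤
      Submodule.span ℂ {T | ∃ θ ∈ gradedForms q n w 0, ∃ η ∈ gradedForms q n' w' 0,
        T = ρ.mulTensor θ η} := by
  refine Submodule.span_le.2 ?_
  rintro _ ⟨⟨i, j⟩, φ, hφ, rfl⟩
  have key : ∀ y ∈ Submodule.span ℂ
      {x | ∃ u ∈ lineBundle q (-n' j), ∃ v ∈ lineBundle q (n' j), x = u * v},
      TensorProduct.assoc ℂ _ _ _ (ρ.forms (.op y) (φ ⊗ₜ w i) ⊗ₜ w' j) ∈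
        Submodule.span ℂ {T | ∃ θ ∈ gradedForms q n w 0, ∃ η ∈ gradedForms q n' w' 0,
          T = ρ.mulTensor θ η} := by
    intro y hy
    induction hy using Submodule.span_induction with
    | mem y hy =>
      obtain ⟨u, hu, v, hv, rfl⟩ := hy
      refine Submodule.subset_span ⟨ρ.forms (.op u) (φ ⊗ₜ w i), ?_, v ⊗ₜ w' j, ?_, ?_⟩
      · refine h.forms_mem (k := n' j) hu (Submodule.subset_span ⟨i, φ, ?_, rfl⟩) (by ring)
        simpa [sumWeight] using hφ
      · exact Submodule.subset_span ⟨j, v, by simpa using hv, rfl⟩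
      · rw [RAct.mulTensor_tmul, RAct.forms_mul_apply]
    | zero => simp
    | add x y _ _ hx hy =>
      rw [MulOpposite.op_add, map_add, LinearMap.add_apply, add_tmul, map_add]
      exact add_mem hx hy
    | smul r x _ hx =>
      rw [MulOpposite.op_smul, map_smul, LinearMap.smul_apply, ← smul_tmul', map_smul]
      exact Submodule.smul_mem _ r hx
  have h1 := key 1 (one_mem_span_mul q (n' j))
  rwa [MulOpposite.op_one, map_one, Module.End.one_apply, TensorProduct.assoc_tmul] at h1

/-! ### Sums of line bundles -/

theorem mem_lineForms {n : ℤ} {θ x : SUq q ⊗[ℂ] W} :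
    x ∈ lineForms n θ ↔ ∃ φ ∈ lineBundle q n, φ • θ = x := Iff.rfl

theorem tmul_eq_smul (φ : SUq q) (w : W) : φ ⊗ₜ[ℂ] w = φ • ((1 : SUq q) ⊗ₜ[ℂ] w) := by
  rw [TensorProduct.smul_tmul', smul_eq_mul, mul_one]

theorem mem_iSup_lineForms {n : ι → ℤ} {w : ι → W} {x : SUq q ⊗[ℂ] W} :
    x ∈ ⨆ i, lineForms (n i) ((1 : SUq q) ⊗ₜ[ℂ] w i) ↔ x ∈ gradedForms q n w 0 := by
  constructor
  · intro hx
    induction hx using Submodule.iSup_induction' with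
    | mem i x hx =>
      obtain ⟨φ, hφ, rfl⟩ := mem_lineForms.1 hx
      exact Submodule.subset_span ⟨i, φ, by rwa [add_zero], (tmul_eq_smul _ _).symm⟩
    | zero => exact zero_mem _
    | add x y _ _ hx hy => exact add_mem hx hy
  · intro hx
    induction hx using Submodule.span_induction with
    | mem x hx =>
      obtain ⟨i, φ, hφ, rfl⟩ := hx
      rw [add_zero] at hφ
      exact Submodule.mem_iSup_of_mem i (mem_lineForms.2 ⟨φ, hφ, (tmul_eq_smul _ _).symm⟩)
    | zero => exact zero_mem _
    | add x y _ _ hx hy => exact add_mem hx hy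
    | smul r x _ hx =>
      have h := Submodule.smul_mem _ (algebraMap ℂ (sphere q) r) hx
      rwa [algebraMap_smul] at h

theorem lineForms_smul (n : ℤ) {r : ℂ} (hr : r ≠ 0) (θ : SUq q ⊗[ℂ] W) :
    lineForms n (r • θ) = lineForms n θ := by
  ext x
  rw [mem_lineForms, mem_lineForms]
  constructor
  · rintro ⟨φ, hφ, rfl⟩
    exact ⟨r • φ, smul_mem_lineBundle r hφ, by rw [smul_assoc, smul_comm]⟩
  · rintro ⟨φ, hφ, rfl⟩
    refine ⟨r⁻¹ • φ, smul_mem_lineBundle _ hφ, ?_⟩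
    rw [smul_assoc, smul_comm φ r, smul_smul, inv_mul_cancel₀ hr, one_smul]

/-- This passes from the normalised basis forms 1 ⊗ wᵢ to the forms ω₋, ω₊, ω₀ and their wedge
products. -/
theorem IsLineBundleSum.smul {ρ : RAct (SUq q) W} {Ω : Submodule (sphere q) (SUq q ⊗[ℂ] W)}
    {r : ℕ} {n : Fin r → ℤ} {θ θ' : Fin r → SUq q ⊗[ℂ] W} (h : IsLineBundleSum ρ Ω n θ)
    (k : Fin r → ℂ) (hk : ∀ i, k i ≠ 0) (hθ : ∀ i, θ' i = k i • θ i) :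
    IsLineBundleSum ρ Ω n θ' := by
  have h1 : ∀ i, lineForms (n i) (θ' i) = lineForms (n i) (θ i) := fun i => by
    rw [hθ, lineForms_smul _ (hk i)]
  refine ⟨h.right_mem, ?_, ?_, fun i φ hφ h0 => h.free i φ hφ ?_⟩
  · simp only [h1]; exact h.eq_iSup
  · simp only [h1]; exact h.indep
  · rw [hθ, smul_comm] at h0
    exact (smul_eq_zero.1 h0).resolve_left (hk i)

/-- The coefficient `H ⊗ W → H` defined by a linear functional on `W`. -/
def coeff (q : Param) (f : W →ₗ[ℂ] ℂ) : SUq q ⊗[ℂ] W →ₗ[ℂ] SUq q :=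
  (TensorProduct.rid ℂ _).toLinearMap ∘ₗ f.lTensor _

theorem coeff_smul_one_tmul (f : W →ₗ[ℂ] ℂ) (φ : SUq q) (w : W) :
    coeff q f (φ • ((1 : SUq q) ⊗ₜ[ℂ] w)) = f w • φ := by
  rw [← tmul_eq_smul]; simp [coeff]

/-- Dual functionals give A-valued coefficient maps, and these yield both independence and freeness.
Stability under the right action of the sphere is the case m = 0 of `IsGraded.forms_mem`. -/
theorem isLineBundleSum_of_isGraded {ρ : RAct (SUq q) W} {r : ℕ} {n : Fin r → ℤ} {w : Fin r → W}
    (h : IsGraded ρ n w) (f : Fin r → W →ₗ[ℂ] ℂ) (hf : ∀ i j, f i (w j) = if i = j then 1 else 0)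
    {Ω : Submodule (sphere q) (SUq q ⊗[ℂ] W)} (hΩ : ∀ x, x ∈ Ω ↔ x ∈ gradedForms q n w 0) :
    IsLineBundleSum ρ Ω n (fun i => (1 : SUq q) ⊗ₜ[ℂ] w i) where
  right_mem η hη b hb := by
    rw [hΩ] at *
    exact h.forms_mem (mem_sphere.1 hb) hη (add_zero 0)
  eq_iSup := by
    ext x
    rw [hΩ, mem_iSup_lineForms]
  indep := by
    rw [iSupIndep_def]
    intro i
    rw [Submodule.disjoint_def]
    intro x hx hx'
    obtain ⟨φ, hφ, rfl⟩ := mem_lineForms.1 hx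
    have h0 : ∀ y ∈ ⨆ j, ⨆ (_ : j ≠ i), lineForms (n j) ((1 : SUq q) ⊗ₜ[ℂ] w j),
        coeff q (f i) y = 0 := by
      intro y hy
      induction hy using Submodule.iSup_induction' with
      | mem j y hy =>
        by_cases hj : j = i
        · simp only [hj, ne_eq, not_true_eq_false, iSup_false, Submodule.mem_bot] at hy
          rw [hy, map_zero]
        · simp only [ne_eq, hj, not_false_eq_true, iSup_true] at hy
          obtain ⟨ψ, _, rfl⟩ := mem_lineForms.1 hy
          rw [coeff_smul_one_tmul, hf, if_neg (Ne.symm hj), zero_smul]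
      | zero => exact map_zero _
      | add x y _ _ hx hy => rw [map_add, hx, hy, add_zero]
    have h1 := h0 _ hx'
    rw [coeff_smul_one_tmul, hf, if_pos rfl, one_smul] at h1
    rw [h1, zero_smul]
  free i φ _ h0 := by
    have h1 := congrArg (coeff q (f i)) h0
    rwa [coeff_smul_one_tmul, hf, if_pos rfl, one_smul, map_zero] at h1

end SUq
end QuantumSphere
end

/-! ### Recovering left invariant forms from differentials, and wedge products of restricted forms.
-/

noncomputable section

namespace QuantumSphere

open TensorProduct

namespace CalculusIdeal

variable {H : Type*} [Ring H] [HopfAlgebra ℂ H] (C : CalculusIdeal H)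

/-- The map `x ⊗ y ↦ S(x) dy`. -/
def antipodeD : H ⊗[ℂ] H →ₗ[ℂ] C.OneForms :=
  C.cls.lTensor H ∘ₗ (LinearMap.mul' ℂ H).rTensor H ∘ₗ
    (TensorProduct.assoc ℂ H H H).symm.toLinearMap ∘ₗ
    TensorProduct.map (HopfAlgebra.antipode ℂ) Coalgebra.comul

theorem antipodeD_tmul (x y : H) :
    C.antipodeD (x ⊗ₜ y) = HopfAlgebra.antipode ℂ x • C.d y := by
  simp only [antipodeD, d, LinearMap.comp_apply, TensorProduct.map_tmul]
  generalize Coalgebra.comul (R := ℂ) y = u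
  induction u with
  | zero => simp
  | add u v hu hv => simp only [tmul_add, map_add, hu, hv, smul_add]
  | tmul u v => simp [TensorProduct.smul_tmul']

/-- The left invariant form `[x - ε(x) 1]` is `S(x₍₁₎) d x₍₂₎`. -/
theorem antipodeD_comul (x : H) : C.antipodeD (Coalgebra.comul x) = 1 ⊗ₜ C.cls x := by
  -- Reassociation puts S(x₍₁₎)x₍₂₎ ⊗ x₍₃₎ in a form to which coassociativity and the antipode axiom
  -- apply.
  have h1 : ∀ U : H ⊗[ℂ] H, (LinearMap.mul' ℂ H).rTensor H
      ((TensorProduct.assoc ℂ H H H).symm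
        (TensorProduct.map (HopfAlgebra.antipode ℂ) Coalgebra.comul U)) =
      (LinearMap.mul' ℂ H ∘ₗ (HopfAlgebra.antipode ℂ).rTensor H).rTensor H
        ((TensorProduct.assoc ℂ H H H).symm (Coalgebra.comul.lTensor H U)) := by
    intro U
    induction U with
    | zero => simp
    | add u v hu hv => simp only [map_add, hu, hv]
    | tmul u v =>
      rw [TensorProduct.map_tmul, LinearMap.lTensor_tmul]
      generalize Coalgebra.comul (R := ℂ) v = w
      induction w with
      | zero => simp
      | add w w' hw hw' => simp only [tmul_add, map_add, hw, hw']
      | tmul w w' => simp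
  have h2 : C.antipodeD (Coalgebra.comul x) = C.cls.lTensor H ((LinearMap.mul' ℂ H).rTensor H
      ((TensorProduct.assoc ℂ H H H).symm
        (TensorProduct.map (HopfAlgebra.antipode ℂ) Coalgebra.comul (Coalgebra.comul x)))) := rfl
  rw [h2, h1, Coalgebra.coassoc_symm_apply, ← LinearMap.comp_apply (LinearMap.rTensor H _),
    ← LinearMap.rTensor_comp, LinearMap.comp_assoc, HopfAlgebra.mul_antipode_rTensor_comul,
    LinearMap.rTensor_comp, LinearMap.comp_apply, Coalgebra.rTensor_counit_comul,
    LinearMap.rTensor_tmul, LinearMap.lTensor_tmul, Algebra.linearMap_apply, map_one]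

/-! ### Forms of the restricted calculus -/

variable {C} {B : Subalgebra ℂ H}

theorem smul_complex_mem {W : Type*} [AddCommGroup W] [Module ℂ W]
    {Ω : Submodule B (H ⊗[ℂ] W)} (r : ℂ) {θ : H ⊗[ℂ] W} (hθ : θ ∈ Ω) : r • θ ∈ Ω := by
  have h := Ω.smul_mem (algebraMap ℂ B r) hθ
  rwa [algebraMap_smul] at h

theorem d_mem_restrict₁ {x : H} (hx : x ∈ B) : C.d x ∈ C.restrict₁ B :=
  Submodule.subset_span ⟨x, hx, rfl⟩

/-- The Leibniz rule gives (dx)b = d(xb) - x db, so the left span of differentials is also a right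
module. -/
theorem forms_mem_restrict₁ {b : H} (hb : b ∈ B) {θ : C.OneForms} (hθ : θ ∈ C.restrict₁ B) :
    C.invAct.forms (.op b) θ ∈ C.restrict₁ B := by
  induction hθ using Submodule.span_induction with
  | mem θ hθ =>
    obtain ⟨x, hx, rfl⟩ := hθ
    rw [← sub_eq_of_eq_add' (C.d_mul x b)]
    exact sub_mem (d_mem_restrict₁ (mul_mem hx hb))
      ((C.restrict₁ B).smul_mem (⟨x, hx⟩ : B) (d_mem_restrict₁ hb))
  | zero => simp
  | add u v _ _ hu hv => rw [map_add]; exact add_mem hu hv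
  | smul x θ _ hθ =>
    rw [Subalgebra.smul_def, RAct.forms_smul]
    exact (C.restrict₁ B).smul_mem x hθ

theorem wedge₂_mem {θ η : C.OneForms} (hθ : θ ∈ C.restrict₁ B) (hη : η ∈ C.restrict₁ B) :
    C.wedge₂ θ η ∈ C.restrict₂ B := by
  -- A coefficient of η moves across the product and replaces θ by θ·x, so θ must stay arbitrary.
  induction hη using Submodule.span_induction generalizing θ with
  | mem η hη =>
    obtain ⟨y, hy, rfl⟩ := hη
    induction hθ using Submodule.span_induction with
    | mem θ hθ =>
      obtain ⟨x, hx, rfl⟩ := hθ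
      exact Submodule.subset_span ⟨x, hx, y, hy, rfl⟩
    | zero => rw [wedge₂, RAct.mulTensor_zero_left, map_zero]; exact zero_mem _
    | add u v _ _ hu hv =>
      rw [wedge₂, RAct.mulTensor_add_left, map_add]; exact add_mem hu hv
    | smul x θ _ hθ =>
      rw [Subalgebra.smul_def, wedge₂, RAct.mulTensor_left_linear, lTensor_smul_left]
      exact (C.restrict₂ B).smul_mem x hθ
  | zero => rw [wedge₂, RAct.mulTensor_zero_right, map_zero]; exact zero_mem _
  | add u v _ _ hu hv =>
    rw [wedge₂, RAct.mulTensor_add_right, map_add]; exact add_mem (hu hθ) (hv hθ)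
  | smul x η _ hη =>
    rw [Subalgebra.smul_def, wedge₂, RAct.mulTensor_balanced]
    exact hη (forms_mem_restrict₁ x.2 hθ)

/-- Coefficients travel from ζ to η, from η to θ, and finally out on the left. The nested inductions
follow that order. -/
theorem wedge₃_mem {θ η ζ : C.OneForms} (hθ : θ ∈ C.restrict₁ B) (hη : η ∈ C.restrict₁ B)
    (hζ : ζ ∈ C.restrict₁ B) : C.wedge₃ θ η ζ ∈ C.restrict₃ B := by
  induction hζ using Submodule.span_induction generalizing θ η with
  | mem ζ hζ =>
    obtain ⟨z, hz, rfl⟩ := hζ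
    induction hη using Submodule.span_induction generalizing θ with
    | mem η hη =>
      obtain ⟨y, hy, rfl⟩ := hη
      induction hθ using Submodule.span_induction with
      | mem θ hθ =>
        obtain ⟨x, hx, rfl⟩ := hθ
        exact Submodule.subset_span ⟨x, hx, y, hy, z, hz, rfl⟩
      | zero => rw [wedge₃, RAct.mulTensor_zero_left, map_zero]; exact zero_mem _
      | add u v _ _ hu hv =>
        rw [wedge₃, RAct.mulTensor_add_left, map_add]; exact add_mem hu hv
      | smul x θ _ hθ =>
        rw [Subalgebra.smul_def, wedge₃, RAct.mulTensor_left_linear, lTensor_smul_left]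
        exact (C.restrict₃ B).smul_mem x hθ
    | zero =>
      rw [wedge₃, RAct.mulTensor_zero_left, RAct.mulTensor_zero_right, map_zero]; exact zero_mem _
    | add u v _ _ hu hv =>
      rw [wedge₃, RAct.mulTensor_add_left, RAct.mulTensor_add_right, map_add]
      exact add_mem (hu hθ) (hv hθ)
    | smul x η _ hη =>
      rw [Subalgebra.smul_def, wedge₃, RAct.mulTensor_left_linear, RAct.mulTensor_balanced]
      exact hη (forms_mem_restrict₁ x.2 hθ)
  | zero =>
    rw [wedge₃, RAct.mulTensor_zero_right, RAct.mulTensor_zero_right, map_zero]; exact zero_mem _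
  | add u v _ _ hu hv =>
    rw [wedge₃, RAct.mulTensor_add_right, RAct.mulTensor_add_right, map_add]
    exact add_mem (hu hθ hη) (hv hθ hη)
  | smul x ζ _ hζ =>
    rw [Subalgebra.smul_def, wedge₃, RAct.mulTensor_balanced]
    exact hζ hθ (forms_mem_restrict₁ x.2 hη)

theorem smul_wedge₂_smul (r s : ℂ) (v w : C.Inv) :
    C.wedge₂ (r • (1 : H) ⊗ₜ v) (s • (1 : H) ⊗ₜ w) =
      (r * s) • ((1 : H) ⊗ₜ C.antisymm₂ (v ⊗ₜ w)) := by
  rw [wedge₂, RAct.mulTensor_smul_left, RAct.mulTensor_smul_right, RAct.mulTensor_one_tmul,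
    map_smul, map_smul, smul_smul, LinearMap.lTensor_tmul]

theorem smul_wedge₃_smul (r s t : ℂ) (u v w : C.Inv) :
    C.wedge₃ (r • (1 : H) ⊗ₜ u) (s • (1 : H) ⊗ₜ v) (t • (1 : H) ⊗ₜ w) =
      (r * (s * t)) • ((1 : H) ⊗ₜ C.antisymm₃ (u ⊗ₜ (v ⊗ₜ w))) := by
  simp only [wedge₃, RAct.mulTensor_smul_left, RAct.mulTensor_smul_right,
    RAct.mulTensor_one_tmul, map_smul, smul_smul, LinearMap.lTensor_tmul, mul_comm, mul_left_comm]

end CalculusIdeal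

namespace SUq

variable (q : Param)

/-! ### One-forms on the sphere -/

theorem d_a : (fourDPlus q).d (a q) = a q ⊗ₜ eX q - qc q • (c' q ⊗ₜ eP q) := by
  change (fcls q).lTensor _ (Δ q (a q)) = _
  rw [Δ_a, map_sub, map_smul]; rfl
theorem d_a' : (fourDPlus q).d (a' q) = a' q ⊗ₜ fcls q (a' q) - qc q • (c q ⊗ₜ eM q) := by
  change (fcls q).lTensor _ (Δ q (a' q)) = _
  rw [Δ_a', map_sub, map_smul]; rfl
theorem d_c : (fourDPlus q).d (c q) = c q ⊗ₜ eX q + a' q ⊗ₜ eP q := by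
  change (fcls q).lTensor _ (Δ q (c q)) = _
  rw [Δ_c, map_add]; rfl
theorem d_c' : (fourDPlus q).d (c' q) = c' q ⊗ₜ fcls q (a' q) + a q ⊗ₜ eM q := by
  change (fcls q).lTensor _ (Δ q (c' q)) = _
  rw [Δ_c', map_add]; rfl

theorem smul_smul_forms {W : Type*} [AddCommGroup W] [Module ℂ W] (x : SUq q) (r : ℂ)
    (θ : SUq q ⊗[ℂ] W) : x • r • θ = r • x • θ := smul_comm x r θ

theorem smul_tmul_forms {W : Type*} [AddCommGroup W] [Module ℂ W] (x y : SUq q) (w : W) :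
    x • (y ⊗ₜ[ℂ] w) = (x * y) ⊗ₜ[ℂ] w := rfl

theorem ωm_eq : ωm q = -qc q • ((1 : SUq q) ⊗ₜ eM q) := by
  simp only [ωm, d_a', d_c', smul_sub, smul_add, smul_smul_forms, smul_tmul_forms,
    c'_mul_a', nf3, ← c_mul_c', sub_tmul, ← smul_tmul']
  module

theorem ωp_eq : ωp q = (1 : ℂ) • ((1 : SUq q) ⊗ₜ eP q) := by
  simp only [ωp, d_a, d_c, smul_sub, smul_add, smul_smul_forms, smul_tmul_forms,
    a_mul_c, nf4, sub_tmul, ← smul_tmul']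
  module

/-- The bracket is 1 ⊗ ([a - 1] + q[a* - 1]). The weight q is exactly the one that cancels `eX`
against the -q⁻¹ `eX` in `fcls_a'`. -/
theorem ω0_eq : ω0 q = (-((1 + qc q)⁻¹ * (lam q)⁻¹ * qc q * (1 + qc q + qc q ^ 2))) •
    ((1 : SUq q) ⊗ₜ eZ q) := by
  have h1 := qc_ne_zero q
  have h2 : a' q • (fourDPlus q).d (a q) + c' q • (fourDPlus q).d (c q) = 1 ⊗ₜ eX q := by
    simp only [d_a, d_c, smul_sub, smul_add, smul_smul_forms, smul_tmul_forms,
      c'_mul_a', nf3, ← c_mul_c', sub_tmul, ← smul_tmul']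
    module
  have h3 : a q • (fourDPlus q).d (a' q) + qc q ^ 2 • (c q • (fourDPlus q).d (c' q)) =
      1 ⊗ₜ fcls q (a' q) := by
    simp only [d_a', d_c', smul_sub, smul_add, smul_smul_forms, smul_tmul_forms,
      nf1, nf4, sub_tmul, ← smul_tmul']
    match_scalars <;> field_simp <;> ring
  have h4 : a' q • (fourDPlus q).d (a q) + c' q • (fourDPlus q).d (c q) +
      qc q • (a q • (fourDPlus q).d (a' q) + qc q ^ 2 • (c q • (fourDPlus q).d (c' q))) =
      (-(qc q * (1 + qc q + qc q ^ 2))) • ((1 : SUq q) ⊗ₜ eZ q) := by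
    rw [h2, h3, fcls_a']
    simp only [tmul_sub, tmul_smul]
    match_scalars <;> field_simp <;> ring
  rw [ω0, h4]
  module

theorem qNumber_ne_zero {x : ℝ} (hx : 0 < x) : qNumber q x ≠ 0 := by
  have h0 : 0 < (q : ℝ) := q.2.1
  have h1 : (q : ℝ) < 1 := q.2.2
  have h2 : (q : ℝ) ^ x < 1 := Real.rpow_lt_one h0.le h1 hx
  have h3 : 1 < (q : ℝ) ^ (-x) := Real.one_lt_rpow_of_pos_of_lt_one_of_neg h0 h1 (neg_neg_of_pos hx)
  have h4 : 1 < (q : ℝ)⁻¹ := (one_lt_inv₀ h0).2 h1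
  exact div_ne_zero (by linarith) (by linarith)

theorem lam_ne_zero : lam q ≠ 0 := by
  unfold lam
  exact_mod_cast mul_ne_zero (qNumber_ne_zero q (by norm_num)) (qNumber_ne_zero q (by norm_num))

theorem ω0_coeff_ne_zero :
    -((1 + qc q)⁻¹ * (lam q)⁻¹ * qc q * (1 + qc q + qc q ^ 2)) ≠ 0 :=
  neg_ne_zero.2 (mul_ne_zero (mul_ne_zero (mul_ne_zero (inv_ne_zero (one_add_qc_ne_zero q))
    (inv_ne_zero (lam_ne_zero q))) (qc_ne_zero q)) (one_add_qc_add_sq_ne_zero q))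

/-- The left invariant one-forms `[c*]`, `[c]` and `(1 + q)⁻¹ [c c*]`. -/
def oneFamily : Fin 3 → (fourDPlus q).Inv := ![eM q, eP q, eZ q]
/-- The weights of `oneFamily`. -/
def oneWeight : Fin 3 → ℤ := ![-2, 2, 0]

variable {q}

theorem eM_mem : eM q ∈ weightSpan oneWeight (oneFamily q) (-2) := mem_weightSpan (oneFamily q) 0 rfl
theorem eP_mem : eP q ∈ weightSpan oneWeight (oneFamily q) 2 := mem_weightSpan (oneFamily q) 1 rfl
theorem eZ_mem : eZ q ∈ weightSpan oneWeight (oneFamily q) 0 := mem_weightSpan (oneFamily q) 2 rfl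

theorem isGraded_one : IsGraded (fourDPlus q).invAct oneWeight (oneFamily q) := by
  constructor <;> intro i <;> fin_cases i
  · exact (act_eM_a q).symm ▸ eM_mem
  · exact (act_eP_a q).symm ▸ eP_mem
  · exact (act_eZ_a q).symm ▸ Submodule.smul_mem _ _ eZ_mem
  · exact (act_eM_a' q).symm ▸ eM_mem
  · exact (act_eP_a' q).symm ▸ eP_mem
  · exact (act_eZ_a' q).symm ▸ Submodule.smul_mem _ _ eZ_mem
  · exact (act_eM_c q).symm ▸ Submodule.smul_mem _ _ eZ_mem
  · exact (act_eP_c q).symm ▸ zero_mem _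
  · exact (act_eZ_c q).symm ▸ zero_mem _
  · exact (act_eM_c' q).symm ▸ zero_mem _
  · exact (act_eP_c' q).symm ▸ Submodule.smul_mem _ _ eZ_mem
  · exact (act_eZ_c' q).symm ▸ zero_mem _

theorem act_invAct (h : SUq q) (w : (fourDPlus q).Inv) :
    (fourDPlus q).invAct (.op h) w = act q h w := rfl

/-- For `y ∈ L_m` the form `dy` is homogeneous up to a multiple of `y ⊗ [a - 1]`. -/
theorem d_sub_mem {m : ℤ} {y : SUq q} (hy : y ∈ lineBundle q m) :
    (fourDPlus q).d y - ((qc q ^ (-m) - 1) * (qc q - 1)⁻¹) • (y ⊗ₜ eX q) ∈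
      gradedForms q oneWeight (oneFamily q) m := by
  have h1 := qc_ne_zero q
  have h2 : qc q - 1 ≠ 0 := by
    rw [← neg_sub]; exact neg_ne_zero.2 (one_sub_qc_ne_zero q)
  -- The induction passes through all degrees although only m = 0 is wanted. With λ_m the
  -- coefficient of y ⊗ `eX`, the Leibniz rule forces λ_{m-1} = 1 + qλ_m and λ_{m+1} = q⁻¹(λ_m - 1),
  -- with λ₀ = 0. The solution is (q^{-m} - 1)/(q - 1).
  let P : ℤ → Submodule ℂ (SUq q) := fun m =>
    (gradedForms q oneWeight (oneFamily q) m).comap ((fourDPlus q).d -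
      ((qc q ^ (-m) - 1) * (qc q - 1)⁻¹) • (TensorProduct.mk ℂ _ _).flip (eX q))
  have step : ∀ (g : SUq q) (m e : ℤ) (y : SUq q), g ∈ lineBundle q e → y ∈ P m →
      (y • (fourDPlus q).d g + ((qc q ^ (-m) - 1) * (qc q - 1)⁻¹) •
        (fourDPlus q).invAct.forms (.op g) (y ⊗ₜ eX q) -
        ((qc q ^ (-(m + e)) - 1) * (qc q - 1)⁻¹) • ((y * g) ⊗ₜ eX q) ∈
          gradedForms q oneWeight (oneFamily q) (m + e)) → y * g ∈ P (m + e) := by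
    intro g m e y hg hy h
    have h' := add_mem (isGraded_one.forms_mem hg (Submodule.mem_comap.1 hy) rfl) h
    refine Submodule.mem_comap.2 ?_
    convert h' using 1
    simp only [LinearMap.sub_apply, LinearMap.smul_apply, LinearMap.flip_apply,
      TensorProduct.mk_apply, CalculusIdeal.d_mul, map_sub, map_smul]
    abel
  refine lineBundle_induction (P := P) ?_ ?_ ?_ ?_ ?_ hy
  · refine Submodule.mem_comap.2 ?_
    have : (fourDPlus q).d 1 = 0 := by
      change (fcls q).lTensor _ (Δ q 1) = 0
      rw [map_one, Algebra.TensorProduct.one_def, LinearMap.lTensor_tmul, fcls_one, tmul_zero]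
    simp [this]
  · intro m y hy hP
    refine step (a q) m (-1) y a_mem hP ?_
    rw [d_a, forms_a]
    have hz : qc q ^ (-(m + -1)) = qc q ^ (-m) * qc q := by
      rw [neg_add, zpow_add₀ h1]; simp
    -- What remains after the `eX` terms cancel: an `eZ` term from eX · a, and an `eP` term from da
    -- together with eX · c. The other three generators follow the same pattern.
    have h := add_mem
      (Submodule.smul_mem _ (-((qc q ^ (-m) - 1) * (qc q - 1)⁻¹))
        (tmul_mem_gradedForms (mul_mem_lineBundle hy a_mem) (eZ_mem (q := q)) (zero_add _)))
      (Submodule.smul_mem _ (-(qc q + ((qc q ^ (-m) - 1) * (qc q - 1)⁻¹) * (qc q * (qc q - 1))))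
        (tmul_mem_gradedForms (k := m + -1) (mul_mem_lineBundle hy c'_mem) (eP_mem (q := q)) (by ring)))
    convert h using 1
    rw [hz]
    simp only [fcls_a', act_invAct, act_eX_a, act_eX_a', act_eX_c, act_eX_c', smul_sub, smul_add,
      smul_smul_forms, smul_tmul_forms, tmul_sub, tmul_add, tmul_smul]
    match_scalars <;> field_simp <;> ring
  · intro m y hy hP
    refine step (a' q) m 1 y a'_mem hP ?_
    rw [d_a', forms_a']
    have hz : qc q ^ (-(m + 1)) = qc q ^ (-m) * (qc q)⁻¹ := by
      rw [neg_add, zpow_add₀ h1]; simp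
    have h := add_mem
      (Submodule.smul_mem _ (((qc q ^ (-m) - 1) * (qc q - 1)⁻¹) * (1 + qc q - qc q ^ 3) - (1 + qc q + qc q ^ 2))
        (tmul_mem_gradedForms (mul_mem_lineBundle hy a'_mem) (eZ_mem (q := q)) (zero_add _)))
      (Submodule.smul_mem _ (-(qc q + ((qc q ^ (-m) - 1) * (qc q - 1)⁻¹) * (qc q * (qc q - 1))))
        (tmul_mem_gradedForms (k := m + 1) (mul_mem_lineBundle hy c_mem) (eM_mem (q := q)) (by ring)))
    convert h using 1
    rw [hz]
    simp only [fcls_a', act_invAct, act_eX_a, act_eX_a', act_eX_c, act_eX_c', smul_sub, smul_add,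
      smul_smul_forms, smul_tmul_forms, tmul_sub, tmul_add, tmul_smul]
    match_scalars <;> field_simp <;> ring
  · intro m y hy hP
    refine step (c q) m (-1) y c_mem hP ?_
    rw [d_c, forms_c]
    have hz : qc q ^ (-(m + -1)) = qc q ^ (-m) * qc q := by
      rw [neg_add, zpow_add₀ h1]; simp
    have h := add_mem
      (Submodule.smul_mem _ (-((qc q ^ (-m) - 1) * (qc q - 1)⁻¹))
        (tmul_mem_gradedForms (mul_mem_lineBundle hy c_mem) (eZ_mem (q := q)) (zero_add _)))
      (Submodule.smul_mem _ (1 + ((qc q ^ (-m) - 1) * (qc q - 1)⁻¹) * (qc q - 1))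
        (tmul_mem_gradedForms (k := m + -1) (mul_mem_lineBundle hy a'_mem) (eP_mem (q := q)) (by ring)))
    convert h using 1
    rw [hz]
    simp only [fcls_a', act_invAct, act_eX_a, act_eX_a', act_eX_c, act_eX_c', smul_sub, smul_add,
      smul_smul_forms, smul_tmul_forms, tmul_sub, tmul_add, tmul_smul]
    match_scalars <;> field_simp <;> ring
  · intro m y hy hP
    refine step (c' q) m 1 y c'_mem hP ?_
    rw [d_c', forms_c']
    have hz : qc q ^ (-(m + 1)) = qc q ^ (-m) * (qc q)⁻¹ := by
      rw [neg_add, zpow_add₀ h1]; simp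
    have h := add_mem
      (Submodule.smul_mem _ (((qc q ^ (-m) - 1) * (qc q - 1)⁻¹) * (1 + qc q - qc q ^ 3) - (1 + qc q + qc q ^ 2))
        (tmul_mem_gradedForms (mul_mem_lineBundle hy c'_mem) (eZ_mem (q := q)) (zero_add _)))
      (Submodule.smul_mem _ (1 + ((qc q ^ (-m) - 1) * (qc q - 1)⁻¹) * (qc q - 1))
        (tmul_mem_gradedForms (k := m + 1) (mul_mem_lineBundle hy a_mem) (eM_mem (q := q)) (by ring)))
    convert h using 1
    rw [hz]
    simp only [fcls_a', act_invAct, act_eX_a, act_eX_a', act_eX_c, act_eX_c', smul_sub, smul_add,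
      smul_smul_forms, smul_tmul_forms, tmul_sub, tmul_add, tmul_smul]
    match_scalars <;> field_simp <;> ring

end SUq
end QuantumSphere
end

/-! ### One-forms on the sphere: the generating forms are attained. -/

noncomputable section

namespace QuantumSphere
namespace SUq

open TensorProduct

variable {q : Param}

theorem S_a_mem : S q (a q) ∈ lineBundle q 1 := (S_a q).symm ▸ a'_mem
theorem S_a'_mem : S q (a' q) ∈ lineBundle q (-1) := (S_a' q).symm ▸ a_mem
theorem S_c_mem : S q (c q) ∈ lineBundle q (-1) :=
  (S_c q).symm ▸ neg_mem (smul_mem_lineBundle _ c_mem)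
theorem S_c'_mem : S q (c' q) ∈ lineBundle q 1 :=
  (S_c' q).symm ▸ neg_mem (smul_mem_lineBundle _ c'_mem)

/-- The form in question is φS(xy) d(zw), and the two degree conditions place both φS(xy) and zw in
the sphere. -/
theorem smul_antipodeD_mem {k l m i j : ℤ} {φ x y z w : SUq q} (hφ : φ ∈ lineBundle q k)
    (hx : S q x ∈ lineBundle q l) (hy : S q y ∈ lineBundle q m) (hz : z ∈ lineBundle q i)
    (hw : w ∈ lineBundle q j) (h : k + (m + l) = 0) (h' : i + j = 0) :
    φ • (fourDPlus q).antipodeD ((x * y) ⊗ₜ (z * w)) ∈ (fourDPlus q).restrict₁ (sphere q) := by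
  have hS : φ * S q (x * y) ∈ lineBundle q 0 := by
    rw [S_mul]
    exact mul_mem_lineBundle_of_eq hφ (mul_mem_lineBundle hy hx) h
  have hd := ((fourDPlus q).restrict₁ (sphere q)).smul_mem (⟨_, hS⟩ : sphere q)
    (CalculusIdeal.d_mem_restrict₁ (mem_sphere.2 (mul_mem_lineBundle_of_eq hz hw h')))
  rw [CalculusIdeal.antipodeD_tmul, smul_smul]
  exact hd

theorem smul_tmul_fcls (φ t : SUq q) :
    φ ⊗ₜ fcls q t = φ • (fourDPlus q).antipodeD (Δ q t) := by
  rw [tmul_eq_smul]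
  exact congrArg _ ((fourDPlus q).antipodeD_comul t).symm

/-- The representative c*a is used instead of c*: it lies in L₀, so the second legs of its coproduct
are in the sphere. The antipodes of its first legs lie in L₂, which compensates φ ∈ L₋₂. -/
theorem tmul_eM_mem {φ : SUq q} (hφ : φ ∈ lineBundle q (-2)) :
    φ ⊗ₜ eM q ∈ (fourDPlus q).restrict₁ (sphere q) := by
  rw [← fcls_c'_mul_a, smul_tmul_fcls, map_mul, Δ_c', Δ_a]
  simp only [add_mul, mul_sub, mul_smul_comm, Algebra.TensorProduct.tmul_mul_tmul, map_add,
    map_sub, map_smul, smul_add, smul_sub, smul_smul_forms]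
  refine sub_mem (add_mem ?_ ?_)
    (add_mem (CalculusIdeal.smul_complex_mem _ ?_) (CalculusIdeal.smul_complex_mem _ ?_))
  · exact smul_antipodeD_mem hφ S_c'_mem S_a_mem a'_mem a_mem (by norm_num) (by norm_num)
  · exact smul_antipodeD_mem hφ S_a_mem S_a_mem c'_mem a_mem (by norm_num) (by norm_num)
  · exact smul_antipodeD_mem hφ S_c'_mem S_c'_mem a'_mem c_mem (by norm_num) (by norm_num)
  · exact smul_antipodeD_mem hφ S_a_mem S_c'_mem c'_mem c_mem (by norm_num) (by norm_num)

/-- The same argument with the degree 0 representative ca* of [c]. -/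
theorem tmul_eP_mem {φ : SUq q} (hφ : φ ∈ lineBundle q 2) :
    φ ⊗ₜ eP q ∈ (fourDPlus q).restrict₁ (sphere q) := by
  rw [← fcls_c_mul_a, ← fcls_c_mul_a', smul_tmul_fcls, map_mul, Δ_c, Δ_a']
  simp only [add_mul, mul_sub, mul_smul_comm, Algebra.TensorProduct.tmul_mul_tmul, map_add,
    map_sub, map_smul, smul_add, smul_sub, smul_smul_forms]
  refine sub_mem (add_mem ?_ ?_)
    (add_mem (CalculusIdeal.smul_complex_mem _ ?_) (CalculusIdeal.smul_complex_mem _ ?_))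
  · exact smul_antipodeD_mem hφ S_c_mem S_a'_mem a_mem a'_mem (by norm_num) (by norm_num)
  · exact smul_antipodeD_mem hφ S_a'_mem S_a'_mem c_mem a'_mem (by norm_num) (by norm_num)
  · exact smul_antipodeD_mem hφ S_c_mem S_c_mem a_mem c'_mem (by norm_num) (by norm_num)
  · exact smul_antipodeD_mem hφ S_a'_mem S_c_mem c_mem c'_mem (by norm_num) (by norm_num)

theorem tmul_eZ_mem {φ : SUq q} (hφ : φ ∈ lineBundle q 0) :
    φ ⊗ₜ eZ q ∈ (fourDPlus q).restrict₁ (sphere q) := by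
  rw [eZ, tmul_smul]
  refine CalculusIdeal.smul_complex_mem _ ?_
  rw [smul_tmul_fcls, map_mul, Δ_c, Δ_c']
  simp only [add_mul, mul_add, Algebra.TensorProduct.tmul_mul_tmul, map_add, smul_add]
  refine add_mem (add_mem ?_ ?_) (add_mem ?_ ?_)
  · exact smul_antipodeD_mem hφ S_c_mem S_c'_mem a_mem a'_mem (by norm_num) (by norm_num)
  · exact smul_antipodeD_mem hφ S_a'_mem S_c'_mem c_mem a'_mem (by norm_num) (by norm_num)
  · exact smul_antipodeD_mem hφ S_c_mem S_a_mem a_mem c'_mem (by norm_num) (by norm_num)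
  · exact smul_antipodeD_mem hφ S_a'_mem S_a_mem c_mem c'_mem (by norm_num) (by norm_num)

/-- A submodule over the sphere that contains the generating homogeneous forms contains all
homogeneous forms of degree `0`. -/
theorem mem_of_mem_gradedForms {ι W : Type*} [AddCommGroup W] [Module ℂ W] {n : ι → ℤ} {w : ι → W}
    {Ω : Submodule (sphere q) (SUq q ⊗[ℂ] W)}
    (h : ∀ i, ∀ φ ∈ lineBundle q (n i), φ ⊗ₜ w i ∈ Ω) {x : SUq q ⊗[ℂ] W}
    (hx : x ∈ gradedForms q n w 0) : x ∈ Ω := by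
  induction hx using Submodule.span_induction with
  | mem x hx =>
    obtain ⟨i, φ, hφ, rfl⟩ := hx
    exact h i φ (by rwa [add_zero] at hφ)
  | zero => exact zero_mem _
  | add x y _ _ hx hy => exact add_mem hx hy
  | smul r x _ hx => exact CalculusIdeal.smul_complex_mem r hx

theorem span_le_gradedForms {ι W : Type*} [AddCommGroup W] [Module ℂ W] {n : ι → ℤ} {w : ι → W}
    {s : Set (SUq q ⊗[ℂ] W)} (h : ∀ x ∈ s, x ∈ gradedForms q n w 0) {x : SUq q ⊗[ℂ] W}
    (hx : x ∈ Submodule.span (sphere q) s) : x ∈ gradedForms q n w 0 := by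
  induction hx using Submodule.span_induction with
  | mem x hx => exact h x hx
  | zero => exact zero_mem _
  | add x y _ _ hx hy => exact add_mem hx hy
  | smul b x _ hx => exact smul_mem_gradedForms (mem_sphere.1 b.2) hx (zero_add 0)

/-- At m = 0 the coefficient q⁰ - 1 of the `eX` term vanishes. -/
theorem d_mem {x : SUq q} (hx : x ∈ sphere q) :
    (fourDPlus q).d x ∈ gradedForms q oneWeight (oneFamily q) 0 := by
  have h := d_sub_mem (mem_sphere.1 hx)
  simpa using h

theorem mem_restrict₁ (x : SUq q ⊗[ℂ] (fourDPlus q).Inv) :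
    x ∈ (fourDPlus q).restrict₁ (sphere q) ↔ x ∈ gradedForms q oneWeight (oneFamily q) 0 := by
  constructor
  · refine span_le_gradedForms ?_
    rintro _ ⟨y, hy, rfl⟩
    exact d_mem hy
  · refine mem_of_mem_gradedForms fun i φ hφ => ?_
    fin_cases i
    exacts [tmul_eM_mem hφ, tmul_eP_mem hφ, tmul_eZ_mem hφ]

/-! ### Two-forms on the sphere -/

/-- The left invariant two-forms `[c*] ∧ [c c*]`, `[c*] ∧ [c]` and `[c c*] ∧ [c]` up to factors. -/
def twoFamily (q : Param) : Fin 3 → (fourDPlus q).Inv ⊗[ℂ] (fourDPlus q).Inv :=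
  ![eMZ q, eMP q, eZP q]
/-- The weights of `twoFamily`. -/
def twoWeight : Fin 3 → ℤ := ![-2, 0, 2]

theorem eMZ_mem : eMZ q ∈ weightSpan twoWeight (twoFamily q) (-2) :=
  mem_weightSpan (twoFamily q) 0 rfl
theorem eMP_mem : eMP q ∈ weightSpan twoWeight (twoFamily q) 0 :=
  mem_weightSpan (twoFamily q) 1 rfl
theorem eZP_mem : eZP q ∈ weightSpan twoWeight (twoFamily q) 2 :=
  mem_weightSpan (twoFamily q) 2 rfl

theorem asym₂_mem (i j : Fin 3) : asym₂ q (oneFamily q i ⊗ₜ oneFamily q j) ∈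
    weightSpan twoWeight (twoFamily q) (oneWeight i + oneWeight j) := by
  obtain ⟨⟨h1, h2, h3⟩, ⟨h4, h5, h6⟩, h7, h8, h9⟩ := asym₂_table q
  fin_cases i <;> fin_cases j
  · exact h1.symm ▸ zero_mem _
  · exact h2.symm ▸ eMP_mem
  · exact h3.symm ▸ eMZ_mem
  · exact h4.symm ▸ neg_mem eMP_mem
  · exact h5.symm ▸ zero_mem _
  · exact h6.symm ▸ neg_mem eZP_mem
  · exact h7.symm ▸ neg_mem eMZ_mem
  · exact h8.symm ▸ eZP_mem
  · exact h9.symm ▸ zero_mem _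

/-- The right action of an element of `A(SU_q(2))` on the left invariant 2-tensors. -/
def act₂ (h : SUq q) : Module.End ℂ ((fourDPlus q).Inv ⊗[ℂ] (fourDPlus q).Inv) :=
  (fourDPlus q).invAct₂ (.op h)

section tensor
variable {V W : Type*} [AddCommGroup V] [Module ℂ V] [AddCommGroup W] [Module ℂ W]
  (ρ : RAct (SUq q) V) (τ : RAct (SUq q) W) (v : V) (w : W)

theorem tensor_apply (h : SUq q) : (ρ.tensor τ) (.op h) (v ⊗ₜ w) =
    TensorProduct.map (LinearMap.flip (ρ.toLinearMap ∘ₗ (MulOpposite.opLinearEquiv ℂ).toLinearMap) v)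
      (LinearMap.flip (τ.toLinearMap ∘ₗ (MulOpposite.opLinearEquiv ℂ).toLinearMap) w) (Δ q h) := by
  simp only [RAct.tensor, AlgHom.comp_apply, AlgHom.op_apply_apply, MulOpposite.unop_op,
    Bialgebra.comulAlgHom_apply, comul_eq]
  generalize Δ q h = u
  induction u with
  | zero => simp
  | add u v hu hv =>
    simp only [map_add, MulOpposite.op_add, LinearMap.add_apply] at hu hv ⊢
    rw [hu, hv]
  | tmul u v => simp [Module.endTensorEndAlgHom_apply]

theorem tensor_a : (ρ.tensor τ) (.op (a q)) (v ⊗ₜ w) =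
    ρ (.op (a q)) v ⊗ₜ τ (.op (a q)) w - qc q • (ρ (.op (c' q)) v ⊗ₜ τ (.op (c q)) w) := by
  rw [tensor_apply, Δ_a, map_sub, map_smul]; rfl
theorem tensor_a' : (ρ.tensor τ) (.op (a' q)) (v ⊗ₜ w) =
    ρ (.op (a' q)) v ⊗ₜ τ (.op (a' q)) w - qc q • (ρ (.op (c q)) v ⊗ₜ τ (.op (c' q)) w) := by
  rw [tensor_apply, Δ_a', map_sub, map_smul]; rfl
theorem tensor_c : (ρ.tensor τ) (.op (c q)) (v ⊗ₜ w) =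
    ρ (.op (c q)) v ⊗ₜ τ (.op (a q)) w + ρ (.op (a' q)) v ⊗ₜ τ (.op (c q)) w := by
  rw [tensor_apply, Δ_c, map_add]; rfl
theorem tensor_c' : (ρ.tensor τ) (.op (c' q)) (v ⊗ₜ w) =
    ρ (.op (c' q)) v ⊗ₜ τ (.op (a' q)) w + ρ (.op (a q)) v ⊗ₜ τ (.op (c' q)) w := by
  rw [tensor_apply, Δ_c', map_add]; rfl

end tensor

theorem act₂_tmul (v w : (fourDPlus q).Inv) :
    act₂ (a q) (v ⊗ₜ w) =
      act q (a q) v ⊗ₜ act q (a q) w - qc q • (act q (c' q) v ⊗ₜ act q (c q) w) ∧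
    act₂ (a' q) (v ⊗ₜ w) =
      act q (a' q) v ⊗ₜ act q (a' q) w - qc q • (act q (c q) v ⊗ₜ act q (c' q) w) ∧
    act₂ (c q) (v ⊗ₜ w) =
      act q (c q) v ⊗ₜ act q (a q) w + act q (a' q) v ⊗ₜ act q (c q) w ∧
    act₂ (c' q) (v ⊗ₜ w) =
      act q (c' q) v ⊗ₜ act q (a' q) w + act q (a q) v ⊗ₜ act q (c' q) w :=
  ⟨tensor_a .., tensor_a' .., tensor_c .., tensor_c' ..⟩

/-- Although `eMP` contains `eG`, the three two-forms still span a submodule, with the same weight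
shifts as in degree one. -/
theorem act₂_table :
    (act₂ (a q) (eMZ q) = (qc q)⁻¹ • eMZ q ∧ act₂ (a' q) (eMZ q) = qc q • eMZ q ∧
      act₂ (c q) (eMZ q) = 0 ∧ act₂ (c' q) (eMZ q) = 0) ∧
    (act₂ (a q) (eMP q) = eMP q ∧ act₂ (a' q) (eMP q) = eMP q ∧
      act₂ (c q) (eMP q) = (1 + qc q) • eZP q ∧ act₂ (c' q) (eMP q) = (1 + qc q) • eMZ q) ∧
    (act₂ (a q) (eZP q) = (qc q)⁻¹ • eZP q ∧ act₂ (a' q) (eZP q) = qc q • eZP q ∧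
      act₂ (c q) (eZP q) = 0 ∧ act₂ (c' q) (eZP q) = 0) := by
  have h1 := qc_ne_zero q
  refine ⟨⟨?_, ?_, ?_, ?_⟩, ⟨?_, ?_, ?_, ?_⟩, ?_, ?_, ?_, ?_⟩ <;>
  · simp only [eMZ, eMP, eZP, map_add, map_sub, map_smul, act₂_tmul, act_table, tmul_zero,
      zero_tmul, tmul_add, tmul_sub, add_tmul, sub_tmul, tmul_smul, ← smul_tmul']
    try match_scalars <;> (try field_simp) <;> ring

theorem isGraded_two : IsGraded (fourDPlus q).invAct₂ twoWeight (twoFamily q) := by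
  obtain ⟨⟨h1, h2, h3, h4⟩, ⟨h5, h6, h7, h8⟩, h9, h10, h11, h12⟩ := act₂_table (q := q)
  constructor <;> intro i <;> fin_cases i
  · exact h1.symm ▸ Submodule.smul_mem _ _ eMZ_mem
  · exact h5.symm ▸ eMP_mem
  · exact h9.symm ▸ Submodule.smul_mem _ _ eZP_mem
  · exact h2.symm ▸ Submodule.smul_mem _ _ eMZ_mem
  · exact h6.symm ▸ eMP_mem
  · exact h10.symm ▸ Submodule.smul_mem _ _ eZP_mem
  · exact h3.symm ▸ zero_mem _
  · exact h7.symm ▸ Submodule.smul_mem _ _ eZP_mem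
  · exact h11.symm ▸ zero_mem _
  · exact h4.symm ▸ zero_mem _
  · exact h8.symm ▸ Submodule.smul_mem _ _ eMZ_mem
  · exact h12.symm ▸ zero_mem _

/-- A degree 0 two-tensor is a sum of products of degree 0 one-forms. Those are restricted
one-forms, so antisymmetrising gives their wedge products. -/
theorem asym₂_mulTensor_mem {T : SUq q ⊗[ℂ] ((fourDPlus q).Inv ⊗[ℂ] (fourDPlus q).Inv)}
    (hT : T ∈ gradedForms q (sumWeight oneWeight oneWeight)
      (tensFamily (oneFamily q) (oneFamily q)) 0) :
    (asym₂ q).lTensor (SUq q) T ∈ (fourDPlus q).restrict₂ (sphere q) := by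
  replace hT := isGraded_one.le_span_mulTensor _ _ hT
  induction hT using Submodule.span_induction with
  | mem T hT =>
    obtain ⟨θ, hθ, η, hη, rfl⟩ := hT
    exact CalculusIdeal.wedge₂_mem ((mem_restrict₁ θ).2 hθ) ((mem_restrict₁ η).2 hη)
  | zero => rw [map_zero]; exact zero_mem _
  | add x y _ _ hx hy => rw [map_add]; exact add_mem hx hy
  | smul r x _ hx => rw [map_smul]; exact CalculusIdeal.smul_complex_mem r hx

end SUq
end QuantumSphere
end

/-! ### Two-forms on the sphere: both inclusions, and independence. -/

noncomputable section

namespace QuantumSphere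
namespace SUq

open TensorProduct

variable {q : Param}

theorem mem_restrict₂ (x : SUq q ⊗[ℂ] ((fourDPlus q).Inv ⊗[ℂ] (fourDPlus q).Inv)) :
    x ∈ (fourDPlus q).restrict₂ (sphere q) ↔ x ∈ gradedForms q twoWeight (twoFamily q) 0 := by
  constructor
  · refine span_le_gradedForms ?_
    rintro _ ⟨x, hx, y, hy, rfl⟩
    refine map_gradedForms ((asym₂ q).lTensor (SUq q)) ?_
      (isGraded_one.mulTensor_mem (d_mem hx) (d_mem hy))
    rintro ⟨i, j⟩ φ hφ
    exact tmul_mem_gradedForms hφ (asym₂_mem i j) rfl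
  · refine mem_of_mem_gradedForms fun i φ hφ => ?_
    -- Each basis two-form is the antisymmetrisation of one product of basis one-forms with the same
    -- total weight.
    have key : ∀ (u v : Fin 3) (_ : oneWeight u + oneWeight v = twoWeight i),
        φ ⊗ₜ asym₂ q (oneFamily q u ⊗ₜ oneFamily q v) ∈
          (fourDPlus q).restrict₂ (sphere q) := by
      intro u v h
      refine asym₂_mulTensor_mem (T := φ ⊗ₜ (oneFamily q u ⊗ₜ oneFamily q v))
        (Submodule.subset_span ⟨(u, v), φ, ?_, rfl⟩)
      rwa [sumWeight, add_zero, h]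
    obtain ⟨⟨-, h2, h3⟩, -, -, h8, -⟩ := asym₂_table q
    fin_cases i
    · change φ ⊗ₜ eMZ q ∈ _
      exact h3 ▸ key 0 2 rfl
    · change φ ⊗ₜ eMP q ∈ _
      exact h2 ▸ key 0 1 rfl
    · change φ ⊗ₜ eZP q ∈ _
      exact h8 ▸ key 2 1 rfl

theorem dual_eG (j : Fin 4) :
    dual q j (eG q) = ![0, 0, -(1 + qc q + qc q ^ 2), -(1 + (qc q)⁻¹)] j := by
  rw [eG_eq, map_sub, map_smul, map_smul, dual_eZ', dual_eX']
  fin_cases j <;> simp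

/-- The product of two linear functionals. -/
def mulFunctional {V W : Type*} [AddCommGroup V] [Module ℂ V] [AddCommGroup W] [Module ℂ W]
    (f : V →ₗ[ℂ] ℂ) (g : W →ₗ[ℂ] ℂ) : V ⊗[ℂ] W →ₗ[ℂ] ℂ :=
  LinearMap.mul' ℂ ℂ ∘ₗ TensorProduct.map f g

theorem mulFunctional_tmul {V W : Type*} [AddCommGroup V] [Module ℂ V] [AddCommGroup W] [Module ℂ W]
    (f : V →ₗ[ℂ] ℂ) (g : W →ₗ[ℂ] ℂ) (v : V) (w : W) :
    mulFunctional f g (v ⊗ₜ w) = f v * g w := rfl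

theorem isLineBundleSum_one : IsLineBundleSum (fourDPlus q).invAct
    ((fourDPlus q).restrict₁ (sphere q)) oneWeight
    (fun i => (1 : SUq q) ⊗ₜ[ℂ] oneFamily q i) := by
  refine isLineBundleSum_of_isGraded isGraded_one ![dual q 1, dual q 0, dual q 2] ?_ mem_restrict₁
  intro i j
  fin_cases i <;> fin_cases j <;> simp [oneFamily, dual_eP', dual_eM', dual_eZ']

theorem isLineBundleSum_two : IsLineBundleSum (fourDPlus q).invAct₂
    ((fourDPlus q).restrict₂ (sphere q)) twoWeight
    (fun i => (1 : SUq q) ⊗ₜ[ℂ] twoFamily q i) := by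
  have h := qc_ne_zero q
  refine isLineBundleSum_of_isGraded isGraded_two
    -- These read the coefficients of eM ⊗ eZ, eM ⊗ eP and eZ ⊗ eP. The first is rescaled because it
    -- equals q² in `eMZ`, and none of them sees eG ⊗ eZ.
    ![(qc q ^ 2)⁻¹ • mulFunctional (dual q 1) (dual q 2), mulFunctional (dual q 1) (dual q 0),
      mulFunctional (dual q 2) (dual q 0)] ?_ mem_restrict₂
  intro i j
  fin_cases i <;> fin_cases j <;> simp [twoFamily, eMZ, eMP, eZP, mulFunctional_tmul, dual_eP',
    dual_eM', dual_eZ', dual_eG, h]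

/-! ### Three-forms on the sphere -/

/-- The left invariant three-form `[c*] ∧ [c] ∧ [c c*]` up to a factor. -/
def threeFamily (q : Param) :
    Fin 1 → (fourDPlus q).Inv ⊗[ℂ] ((fourDPlus q).Inv ⊗[ℂ] (fourDPlus q).Inv) := ![eMPZ q]
/-- The weight of `threeFamily`. -/
def threeWeight : Fin 1 → ℤ := ![0]

theorem eMPZ_mem : eMPZ q ∈ weightSpan threeWeight (threeFamily q) 0 :=
  mem_weightSpan (threeFamily q) 0 rfl

theorem shuffle₃_mem (k : Fin 3) {m : ℤ} {u : (fourDPlus q).Inv ⊗[ℂ] (fourDPlus q).Inv}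
    (hu : u ∈ weightSpan twoWeight (twoFamily q) m) :
    shuffle₃ q (tens₃ q (oneFamily q k) u) ∈
      weightSpan threeWeight (threeFamily q) (m + oneWeight k) := by
  induction hu using Submodule.span_induction with
  | mem u hu =>
    obtain ⟨i, rfl, rfl⟩ := hu
    obtain ⟨⟨h1, h2, h3⟩, ⟨h4, h5, h6⟩, h7, h8, h9⟩ := shuffle₃_table q
    fin_cases i <;> fin_cases k
    · exact h1.symm ▸ zero_mem _
    · exact h2.symm ▸ neg_mem eMPZ_mem
    · exact h3.symm ▸ zero_mem _
    · exact h4.symm ▸ zero_mem _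
    · exact h5.symm ▸ zero_mem _
    · exact h6.symm ▸ eMPZ_mem
    · exact h7.symm ▸ neg_mem eMPZ_mem
    · exact h8.symm ▸ zero_mem _
    · exact h9.symm ▸ zero_mem _
  | zero => simp
  | add x y _ _ hx hy => rw [map_add, map_add]; exact add_mem hx hy
  | smul r x _ hx => rw [map_smul, map_smul]; exact Submodule.smul_mem _ r hx

theorem asym₃_mem (i j k : Fin 3) :
    asym₃ q (oneFamily q i ⊗ₜ (oneFamily q j ⊗ₜ oneFamily q k)) ∈
      weightSpan threeWeight (threeFamily q) (oneWeight i + (oneWeight j + oneWeight k)) := by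
  rw [asym₃_tmul, ← add_assoc]
  exact shuffle₃_mem k (asym₂_mem i j)

theorem asym₃_eMPZ : asym₃ q (eM q ⊗ₜ (eP q ⊗ₜ eZ q)) = eMPZ q := by
  obtain ⟨-, ⟨-, -, h⟩, -⟩ := shuffle₃_table q
  obtain ⟨⟨-, h2, -⟩, -⟩ := asym₂_table q
  rw [asym₃_tmul, h2, h]

/-- The right action of an element of `A(SU_q(2))` on the left invariant 3-tensors. -/
def act₃ (h : SUq q) :
    Module.End ℂ ((fourDPlus q).Inv ⊗[ℂ] ((fourDPlus q).Inv ⊗[ℂ] (fourDPlus q).Inv)) :=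
  (fourDPlus q).invAct₃ (.op h)

theorem act₃_tmul (v : (fourDPlus q).Inv) (w : (fourDPlus q).Inv ⊗[ℂ] (fourDPlus q).Inv) :
    act₃ (a q) (v ⊗ₜ w) =
      act q (a q) v ⊗ₜ act₂ (a q) w - qc q • (act q (c' q) v ⊗ₜ act₂ (c q) w) ∧
    act₃ (a' q) (v ⊗ₜ w) =
      act q (a' q) v ⊗ₜ act₂ (a' q) w - qc q • (act q (c q) v ⊗ₜ act₂ (c' q) w) ∧
    act₃ (c q) (v ⊗ₜ w) =
      act q (c q) v ⊗ₜ act₂ (a q) w + act q (a' q) v ⊗ₜ act₂ (c q) w ∧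
    act₃ (c' q) (v ⊗ₜ w) =
      act q (c' q) v ⊗ₜ act₂ (a' q) w + act q (a q) v ⊗ₜ act₂ (c' q) w :=
  ⟨tensor_a .., tensor_a' .., tensor_c .., tensor_c' ..⟩

set_option maxHeartbeats 1000000 in
theorem act₃_table :
    act₃ (a q) (eMPZ q) = (qc q)⁻¹ • eMPZ q ∧ act₃ (a' q) (eMPZ q) = qc q • eMPZ q ∧
      act₃ (c q) (eMPZ q) = 0 ∧ act₃ (c' q) (eMPZ q) = 0 := by
  have h1 := qc_ne_zero q
  refine ⟨?_, ?_, ?_, ?_⟩ <;>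
  · simp only [eMPZ, map_add, map_sub, map_smul, act₃_tmul, act₂_tmul, act_table, tmul_zero,
      zero_tmul, tmul_add, tmul_sub, add_tmul, sub_tmul, tmul_smul, ← smul_tmul', smul_zero]
    match_scalars <;> (try field_simp) <;> ring

theorem isGraded_three : IsGraded (fourDPlus q).invAct₃ threeWeight (threeFamily q) := by
  obtain ⟨h1, h2, h3, h4⟩ := act₃_table (q := q)
  constructor <;> intro i <;> fin_cases i
  · exact h1.symm ▸ Submodule.smul_mem _ _ eMPZ_mem
  · exact h2.symm ▸ Submodule.smul_mem _ _ eMPZ_mem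
  · exact h3.symm ▸ zero_mem _
  · exact h4.symm ▸ zero_mem _

/-- The factorisation into degree 0 forms is used twice: once to split off the first one-form, once
to split the remaining two-tensor. -/
theorem asym₃_mulTensor_mem
    {T : SUq q ⊗[ℂ] ((fourDPlus q).Inv ⊗[ℂ] ((fourDPlus q).Inv ⊗[ℂ] (fourDPlus q).Inv))}
    (hT : T ∈ gradedForms q (sumWeight oneWeight (sumWeight oneWeight oneWeight))
      (tensFamily (oneFamily q) (tensFamily (oneFamily q) (oneFamily q))) 0) :
    (asym₃ q).lTensor (SUq q) T ∈ (fourDPlus q).restrict₃ (sphere q) := by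
  replace hT := isGraded_one.le_span_mulTensor _ _ hT
  induction hT using Submodule.span_induction with
  | mem T hT =>
    obtain ⟨θ, hθ, η, hη, rfl⟩ := hT
    replace hη := isGraded_one.le_span_mulTensor _ _ hη
    induction hη using Submodule.span_induction with
    | mem η hη =>
      obtain ⟨η, hη, ζ, hζ, rfl⟩ := hη
      exact CalculusIdeal.wedge₃_mem ((mem_restrict₁ θ).2 hθ) ((mem_restrict₁ η).2 hη)
        ((mem_restrict₁ ζ).2 hζ)
    | zero => rw [RAct.mulTensor_zero_right, map_zero]; exact zero_mem _
    | add x y _ _ hx hy => rw [RAct.mulTensor_add_right, map_add]; exact add_mem hx hy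
    | smul r x _ hx =>
      rw [RAct.mulTensor_smul_right, map_smul]; exact CalculusIdeal.smul_complex_mem r hx
  | zero => rw [map_zero]; exact zero_mem _
  | add x y _ _ hx hy => rw [map_add]; exact add_mem hx hy
  | smul r x _ hx => rw [map_smul]; exact CalculusIdeal.smul_complex_mem r hx

theorem mem_restrict₃
    (x : SUq q ⊗[ℂ] ((fourDPlus q).Inv ⊗[ℂ] ((fourDPlus q).Inv ⊗[ℂ] (fourDPlus q).Inv))) :
    x ∈ (fourDPlus q).restrict₃ (sphere q) ↔ x ∈ gradedForms q threeWeight (threeFamily q) 0 := by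
  constructor
  · refine span_le_gradedForms ?_
    rintro _ ⟨x, hx, y, hy, z, hz, rfl⟩
    refine map_gradedForms ((asym₃ q).lTensor (SUq q)) ?_
      (isGraded_one.mulTensor_mem (d_mem hx) (isGraded_one.mulTensor_mem (d_mem hy) (d_mem hz)))
    rintro ⟨i, j, k⟩ φ hφ
    exact tmul_mem_gradedForms hφ (asym₃_mem i j k) rfl
  · refine mem_of_mem_gradedForms fun i φ hφ => ?_
    have key : φ ⊗ₜ asym₃ q (oneFamily q 0 ⊗ₜ (oneFamily q 1 ⊗ₜ oneFamily q 2)) ∈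
        (fourDPlus q).restrict₃ (sphere q) :=
      asym₃_mulTensor_mem (T := φ ⊗ₜ (oneFamily q 0 ⊗ₜ (oneFamily q 1 ⊗ₜ oneFamily q 2)))
        (Submodule.subset_span ⟨(0, 1, 2), φ, by fin_cases i; exact hφ, rfl⟩)
    fin_cases i
    change φ ⊗ₜ eMPZ q ∈ _
    exact asym₃_eMPZ (q := q) ▸ key

theorem isLineBundleSum_three : IsLineBundleSum (fourDPlus q).invAct₃
    ((fourDPlus q).restrict₃ (sphere q)) threeWeight
    (fun i => (1 : SUq q) ⊗ₜ[ℂ] threeFamily q i) := by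
  refine isLineBundleSum_of_isGraded isGraded_three
    -- This reads the coefficient of eM ⊗ eP ⊗ eZ, which is 1 in `eMPZ`.
    ![mulFunctional (dual q 1) (mulFunctional (dual q 0) (dual q 2))] ?_ mem_restrict₃
  intro i j
  fin_cases i
  fin_cases j
  simp [threeFamily, eMPZ, mulFunctional_tmul, dual_eP', dual_eM', dual_eZ']

end SUq
end QuantumSphere
end

/-! ### Passage from the normalised left invariant forms to ω₋, ω₊, ω₀. -/

theorem proposition2p1 (q : Set.Ioo (0 : ℝ) 1) :
    QuantumSphere.SUq.IsLineBundleSum (QuantumSphere.SUq.fourDPlus q).invAct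
        ((QuantumSphere.SUq.fourDPlus q).restrict₁ (QuantumSphere.SUq.sphere q))
        ![-2, 2, 0]
        ![QuantumSphere.SUq.ωm q, QuantumSphere.SUq.ωp q, QuantumSphere.SUq.ω0 q] ∧
      QuantumSphere.SUq.IsLineBundleSum (QuantumSphere.SUq.fourDPlus q).invAct₂
        ((QuantumSphere.SUq.fourDPlus q).restrict₂ (QuantumSphere.SUq.sphere q))
        ![-2, 0, 2]
        ![(QuantumSphere.SUq.fourDPlus q).wedge₂ (QuantumSphere.SUq.ωm q) (QuantumSphere.SUq.ω0 q),
          (QuantumSphere.SUq.fourDPlus q).wedge₂ (QuantumSphere.SUq.ωm q) (QuantumSphere.SUq.ωp q),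
          (QuantumSphere.SUq.fourDPlus q).wedge₂ (QuantumSphere.SUq.ω0 q) (QuantumSphere.SUq.ωp q)] ∧
      QuantumSphere.SUq.IsLineBundleSum (QuantumSphere.SUq.fourDPlus q).invAct₃
        ((QuantumSphere.SUq.fourDPlus q).restrict₃ (QuantumSphere.SUq.sphere q))
        ![0]
        ![(QuantumSphere.SUq.fourDPlus q).wedge₃
          (QuantumSphere.SUq.ωm q) (QuantumSphere.SUq.ωp q) (QuantumSphere.SUq.ω0 q)] := by
  open QuantumSphere QuantumSphere.SUq in
  have hm := neg_ne_zero.2 (qc_ne_zero q)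
  have h0 := ω0_coeff_ne_zero q
  obtain ⟨⟨-, h2, h3⟩, -, -, h8, -⟩ := asym₂_table q
  rw [ωm_eq, ωp_eq, ω0_eq]
  -- Only the nonvanishing of the normalisation of ω₀ matters from here on. The wedge products are
  -- rescaled by products of the constants -q, 1 and s.
  generalize -((1 + qc q)⁻¹ * (lam q)⁻¹ * qc q * (1 + qc q + qc q ^ 2)) = s at h0 ⊢
  refine ⟨isLineBundleSum_one.smul ![-qc q, 1, s] ?_ ?_,
    isLineBundleSum_two.smul ![-qc q * s, -qc q * 1, s * 1] ?_ ?_,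
    isLineBundleSum_three.smul ![-qc q * (1 * s)] ?_ ?_⟩
  · intro i; fin_cases i
    exacts [hm, one_ne_zero, h0]
  · intro i; fin_cases i <;> rfl
  · intro i; fin_cases i
    exacts [mul_ne_zero hm h0, mul_ne_zero hm one_ne_zero, mul_ne_zero h0 one_ne_zero]
  · intro i; fin_cases i
    · exact (CalculusIdeal.smul_wedge₂_smul _ _ _ _).trans
        (congrArg (fun u => (-qc q * s) • ((1 : SUq q) ⊗ₜ[ℂ] u)) h3)
    · exact (CalculusIdeal.smul_wedge₂_smul _ _ _ _).trans
        (congrArg (fun u => (-qc q * 1) • ((1 : SUq q) ⊗ₜ[ℂ] u)) h2)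
    · exact (CalculusIdeal.smul_wedge₂_smul _ _ _ _).trans
        (congrArg (fun u => (s * 1) • ((1 : SUq q) ⊗ₜ[ℂ] u)) h8)
  · intro i; fin_cases i
    exact mul_ne_zero hm (mul_ne_zero one_ne_zero h0)
  · intro i; fin_cases i
    exact (CalculusIdeal.smul_wedge₃_smul _ _ _ _ _ _).trans
      (congrArg (fun u => (-qc q * (1 * s)) • ((1 : SUq q) ⊗ₜ[ℂ] u)) asym₃_eMPZ)
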